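/- **Setting.** Let $\mathrm{AdS}^3$ be $\mathrm{PSL}_2\mathbb R$ with the bi-invariant Lorentzian metric equal to $\frac18$ of the Killing form, and $\widetilde{\mathrm{AdS}}{}^3=\widetilde{\mathrm{SL}_2\mathbb R}$ its universal cover. Let $\mathrm{Isom}_0(\widetilde{\mathrm{AdS}}{}^3)=(\widetilde{\mathrm{SL}_2\mathbb R}\times\widetilde{\mathrm{SL}_2\mathbb R})/\Delta_{\mathcal Z}$, with $\Delta_{\mathcal Z}$ the diagonal of the centre, act by $(\alpha,\beta)\cdot\gamma=\alpha\gamma\beta^{-1}$. Let $T^1_\star\widetilde{\mathrm{AdS}}{}^3$ be the bundle of future-directed unit timelike tangent vectors $(\gamma,u)$. The timelike geodesics of $\mathrm{AdS}^3$ are the sets $L_{x,y}=\{\gamma\in\mathrm{PSL}_2\mathbb R:\gamma y=x\}$ with $(x,y)\in\mathbb H^2\times\mathbb H^2$; let $$\pi:T^1_\star\widetilde{\mathrm{AdS}}{}^3\to\mathbb H^2\times\mathbb H^2$$ send $(\gamma,u)$ to the $(x,y)$ for which the geodesic issuing from $(\gamma,u)$ projects to $L_{x,y}$. This is a principal $\mathbb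 R$-bundle for the geodesic flow. Let $g_S$ be the Sasaki metric, $\chi$ the generator of the geodesic flow (the horizontal lift of $u$ at $(\gamma,u)$), and let $\omega=-g_S(\chi,\cdot)$, a principal connection form. Let $S$ be a closed oriented surface and let $\rho_l,\rho_r:\pi_1(S)\to\mathrm{PSL}_2\mathbb R$ be Fuchsian, that is, discrete and faithful, and holonomies of hyperbolic structures on $S$ compatible with the orientation. Identify $S$ with $\mathbb H^2/\rho_l(\pi_1 S)$ and with $\mathbb H^2/\rho_r(\pi_1 S)$; let $h_l,h_r$ be the resulting hyperbolic metrics on $S$, with area forms $\Omega_l,\Omega_r$, and on $S\times S$ put $\Omega_\rho=p_l^*\Omega_l-p_r^*\Omega_r$, where $p_l,p_r$ are the two projections. Let $\widetilde\rho:\pi_1(S)\to\mathrm{Isom}_0(\widetilde{\mathrm{AdS}}{}^3)$ be the standard lift of $\rho=(\rho_l,\rho_r)$: the lift of $\rho$ that leaves invariant each connected component of the preimage, in the boundary at infinity of $\widetilde{\mathrm{AdS}}{}^3$ (the covering of $\partial_\infty\mathrm{AdS}^3=\mathbb{RP}^1\times\mathbb{RP}^1$ belonging to the subgroup of $\pi_1(\mathbb{RP}^1\times\mathbb{RP}^1)$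 generated by the diagonal class), of the graph of the orientation-preserving homeomorphism of $\mathbb{RP}^1$ that conjugates $\rho_l$ to $\rho_r$. Put $$P_\rho=T^1_\star\widetilde{\mathrm{AdS}}{}^3/\widetilde\rho(\pi_1 S),\qquad M_\rho=(\mathbb H^2\times\mathbb H^2)/\rho(\pi_1 S).$$ Then $\pi$ induces a principal $\mathbb R$-bundle $P_\rho\to M_\rho$, $\omega$ induces a connection form $\omega_\rho$ on it, and $M_\rho$ covers $\mathbb H^2/\rho_l(\pi_1 S)\times\mathbb H^2/\rho_r(\pi_1 S)=S\times S$. Let $\pi_\rho:P_\rho\to S\times S$ be the composition. For a smooth embedding $\Lambda:S\to S\times S$ let $\Lambda^*P_\rho=\{(s,p)\in S\times P_\rho:\Lambda(s)=\pi_\rho(p)\}$, a $3$-manifold, and let $i:\Lambda^*P_\rho\to P_\rho$, $(s,p)\mapsto p$. The form $i^*\omega_\rho$ is called flat at a point if its curvature $d(i^*\omega_\rho)$ vanishes there. **Statement.** Let $\Lambda:S\to S\times S$ be a smooth embedding. 1. $\Lambda$ is Lagrangian, that is $\Lambda^*\Omega_\rho=0$, if and only if $(\Lambda^*P_\rho,i^*\omega_\rho)$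 is flat. 2. If $\widehat\Lambda:S\to M_\rho$ is a continuous lift of $\Lambda$, then $\Lambda$ is Lagrangian if and only if the principal $\mathbb R$-bundle over $S$ obtained by pulling back $P_\rho\to M_\rho$ by $\widehat\Lambda$ (the open subset of $\Lambda^*P_\rho$ formed by the points $(s,p)$ with $p$ lying over $\widehat\Lambda(s)$), with the connection form induced by $\omega_\rho$, is flat. -/

import Mathlib

open scoped UpperHalfPlane Manifold ContDiff MatrixGroups Topology

noncomputable section

namespace AdSLagrangian

open Matrix

/-! ### `PSL(2, ℝ)` -/

lemma center_smul_upperHalfPlane (g : SL(2, ℝ)) (hg : g ∈ Subgroup.center SL(2, ℝ)) (z : ℍ) :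
    g • z = z := by
  obtain ⟨r, hr, h⟩ := Matrix.SpecialLinearGroup.mem_center_iff.1 hg
  have h00 : g 0 0 = r := by rw [← h]; simp
  have h01 : g 0 1 = 0 := by rw [← h]; simp
  have h10 : g 1 0 = 0 := by rw [← h]; simp
  have h11 : g 1 1 = r := by rw [← h]; simp
  have hr0 : (r : ℂ) ≠ 0 := by
    intro h0
    have : r = 0 := by exact_mod_cast h0
    simp [this] at hr
  ext1
  rw [UpperHalfPlane.coe_specialLinearGroup_apply]
  simp [h00, h01, h10, h11, hr0]

/-- `PSL(2, ℝ)` acts on the upper half-plane by Möbius transformations. -/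
def pslToPerm : PSL(2, ℝ) →* Equiv.Perm ℍ :=
  QuotientGroup.lift _ (MulAction.toPermHom SL(2, ℝ) ℍ) fun g hg => by
    ext1 z
    exact center_smul_upperHalfPlane g hg z

instance : MulAction PSL(2, ℝ) ℍ := MulAction.compHom ℍ pslToPerm

lemma mk_smul (g : SL(2, ℝ)) (z : ℍ) : (QuotientGroup.mk g : PSL(2, ℝ)) • z = g • z := rfl

/-- `SL(2, ℝ)` acting on `ℝP¹ = ℝ ∪ {∞}` by Möbius transformations. -/
def slToPermBoundary : SL(2, ℝ) →* Equiv.Perm (OnePoint ℝ) :=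
  (MulAction.toPermHom (GL (Fin 2) ℝ) (OnePoint ℝ)).comp Matrix.SpecialLinearGroup.toGL

/-- `PSL(2, ℝ)` acting on `ℝP¹ = ℝ ∪ {∞}`, the visual boundary of the hyperbolic plane. -/
def pslToPermBoundary : PSL(2, ℝ) →* Equiv.Perm (OnePoint ℝ) :=
  QuotientGroup.lift _ slToPermBoundary fun g hg => by
    obtain ⟨r, hr, h⟩ := Matrix.SpecialLinearGroup.mem_center_iff.1 hg
    have h00 : g 0 0 = r := by rw [← h]; simp
    have h01 : g 0 1 = 0 := by rw [← h]; simp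
    have h10 : g 1 0 = 0 := by rw [← h]; simp
    have h11 : g 1 1 = r := by rw [← h]; simp
    have hr0 : r ≠ 0 := by
      rintro rfl
      simp at hr
    ext1 ξ
    change (Matrix.SpecialLinearGroup.toGL g) • ξ = ξ
    induction ξ using OnePoint.rec with
    | infty => simp [OnePoint.smul_infty_eq_ite, h10]
    | coe t => simp [OnePoint.smul_some_eq_ite, h10, h11, h00, h01, hr0]

instance : MulAction PSL(2, ℝ) (OnePoint ℝ) := MulAction.compHom _ pslToPermBoundary

/-! ### The universal cover of `SL(2, ℝ)` -/

/-- The automorphy factor `c z + d`. -/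
def autFactor (g : SL(2, ℝ)) (z : ℍ) : ℂ := (g 1 0 : ℂ) * z + (g 1 1 : ℂ)

lemma autFactor_ne_zero (g : SL(2, ℝ)) (z : ℍ) : autFactor g z ≠ 0 := by
  have := UpperHalfPlane.denom_ne_zero (g : GL (Fin 2) ℝ) z
  simpa [autFactor, UpperHalfPlane.denom] using this

lemma coe_smul_mul_autFactor (g : SL(2, ℝ)) (z : ℍ) :
    ((g • z : ℍ) : ℂ) * autFactor g z = (g 0 0 : ℂ) * z + (g 0 1 : ℂ) := by
  rw [UpperHalfPlane.coe_specialLinearGroup_apply]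
  exact div_mul_cancel₀ _ (autFactor_ne_zero g z)

lemma autFactor_mul (g h : SL(2, ℝ)) (z : ℍ) :
    autFactor (g * h) z = autFactor g (h • z) * autFactor h z := by
  have e := coe_smul_mul_autFactor h z
  have : autFactor g (h • z) * autFactor h z
      = g 1 0 * (((h • z : ℍ) : ℂ) * autFactor h z) + g 1 1 * autFactor h z := by
    simp only [autFactor]; ring
  rw [this, e]
  simp [autFactor, Matrix.mul_apply, Fin.sum_univ_two]
  ring

lemma autFactor_one (z : ℍ) : autFactor 1 z = 1 := by simp [autFactor]

/-- The universal cover of `SL(2, ℝ)` (and of `PSL(2, ℝ)`): matrices `g` in `SL(2, ℝ)` together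
with a continuous logarithm on `ℍ` of the nowhere vanishing function `z ↦ c z + d`. The logarithms
of a given `g` differ by the constants `2πin`. -/
@[ext]
structure SL2Tilde where
  mat : SL(2, ℝ)
  log : ℍ → ℂ
  continuous_log : Continuous log
  exp_log : ∀ z, Complex.exp (log z) = autFactor mat z

namespace SL2Tilde

lemma continuous_smul' (g : SL(2, ℝ)) : Continuous fun z : ℍ => g • z :=
  continuous_const_smul g

instance : Mul SL2Tilde where
  mul α β :=
    { mat := α.mat * β.mat
      log := fun z => α.log (β.mat • z) + β.log z
      continuous_log :=
        (α.continuous_log.comp (continuous_smul' _)).add β.continuous_log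
      exp_log := fun z => by rw [Complex.exp_add, α.exp_log, β.exp_log, autFactor_mul] }

instance : One SL2Tilde where
  one :=
    { mat := 1
      log := fun _ => 0
      continuous_log := continuous_const
      exp_log := fun z => by rw [Complex.exp_zero, autFactor_one] }

instance : Inv SL2Tilde where
  inv α :=
    { mat := α.mat⁻¹
      log := fun z => -α.log (α.mat⁻¹ • z)
      continuous_log := (α.continuous_log.comp (continuous_smul' _)).neg
      exp_log := fun z => by
        have h := autFactor_mul α.mat α.mat⁻¹ z
        rw [mul_inv_cancel, autFactor_one] at h
        rw [Complex.exp_neg, α.exp_log]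
        exact (eq_inv_of_mul_eq_one_right h.symm).symm }

@[simp] lemma mul_mat (α β : SL2Tilde) : (α * β).mat = α.mat * β.mat := rfl
@[simp] lemma mul_log (α β : SL2Tilde) (z : ℍ) :
    (α * β).log z = α.log (β.mat • z) + β.log z := rfl
@[simp] lemma one_mat : (1 : SL2Tilde).mat = 1 := rfl
@[simp] lemma one_log (z : ℍ) : (1 : SL2Tilde).log z = 0 := rfl
@[simp] lemma inv_mat (α : SL2Tilde) : (α⁻¹).mat = α.mat⁻¹ := rfl
@[simp] lemma inv_log (α : SL2Tilde) (z : ℍ) : (α⁻¹).log z = -α.log (α.mat⁻¹ • z) := rfl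

instance : Group SL2Tilde :=
  Group.ofLeftAxioms
    (fun α β γ => SL2Tilde.ext (mul_assoc _ _ _) (by
      funext z; simp only [mul_log, mul_mat, mul_smul]; ring))
    (fun α => SL2Tilde.ext (one_mul _) (by funext z; simp))
    (fun α => SL2Tilde.ext (inv_mul_cancel _) (by funext z; simp))

/-- The covering homomorphism onto `PSL(2, ℝ)`. -/
def toPSL : SL2Tilde →* PSL(2, ℝ) where
  toFun α := QuotientGroup.mk α.mat
  map_one' := rfl
  map_mul' _ _ := rfl

/-- Two continuous logarithms that agree at one point agree. -/
lemma ext_of_log_eq {α β : SL2Tilde} (hm : α.mat = β.mat) (z₀ : ℍ)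
    (h : α.log z₀ = β.log z₀) : α = β := by
  refine SL2Tilde.ext hm ?_
  have hexp : ∀ z, Complex.exp (α.log z) = Complex.exp (β.log z) := fun z => by
    rw [α.exp_log, β.exp_log, hm]
  have hc : Continuous fun z => ((α.log z - β.log z) / (2 * Real.pi * Complex.I)).re := by
    have := α.continuous_log
    have := β.continuous_log
    fun_prop
  have hpi : (2 * Real.pi * Complex.I : ℂ) ≠ 0 := Complex.two_pi_I_ne_zero
  have key : ∀ z, ∃ n : ℤ, α.log z - β.log z = n * (2 * Real.pi * Complex.I) := fun z => by
    obtain ⟨n, hn⟩ := Complex.exp_eq_exp_iff_exists_int.1 (hexp z)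
    exact ⟨n, by rw [hn]; ring⟩
  choose n hn using key
  have hfun : (fun z => ((α.log z - β.log z) / (2 * Real.pi * Complex.I)).re)
      = fun z => ((n z : ℤ) : ℝ) := by
    funext z
    rw [hn z, mul_div_cancel_right₀ _ hpi]
    simp
  rw [hfun] at hc
  have hcn : Continuous n := by
    rw [Int.isClosedEmbedding_coe_real.isEmbedding.continuous_iff]; exact hc
  have : ∀ z, n z = n z₀ := fun z => PreconnectedSpace.constant inferInstance hcn
  have h0 : n z₀ = 0 := by
    have := hn z₀
    rw [h, sub_self] at this
    have := (mul_eq_zero.1 this.symm).resolve_right hpi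
    exact_mod_cast this
  funext z
  have := hn z
  rw [‹∀ z, n z = n z₀› z, h0] at this
  simpa [sub_eq_zero] using this

/-- The generator of the infinite cyclic center `𝒵`, which is also the kernel of `toPSL`. -/
def zeta : SL2Tilde where
  mat := -1
  log _ := Real.pi * Complex.I
  continuous_log := continuous_const
  exp_log z := by simp [autFactor, Complex.exp_pi_mul_I]

lemma zeta_mul (α : SL2Tilde) : zeta * α = α * zeta := by
  refine SL2Tilde.ext ?_ ?_
  · simp [zeta]
  · funext z
    have : (-1 : SL(2, ℝ)) • z = z := by
      simpa using center_smul_upperHalfPlane (-1) (by simp [Subgroup.mem_center_iff]) z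
    simp only [mul_log]
    simp only [zeta, this]
    ring

end SL2Tilde

/-- The group `Isom₀` of the universal cover of Anti-de Sitter space:
`(SL₂~ × SL₂~) / Δ_𝒵`, where `Δ_𝒵` is the diagonal of the center. -/
def diagCenter : Subgroup (SL2Tilde × SL2Tilde) :=
  Subgroup.zpowers (SL2Tilde.zeta, SL2Tilde.zeta)

instance : diagCenter.Normal := by
  have hc : (SL2Tilde.zeta, SL2Tilde.zeta) ∈ Subgroup.center (SL2Tilde × SL2Tilde) := by
    rw [Subgroup.mem_center_iff]
    rintro ⟨α, β⟩
    simp [SL2Tilde.zeta_mul]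
  have hle : diagCenter ≤ Subgroup.center _ := by
    rw [diagCenter, Subgroup.zpowers_le]; exact hc
  refine ⟨fun n hn g => ?_⟩
  have h := Subgroup.mem_center_iff.1 (hle hn) g
  rwa [h, mul_inv_cancel_right]

abbrev Isom0 : Type := (SL2Tilde × SL2Tilde) ⧸ diagCenter

/-! ### Anti-de Sitter space and its unit future timelike tangent bundle -/

/-- The Anti-de Sitter metric, `1/8` of the Killing form `κ(X, Y) = 4 tr (XY)` of `𝔰𝔩(2, ℝ)`, on
the tangent space `{X | tr (g⁻¹X) = 0}` of `SL(2, ℝ)` at `g`. The universal cover is locally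
isometric to `SL(2, ℝ)`, so tangent vectors at `γ : SL2Tilde` are written as matrices tangent
to `SL(2, ℝ)` at `γ.mat`. -/
def adsMetric (g : SL(2, ℝ)) (X Y : Matrix (Fin 2) (Fin 2) ℝ) : ℝ :=
  (1 / 8) * (4 * (((g⁻¹ : SL(2, ℝ)) : Matrix (Fin 2) (Fin 2) ℝ) * X *
    ((g⁻¹ : SL(2, ℝ)) : Matrix (Fin 2) (Fin 2) ℝ) * Y).trace)

/-- The bundle of unit future-directed timelike vectors `vec` tangent to the universal cover of
Anti-de Sitter space at `pt`. The future is the side of the generators of counterclockwise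
rotations of the hyperbolic plane. -/
@[ext]
structure UnitTimelike where
  pt : SL2Tilde
  vec : Matrix (Fin 2) (Fin 2) ℝ
  tangent : (((pt.mat⁻¹ : SL(2, ℝ)) : Matrix (Fin 2) (Fin 2) ℝ) * vec).trace = 0
  unit : adsMetric pt.mat vec vec = -1
  future : (((pt.mat⁻¹ : SL(2, ℝ)) : Matrix (Fin 2) (Fin 2) ℝ) * vec) 1 0 < 0

/-- The vector of `𝔰𝔩(2, ℝ)` generating the counterclockwise rotations about `z`,
`d/dθ` at `θ = 0` of the rotation of angle `2θ`. -/
def rotGen (z : ℍ) : Matrix (Fin 2) (Fin 2) ℝ :=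
  !![-z.re / z.im, (z.re ^ 2 + z.im ^ 2) / z.im; -1 / z.im, z.re / z.im]

namespace UnitTimelike

/-- The left translate of the vector to the Lie algebra. -/
def body (T : UnitTimelike) : Matrix (Fin 2) (Fin 2) ℝ :=
  ((T.pt.mat⁻¹ : SL(2, ℝ)) : Matrix (Fin 2) (Fin 2) ℝ) * T.vec

lemma body_11 (T : UnitTimelike) : T.body 1 1 = -T.body 0 0 := by
  have := T.tangent
  rw [Matrix.trace_fin_two] at this
  simp only [body]; linarith

lemma body_neg (T : UnitTimelike) : T.body 1 0 < 0 := T.future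

lemma body_sq (T : UnitTimelike) : T.body 0 0 ^ 2 + T.body 0 1 * T.body 1 0 = -1 := by
  have h := T.unit
  have h2 : adsMetric T.pt.mat T.vec T.vec = (1 / 8) * (4 * (T.body * T.body).trace) := by
    simp only [adsMetric, body, Matrix.mul_assoc]
  rw [h2, Matrix.trace_fin_two] at h
  simp only [Matrix.mul_apply, Fin.sum_univ_two, T.body_11] at h
  linarith

lemma mat_mul_body (T : UnitTimelike) : (T.pt.mat : Matrix (Fin 2) (Fin 2) ℝ) * T.body = T.vec := by
  rw [body, ← Matrix.mul_assoc, ← Matrix.SpecialLinearGroup.coe_mul, mul_inv_cancel]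
  simp

/-- The point of the hyperbolic plane fixed by the elliptic one-parameter group generated by the
left translate of the vector. -/
def right (T : UnitTimelike) : ℍ :=
  UpperHalfPlane.mk ((T.body 0 0 - Complex.I) / T.body 1 0) (by
    have h := T.body_neg
    rw [Complex.div_ofReal_im]
    simp only [Complex.sub_im, Complex.ofReal_im, Complex.I_im]
    exact div_pos_of_neg_of_neg (by norm_num) h)

lemma right_re (T : UnitTimelike) : T.right.re = T.body 0 0 / T.body 1 0 := by
  change (((T.body 0 0 - Complex.I) / T.body 1 0 : ℂ)).re = _
  rw [Complex.div_ofReal_re]; simp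

lemma right_im (T : UnitTimelike) : T.right.im = -1 / T.body 1 0 := by
  change (((T.body 0 0 - Complex.I) / T.body 1 0 : ℂ)).im = _
  rw [Complex.div_ofReal_im]; simp

lemma body_eq (T : UnitTimelike) : T.body = rotGen T.right := by
  have hr : T.body 1 0 ≠ 0 := T.body_neg.ne
  have hs := T.body_sq
  ext i j
  fin_cases i <;> fin_cases j <;> simp [rotGen, right_re, right_im, T.body_11]
  all_goals field_simp
  linarith

/-- The projection `π` to `ℍ × ℍ`: the geodesic issuing from `(γ, u)` projects to
`L_{x,y} = {γ ∈ PSL(2, ℝ) | γ y = x}`; here `y` is the fixed point of the one-parameter group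
generated by `γ⁻¹u` and `x = γ y`. -/
def proj (T : UnitTimelike) : ℍ × ℍ := (T.pt.mat • T.right, T.right)

/-- The point `cos t γ + sin t u` at time `t` of the geodesic issuing from `(γ, u)` maps `y` to `x`,
if `(x, y)` is the projection of `(γ, u)`. -/
lemma geodesic_maps (T : UnitTimelike) (t : ℝ) :
    ∃ g : SL(2, ℝ),
      (g : Matrix (Fin 2) (Fin 2) ℝ) = Real.cos t • (T.pt.mat : Matrix (Fin 2) (Fin 2) ℝ)
        + Real.sin t • T.vec ∧ g • T.proj.2 = T.proj.1 := by
  have hr : T.body 1 0 ≠ 0 := T.body_neg.ne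
  have hs := T.body_sq
  have htr := Real.sin_sq_add_cos_sq t
  let e : SL(2, ℝ) := ⟨Real.cos t • (1 : Matrix (Fin 2) (Fin 2) ℝ) + Real.sin t • T.body, by
    rw [Matrix.det_fin_two]
    simp [T.body_11]
    linear_combination htr - Real.sin t ^ 2 * hs⟩
  refine ⟨T.pt.mat * e, ?_, ?_⟩
  · rw [Matrix.SpecialLinearGroup.coe_mul]
    simp [e, Matrix.mul_add, T.mat_mul_body]
  · rw [mul_smul]
    change T.pt.mat • e • T.right = T.pt.mat • T.right
    congr 1
    ext1
    have hne := autFactor_ne_zero e T.right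
    have h := coe_smul_mul_autFactor e T.right
    refine mul_right_cancel₀ hne (h.trans ?_)
    have hc : ((T.right : ℍ) : ℂ) = (T.body 0 0 - Complex.I) / T.body 1 0 := rfl
    have hrc : (T.body 1 0 : ℂ) ≠ 0 := by exact_mod_cast hr
    have hsc : (T.body 0 0 : ℂ) ^ 2 + T.body 0 1 * T.body 1 0 = -1 := by exact_mod_cast hs
    simp only [autFactor, hc]
    simp [e, T.body_11]
    field_simp
    linear_combination (Complex.sin t) * hsc - (Complex.sin t) * Complex.I_sq

/-- The global coordinates `(θ, x, y)`: `(x, y)` is the projection and `θ` is the argument of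
`c y + d` determined by the chosen logarithm. -/
def coords (T : UnitTimelike) : ℝ × ℍ × ℍ :=
  ((T.pt.log T.right).im, T.pt.mat • T.right, T.right)

end UnitTimelike

/-- The value of `c y + d` at the point with coordinates `(θ, x, y)`. -/
def frameFactor (θ : ℝ) (x y : ℍ) : ℂ :=
  Real.sqrt (y.im / x.im) * Complex.exp (θ * Complex.I)

lemma frameFactor_ne_zero (θ : ℝ) (x y : ℍ) : frameFactor θ x y ≠ 0 := by
  have : Real.sqrt (y.im / x.im) ≠ 0 := (Real.sqrt_pos.2 (div_pos y.im_pos x.im_pos)).ne'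
  exact mul_ne_zero (by exact_mod_cast this) (Complex.exp_ne_zero _)

lemma normSq_frameFactor (θ : ℝ) (x y : ℍ) :
    Complex.normSq (frameFactor θ x y) = y.im / x.im := by
  rw [frameFactor, Complex.normSq_mul, Complex.normSq_ofReal,
    Real.mul_self_sqrt (div_pos y.im_pos x.im_pos).le, Complex.normSq_eq_norm_sq,
    Complex.norm_exp_ofReal_mul_I]
  simp

/-- The matrix `g` with `g y = x` and `c y + d` equal to `frameFactor θ x y`. -/
def frameMat (θ : ℝ) (x y : ℍ) : SL(2, ℝ) :=
  ⟨!![(x * frameFactor θ x y).im / y.im,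
      (x * frameFactor θ x y).re - (x * frameFactor θ x y).im / y.im * y.re;
      (frameFactor θ x y).im / y.im,
      (frameFactor θ x y).re - (frameFactor θ x y).im / y.im * y.re], by
    have h := normSq_frameFactor θ x y
    have hx := x.im_pos.ne'
    have hy := y.im_pos.ne'
    rw [Complex.normSq_apply] at h
    rw [Matrix.det_fin_two]
    simp only [Complex.mul_re, Complex.mul_im, UpperHalfPlane.coe_re, UpperHalfPlane.coe_im,
      Matrix.of_apply, Matrix.cons_val', Matrix.cons_val_zero, Matrix.cons_val_one,
      Matrix.cons_val_fin_one]
    field_simp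
    field_simp at h
    linear_combination y.im * h⟩

lemma autFactor_frameMat (θ : ℝ) (x y : ℍ) :
    autFactor (frameMat θ x y) y = frameFactor θ x y := by
  have hy := y.im_pos.ne'
  apply Complex.ext <;> simp [autFactor, frameMat] <;> field_simp

lemma frameMat_smul (θ : ℝ) (x y : ℍ) : frameMat θ x y • y = x := by
  have hy := y.im_pos.ne'
  ext1
  refine mul_right_cancel₀ (autFactor_ne_zero (frameMat θ x y) y) ?_
  rw [coe_smul_mul_autFactor, autFactor_frameMat]
  apply Complex.ext <;> simp [frameMat] <;> field_simp

/-- The value at any two points of `c z + d` never have a negative quotient. -/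
lemma autFactor_div_mem_slitPlane (g : SL(2, ℝ)) (z w : ℍ) :
    autFactor g z / autFactor g w ∈ Complex.slitPlane := by
  rw [Complex.mem_slitPlane_iff_not_le_zero]
  intro h
  obtain ⟨hre, him⟩ := Complex.le_def.1 h
  set k := autFactor g z / autFactor g w with hk
  have hw := autFactor_ne_zero g w
  have hkk : autFactor g z = k.re * autFactor g w := by
    have : k = (k.re : ℂ) := Complex.ext (by simp) (by simpa using him)
    rw [← this, hk, div_mul_cancel₀ _ hw]
  simp only [Complex.zero_re] at hre
  have h1 := congrArg Complex.im hkk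
  have h2 := congrArg Complex.re hkk
  simp [autFactor] at h1 h2
  have hz := z.im_pos
  have hwp := w.im_pos
  have hc : g 1 0 = 0 := by
    have : g 1 0 * (z.im - k.re * w.im) = 0 := by linarith
    refine (mul_eq_zero.1 this).resolve_right ?_
    nlinarith
  have hd : g 1 1 = 0 := by
    rw [hc] at h2
    have : g 1 1 * (1 - k.re) = 0 := by linarith
    refine (mul_eq_zero.1 this).resolve_right ?_
    nlinarith
  exact hw (by simp [autFactor, hc, hd])

lemma autFactor_continuous (g : SL(2, ℝ)) : Continuous (autFactor g) := by
  unfold autFactor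
  have := UpperHalfPlane.continuous_coe
  fun_prop

/-- The point of the universal cover over `frameMat θ x y` whose logarithm at `y` has imaginary
part `θ`. -/
def framePt (θ : ℝ) (x y : ℍ) : SL2Tilde where
  mat := frameMat θ x y
  log z := Real.log (Real.sqrt (y.im / x.im)) + θ * Complex.I
    + Complex.log (autFactor (frameMat θ x y) z / autFactor (frameMat θ x y) y)
  continuous_log := by
    refine continuous_const.add ?_
    refine Continuous.clog ((autFactor_continuous _).div_const _) ?_
    exact fun z => autFactor_div_mem_slitPlane _ z y
  exp_log z := by
    have h0 := autFactor_ne_zero (frameMat θ x y) y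
    have hz := autFactor_ne_zero (frameMat θ x y) z
    have hs : 0 < Real.sqrt (y.im / x.im) := Real.sqrt_pos.2 (div_pos y.im_pos x.im_pos)
    rw [Complex.exp_add, Complex.exp_add, Complex.exp_log (div_ne_zero hz h0), ← Complex.ofReal_exp,
      Real.exp_log hs, autFactor_frameMat]
    change frameFactor θ x y * _ = _
    rw [mul_div_cancel₀ _ (frameFactor_ne_zero θ x y)]

lemma framePt_log_im (θ : ℝ) (x y : ℍ) : ((framePt θ x y).log y).im = θ := by
  simp [framePt, div_self (autFactor_ne_zero (frameMat θ x y) y)]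

lemma framePt_log_re (θ : ℝ) (x y : ℍ) :
    ((framePt θ x y).log y).re = Real.log (Real.sqrt (y.im / x.im)) := by
  simp [framePt, div_self (autFactor_ne_zero (frameMat θ x y) y)]

lemma inv_mul_frame (g : SL(2, ℝ)) (B : Matrix (Fin 2) (Fin 2) ℝ) :
    ((g⁻¹ : SL(2, ℝ)) : Matrix (Fin 2) (Fin 2) ℝ) * ((g : Matrix (Fin 2) (Fin 2) ℝ) * B) = B := by
  rw [← Matrix.mul_assoc, ← Matrix.SpecialLinearGroup.coe_mul, inv_mul_cancel]
  simp

/-- The unit timelike vector with coordinates `(θ, x, y)`. -/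
def frame (q : ℝ × ℍ × ℍ) : UnitTimelike where
  pt := framePt q.1 q.2.1 q.2.2
  vec := (frameMat q.1 q.2.1 q.2.2 : Matrix (Fin 2) (Fin 2) ℝ) * rotGen q.2.2
  tangent := by
    change (((frameMat q.1 q.2.1 q.2.2)⁻¹ : SL(2, ℝ)) * _ : Matrix (Fin 2) (Fin 2) ℝ).trace = 0
    rw [inv_mul_frame]
    simp [rotGen, Matrix.trace_fin_two]
    ring
  unit := by
    change adsMetric (frameMat q.1 q.2.1 q.2.2) _ _ = -1
    rw [adsMetric, inv_mul_frame, Matrix.mul_assoc, inv_mul_frame, Matrix.trace_fin_two]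
    have := q.2.2.im_pos.ne'
    simp [rotGen, Matrix.mul_apply, Fin.sum_univ_two]
    field_simp
    ring
  future := by
    change (((frameMat q.1 q.2.1 q.2.2)⁻¹ : SL(2, ℝ)) * _ : Matrix (Fin 2) (Fin 2) ℝ) 1 0 < 0
    rw [inv_mul_frame]
    have := q.2.2.im_pos
    simpa [rotGen, neg_div] using this

lemma frame_body (q : ℝ × ℍ × ℍ) : (frame q).body = rotGen q.2.2 := inv_mul_frame _ _

lemma frame_right (q : ℝ × ℍ × ℍ) : (frame q).right = q.2.2 := by
  have h := q.2.2.im_pos.ne'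
  refine UpperHalfPlane.ext_re_im ?_ ?_
  · rw [UnitTimelike.right_re, frame_body]
    simp [rotGen]
    field_simp
  · rw [UnitTimelike.right_im, frame_body]
    simp [rotGen]

/-- The coordinates are a bijection onto `ℝ × ℍ × ℍ`. -/
def coordEquiv : UnitTimelike ≃ ℝ × ℍ × ℍ where
  toFun := UnitTimelike.coords
  invFun := frame
  left_inv T := by
    set y := T.right with hy
    set x := T.pt.mat • y with hx
    set θ := (T.pt.log y).im with hθ
    have hq : T.coords = (θ, x, y) := rfl
    rw [hq]
    have hfac : autFactor T.pt.mat y = frameFactor θ x y := by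
      have h1 := T.pt.exp_log y
      have him : x.im = y.im / Complex.normSq (autFactor T.pt.mat y) := by
        have h := UpperHalfPlane.im_smul_eq_div_normSq (T.pt.mat : GL (Fin 2) ℝ) y
        have h2 : (T.pt.mat : GL (Fin 2) ℝ) • y = x := by
          ext1
          rw [hx, UpperHalfPlane.coe_specialLinearGroup_apply,
            UpperHalfPlane.coe_smul_of_det_pos (by simp)]
          rfl
        rw [h2] at h
        simpa [autFactor, UpperHalfPlane.denom] using h
      have hn : ‖autFactor T.pt.mat y‖ = Real.sqrt (y.im / x.im) := by
        have hy0 := y.im_pos.ne'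
        have hn0 : Complex.normSq (autFactor T.pt.mat y) ≠ 0 := by
          simpa using autFactor_ne_zero T.pt.mat y
        rw [him, div_div_cancel₀ hy0, Complex.normSq_eq_norm_sq, Real.sqrt_sq (norm_nonneg _)]
      rw [frameFactor, ← hn, ← h1, Complex.norm_exp, Complex.ofReal_exp, ← Complex.exp_add,
        hθ, Complex.re_add_im]
    have hmat : frameMat θ x y = T.pt.mat := by
      have hy0 := y.im_pos.ne'
      have e1 := coe_smul_mul_autFactor T.pt.mat y
      rw [hfac] at e1
      change (x : ℂ) * _ = _ at e1
      have e1r := congrArg Complex.re e1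
      have e1i := congrArg Complex.im e1
      have e2r := congrArg Complex.re hfac
      have e2i := congrArg Complex.im hfac
      set J := frameFactor θ x y with hJ
      have r1 : (x * J).re = T.pt.mat 0 0 * y.re + T.pt.mat 0 1 := by rw [e1r]; simp
      have r2 : (x * J).im = T.pt.mat 0 0 * y.im := by rw [e1i]; simp
      have r3 : J.re = T.pt.mat 1 0 * y.re + T.pt.mat 1 1 := by rw [← e2r]; simp [autFactor]
      have r4 : J.im = T.pt.mat 1 0 * y.im := by rw [← e2i]; simp [autFactor]
      ext i j
      fin_cases i <;> fin_cases j
      · change (x * J).im / y.im = T.pt.mat 0 0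
        rw [r2]; field_simp
      · change (x * J).re - (x * J).im / y.im * y.re = T.pt.mat 0 1
        rw [r1, r2]; field_simp; ring
      · change J.im / y.im = T.pt.mat 1 0
        rw [r4]; field_simp
      · change J.re - J.im / y.im * y.re = T.pt.mat 1 1
        rw [r3, r4]; field_simp; ring
    have hpt : framePt θ x y = T.pt := by
      refine SL2Tilde.ext_of_log_eq hmat y (Complex.ext ?_ (framePt_log_im θ x y))
      have h1 := T.pt.exp_log y
      have h2 := (framePt θ x y).exp_log y
      change _ = autFactor (frameMat θ x y) y at h2
      rw [hmat] at h2
      have h3 := congrArg norm (h1.trans h2.symm)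
      rw [Complex.norm_exp, Complex.norm_exp] at h3
      exact (Real.exp_injective h3).symm
    refine UnitTimelike.ext hpt ?_
    change (frameMat θ x y : Matrix (Fin 2) (Fin 2) ℝ) * rotGen y = _
    rw [hmat, hy, ← T.body_eq, T.mat_mul_body]
  right_inv q := by
    rw [UnitTimelike.coords, frame_right]
    refine Prod.ext (framePt_log_im _ _ _) (Prod.ext ?_ rfl)
    exact frameMat_smul _ _ _

/-- The topology of the unit tangent bundle, in which the coordinates `(θ, x, y)` are a
homeomorphism. -/
instance : TopologicalSpace UnitTimelike := TopologicalSpace.induced coordEquiv inferInstance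

def coordHomeo : UnitTimelike ≃ₜ ℝ × ℍ × ℍ := coordEquiv.toHomeomorphOfIsInducing ⟨rfl⟩

lemma isOpenEmbedding_coordMap : Topology.IsOpenEmbedding fun T : UnitTimelike =>
    (((coordHomeo T).1, ((coordHomeo T).2.1 : ℂ), ((coordHomeo T).2.2 : ℂ)) : ℝ × ℂ × ℂ) :=
  (Topology.IsOpenEmbedding.id.prodMap (UpperHalfPlane.isOpenEmbedding_coe.prodMap
    UpperHalfPlane.isOpenEmbedding_coe)).comp coordHomeo.isOpenEmbedding

instance : Nonempty UnitTimelike := ⟨frame (0, UpperHalfPlane.I, UpperHalfPlane.I)⟩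

/-- The smooth structure of the unit tangent bundle, with the single global chart
`(θ, x, y)`. -/
instance : ChartedSpace (ℝ × ℂ × ℂ) UnitTimelike :=
  isOpenEmbedding_coordMap.singletonChartedSpace

instance : IsManifold 𝓘(ℝ, ℝ × ℂ × ℂ) ∞ UnitTimelike :=
  isOpenEmbedding_coordMap.isManifold_singleton

/-! ### Isometries -/

lemma pairAct_body (g : SL2Tilde × SL2Tilde) (T : UnitTimelike) :
    (((g.1 * T.pt * g.2⁻¹).mat⁻¹ : SL(2, ℝ)) : Matrix (Fin 2) (Fin 2) ℝ) *
      ((g.1.mat : Matrix (Fin 2) (Fin 2) ℝ) * T.vec *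
        ((g.2.mat⁻¹ : SL(2, ℝ)) : Matrix (Fin 2) (Fin 2) ℝ))
      = (g.2.mat : Matrix (Fin 2) (Fin 2) ℝ) * T.body *
        ((g.2.mat⁻¹ : SL(2, ℝ)) : Matrix (Fin 2) (Fin 2) ℝ) := by
  have h : (g.1 * T.pt * g.2⁻¹).mat⁻¹ = g.2.mat * T.pt.mat⁻¹ * g.1.mat⁻¹ := by
    simp [mul_assoc]
  rw [h]
  simp only [Matrix.SpecialLinearGroup.coe_mul, Matrix.mul_assoc, inv_mul_frame,
    UnitTimelike.body]


lemma adsMetric_eq (g : SL(2, ℝ)) (X : Matrix (Fin 2) (Fin 2) ℝ) :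
    adsMetric g X X = (1 / 8) * (4 * ((((g⁻¹ : SL(2, ℝ)) : Matrix (Fin 2) (Fin 2) ℝ) * X) *
      (((g⁻¹ : SL(2, ℝ)) : Matrix (Fin 2) (Fin 2) ℝ) * X)).trace) := by
  simp only [adsMetric, Matrix.mul_assoc]

lemma conj_10 (B : SL(2, ℝ)) (X : Matrix (Fin 2) (Fin 2) ℝ) :
    ((B : Matrix (Fin 2) (Fin 2) ℝ) * X * ((B⁻¹ : SL(2, ℝ)) : Matrix (Fin 2) (Fin 2) ℝ)) 1 0
      = X 1 0 * B 1 1 ^ 2 + (X 0 0 - X 1 1) * B 1 0 * B 1 1 - X 0 1 * B 1 0 ^ 2 := by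
  rw [Matrix.SpecialLinearGroup.coe_inv, Matrix.adjugate_fin_two]
  simp [Matrix.mul_apply, Fin.sum_univ_two]
  ring

lemma conj_00 (B : SL(2, ℝ)) (X : Matrix (Fin 2) (Fin 2) ℝ) :
    ((B : Matrix (Fin 2) (Fin 2) ℝ) * X * ((B⁻¹ : SL(2, ℝ)) : Matrix (Fin 2) (Fin 2) ℝ)) 0 0
      = (B 0 0 * X 0 0 + B 0 1 * X 1 0) * B 1 1 - (B 0 0 * X 0 1 + B 0 1 * X 1 1) * B 1 0 := by
  rw [Matrix.SpecialLinearGroup.coe_inv, Matrix.adjugate_fin_two]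
  simp [Matrix.mul_apply, Fin.sum_univ_two]
  ring

lemma conj_trace (B : SL(2, ℝ)) (X : Matrix (Fin 2) (Fin 2) ℝ) :
    ((B : Matrix (Fin 2) (Fin 2) ℝ) * X *
      ((B⁻¹ : SL(2, ℝ)) : Matrix (Fin 2) (Fin 2) ℝ)).trace = X.trace := by
  rw [Matrix.trace_mul_comm, inv_mul_frame]

lemma conj_sq_trace (B : SL(2, ℝ)) (X : Matrix (Fin 2) (Fin 2) ℝ) :
    (((B : Matrix (Fin 2) (Fin 2) ℝ) * X * ((B⁻¹ : SL(2, ℝ)) : Matrix (Fin 2) (Fin 2) ℝ)) *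
      ((B : Matrix (Fin 2) (Fin 2) ℝ) * X *
        ((B⁻¹ : SL(2, ℝ)) : Matrix (Fin 2) (Fin 2) ℝ))).trace = (X * X).trace := by
  have h : ((B : Matrix (Fin 2) (Fin 2) ℝ) * X * ((B⁻¹ : SL(2, ℝ)) : Matrix (Fin 2) (Fin 2) ℝ)) *
      ((B : Matrix (Fin 2) (Fin 2) ℝ) * X * ((B⁻¹ : SL(2, ℝ)) : Matrix (Fin 2) (Fin 2) ℝ))
      = (B : Matrix (Fin 2) (Fin 2) ℝ) * (X * X) *
        ((B⁻¹ : SL(2, ℝ)) : Matrix (Fin 2) (Fin 2) ℝ) := by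
    simp only [Matrix.mul_assoc, inv_mul_frame]
  rw [h, conj_trace]

lemma conj_neg (B : SL(2, ℝ)) (T : UnitTimelike) :
    ((B : Matrix (Fin 2) (Fin 2) ℝ) * T.body *
      ((B⁻¹ : SL(2, ℝ)) : Matrix (Fin 2) (Fin 2) ℝ)) 1 0 < 0 := by
  rw [conj_10, T.body_11]
  have hs := T.body_sq
  have hn := T.body_neg
  have hdet := B.det_coe
  rw [Matrix.det_fin_two] at hdet
  have h1 : 0 < (T.body 1 0 * B 1 1 + T.body 0 0 * B 1 0) ^ 2 + B 1 0 ^ 2 := by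
    by_contra hcon
    have hc : B 1 0 = 0 := by nlinarith [sq_nonneg (T.body 1 0 * B 1 1 + T.body 0 0 * B 1 0)]
    have hd : T.body 1 0 * B 1 1 + T.body 0 0 * B 1 0 = 0 := by nlinarith [sq_nonneg (B 1 0)]
    rw [hc, mul_zero, add_zero] at hd
    have hd' : B 1 1 = 0 := (mul_eq_zero.1 hd).resolve_left hn.ne
    simp [hc, hd'] at hdet
  by_contra hcon
  rw [not_lt] at hcon
  nlinarith [mul_nonpos_of_nonpos_of_nonneg hn.le hcon]

/-- A pair `(α, β)` acts on the universal cover by `γ ↦ α γ β⁻¹`, and on its unit tangent bundle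
by the differential of this map. -/
def pairAct (g : SL2Tilde × SL2Tilde) (T : UnitTimelike) : UnitTimelike where
  pt := g.1 * T.pt * g.2⁻¹
  vec := (g.1.mat : Matrix (Fin 2) (Fin 2) ℝ) * T.vec *
    ((g.2.mat⁻¹ : SL(2, ℝ)) : Matrix (Fin 2) (Fin 2) ℝ)
  tangent := by
    rw [pairAct_body, conj_trace]
    exact T.tangent
  unit := by
    rw [adsMetric_eq, pairAct_body, ← T.unit, adsMetric_eq]
    congr 2
    exact conj_sq_trace _ _
  future := by
    rw [pairAct_body]
    exact conj_neg _ _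


lemma pairAct_right (g : SL2Tilde × SL2Tilde) (T : UnitTimelike) :
    (pairAct g T).right = g.2.mat • T.right := by
  have hb : (pairAct g T).body = _ := pairAct_body g T
  set B := g.2.mat
  have hn := (pairAct g T).body_neg
  have hn' := T.body_neg.ne
  have hs := T.body_sq
  have hdet := B.det_coe
  rw [Matrix.det_fin_two] at hdet
  ext1
  refine mul_right_cancel₀ (autFactor_ne_zero B T.right) ?_
  rw [coe_smul_mul_autFactor]
  change ((pairAct g T).body 0 0 - Complex.I) / (pairAct g T).body 1 0 * _ = _
  have hne : ((pairAct g T).body 1 0 : ℂ) ≠ 0 := by exact_mod_cast hn.ne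
  have hne' : (T.body 1 0 : ℂ) ≠ 0 := by exact_mod_cast hn'
  rw [div_mul_eq_mul_div, div_eq_iff hne, hb, conj_10, conj_00, T.body_11, autFactor]
  have hr : (T.right : ℂ) = (T.body 0 0 - Complex.I) / T.body 1 0 := rfl
  have hsC : (T.body 0 0 : ℂ) ^ 2 + T.body 0 1 * T.body 1 0 = -1 := by exact_mod_cast hs
  have hdC : (B 0 0 : ℂ) * B 1 1 - B 0 1 * B 1 0 = 1 := by exact_mod_cast hdet
  rw [hr]
  have hI := Complex.I_sq
  push_cast
  generalize Complex.I = i at *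
  generalize (T.body 0 0 : ℂ) = p at *
  generalize (T.body 0 1 : ℂ) = q at *
  generalize (T.body 1 0 : ℂ) = r at *
  generalize (B 0 0 : ℂ) = a at *
  generalize (B 0 1 : ℂ) = b at *
  generalize (B 1 0 : ℂ) = c at *
  generalize (B 1 1 : ℂ) = d at *
  clear_value B
  clear hb hn hs hdet hr hne hn'
  field_simp
  grind

lemma pairAct_pt_mat (g : SL2Tilde × SL2Tilde) (T : UnitTimelike) :
    (pairAct g T).pt.mat = g.1.mat * T.pt.mat * g.2.mat⁻¹ := rfl

lemma pairAct_proj (g : SL2Tilde × SL2Tilde) (T : UnitTimelike) :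
    (pairAct g T).proj = (g.1.mat • T.proj.1, g.2.mat • T.proj.2) := by
  simp only [UnitTimelike.proj, pairAct_right, pairAct_pt_mat, mul_smul, inv_smul_smul]

lemma pairAct_coords (g : SL2Tilde × SL2Tilde) (T : UnitTimelike) :
    (pairAct g T).coords =
      (T.coords.1 + (g.1.log T.coords.2.1).im - (g.2.log T.coords.2.2).im,
        g.1.mat • T.coords.2.1, g.2.mat • T.coords.2.2) := by
  refine Prod.ext ?_ (pairAct_proj g T)
  simp only [UnitTimelike.coords, pairAct_right]
  simp [pairAct]
  ring

/-- The action of `SL₂~ × SL₂~` on the unit tangent bundle. -/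
def pairToPerm : SL2Tilde × SL2Tilde →* Equiv.Perm UnitTimelike :=
  letI : MulAction (SL2Tilde × SL2Tilde) UnitTimelike :=
    { smul := pairAct
      one_smul := fun T => UnitTimelike.ext
        (by change 1 * T.pt * 1⁻¹ = _; simp)
        (by change ((1 : SL(2, ℝ)) : Matrix (Fin 2) (Fin 2) ℝ) * T.vec *
              (((1 : SL(2, ℝ))⁻¹ : SL(2, ℝ)) : Matrix (Fin 2) (Fin 2) ℝ) = _
            simp)
      mul_smul := fun g h T => UnitTimelike.ext
        (by change (g.1 * h.1) * T.pt * (g.2 * h.2)⁻¹ = g.1 * (h.1 * T.pt * h.2⁻¹) * g.2⁻¹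
            group)
        (by change ((g.1.mat * h.1.mat : SL(2, ℝ)) : Matrix (Fin 2) (Fin 2) ℝ) * T.vec *
              (((g.2.mat * h.2.mat)⁻¹ : SL(2, ℝ)) : Matrix (Fin 2) (Fin 2) ℝ) =
              (g.1.mat : Matrix (Fin 2) (Fin 2) ℝ) * ((h.1.mat : Matrix (Fin 2) (Fin 2) ℝ) * T.vec *
              ((h.2.mat⁻¹ : SL(2, ℝ)) : Matrix (Fin 2) (Fin 2) ℝ)) *
              ((g.2.mat⁻¹ : SL(2, ℝ)) : Matrix (Fin 2) (Fin 2) ℝ)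
            rw [_root_.mul_inv_rev]
            simp only [Matrix.SpecialLinearGroup.coe_mul, Matrix.mul_assoc]) }
  MulAction.toPermHom _ _

lemma coords_injective : Function.Injective UnitTimelike.coords := coordEquiv.injective

/-- The isometries act on the unit tangent bundle. -/
def isomToPerm : Isom0 →* Equiv.Perm UnitTimelike :=
  QuotientGroup.lift _ pairToPerm (by
    have : diagCenter ≤ pairToPerm.ker := by
      rw [diagCenter, Subgroup.zpowers_le, MonoidHom.mem_ker]
      ext1 T
      refine coords_injective ?_
      change (pairAct (SL2Tilde.zeta, SL2Tilde.zeta) T).coords = _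
      rw [pairAct_coords]
      have hneg : ∀ z : ℍ, SL2Tilde.zeta.mat • z = z := fun z =>
        center_smul_upperHalfPlane (-1) (by simp [Subgroup.mem_center_iff]) z
      rw [hneg, hneg]
      simp [SL2Tilde.zeta]
    exact fun g hg => this hg)

instance : MulAction Isom0 UnitTimelike := MulAction.compHom _ isomToPerm

lemma mk_smul_unitTimelike (g : SL2Tilde × SL2Tilde) (T : UnitTimelike) :
    (QuotientGroup.mk g : Isom0) • T = pairAct g T := rfl

/-- The covering homomorphism from the isometries of the universal cover of Anti-de Sitter space
to `PSL(2, ℝ) × PSL(2, ℝ)`, the isometries of Anti-de Sitter space. -/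
def isomToPSL : Isom0 →* PSL(2, ℝ) × PSL(2, ℝ) :=
  QuotientGroup.lift _ (SL2Tilde.toPSL.prodMap SL2Tilde.toPSL) (by
    have : diagCenter ≤ (SL2Tilde.toPSL.prodMap SL2Tilde.toPSL).ker := by
      rw [diagCenter, Subgroup.zpowers_le, MonoidHom.mem_ker]
      have h : SL2Tilde.toPSL SL2Tilde.zeta = 1 := by
        refine (QuotientGroup.eq_one_iff _).2 ?_
        simp [SL2Tilde.zeta, Subgroup.mem_center_iff]
      simp [h]
    exact fun g hg => this hg)

/-- The isometries act on `ℍ × ℍ`, through `PSL(2, ℝ) × PSL(2, ℝ)` acting factorwise. -/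
instance : MulAction Isom0 (ℍ × ℍ) where
  smul g w := ((isomToPSL g).1 • w.1, (isomToPSL g).2 • w.2)
  one_smul w := by
    change ((isomToPSL 1).1 • w.1, (isomToPSL 1).2 • w.2) = w
    simp
  mul_smul g h w := by
    change ((isomToPSL (g * h)).1 • w.1, (isomToPSL (g * h)).2 • w.2) =
      ((isomToPSL g).1 • (isomToPSL h).1 • w.1, (isomToPSL g).2 • (isomToPSL h).2 • w.2)
    simp [mul_smul]

lemma isom_smul_def (g : Isom0) (w : ℍ × ℍ) :
    g • w = ((isomToPSL g).1 • w.1, (isomToPSL g).2 • w.2) := rfl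

lemma proj_smul (g : Isom0) (T : UnitTimelike) : (g • T).proj = g • T.proj := by
  induction g using QuotientGroup.induction_on with
  | H g => exact pairAct_proj g T

lemma continuous_proj : Continuous UnitTimelike.proj :=
  continuous_snd.comp coordHomeo.continuous

instance : ContinuousConstSMul Isom0 UnitTimelike where
  continuous_const_smul g := by
    induction g using QuotientGroup.induction_on with
    | H g =>
      have h1 := g.1.continuous_log
      have h2 := g.2.continuous_log
      have h3 := SL2Tilde.continuous_smul' g.1.mat
      have h4 := SL2Tilde.continuous_smul' g.2.mat
      rw [coordHomeo.isInducing.continuous_iff]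
      have hc : Continuous fun T : UnitTimelike => T.coords := coordHomeo.continuous
      have : (coordHomeo ∘ fun T : UnitTimelike => (QuotientGroup.mk g : Isom0) • T) =
          fun T => (T.coords.1 + (g.1.log T.coords.2.1).im - (g.2.log T.coords.2.2).im,
            g.1.mat • T.coords.2.1, g.2.mat • T.coords.2.2) := by
        funext T
        exact pairAct_coords g T
      rw [this]
      have k1 := h1.comp (continuous_fst.comp (continuous_snd.comp hc))
      have k2 := h2.comp (continuous_snd.comp (continuous_snd.comp hc))
      have k3 := h3.comp (continuous_fst.comp (continuous_snd.comp hc))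
      have k4 := h4.comp (continuous_snd.comp (continuous_snd.comp hc))
      exact (((continuous_fst.comp hc).add (Complex.continuous_im.comp k1)).sub
        (Complex.continuous_im.comp k2)).prodMk (k3.prodMk k4)

/-! ### The boundary of the universal cover of Anti-de Sitter space -/

/-- The point of `ℝP¹ = ℝ ∪ {∞}` given by the line spanned by `(cos a, sin a)`. -/
def lineOfAngle (a : ℝ) : OnePoint ℝ :=
  if Real.sin a = 0 then OnePoint.infty else ((Real.cos a / Real.sin a : ℝ) : OnePoint ℝ)

/-- `cos a - z sin a`: the value at the vector `v = (cos a, sin a)` of the linear form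
`v₁ - z v₂`. -/
def dirForm (a : ℝ) (z : ℍ) : ℂ := Real.cos a - z * Real.sin a

/-- The angle under which the direction `a` is seen from `z`: the continuous choice in `z` of minus
the argument of `cos a - z sin a` that takes the value `a` at `z = i`. -/
def seenAngle (a : ℝ) (z : ℍ) : ℝ :=
  a - Complex.arg (dirForm a z * Complex.exp (a * Complex.I))

/-- The action of the universal cover of `SL(2, ℝ)` on the universal cover `ℝ` of `ℝP¹`, the
coordinate of `ℝ` being the angle. If `a'` is the image of `a` under the element `(g, log)` then
`seenAngle a' (g z) = seenAngle a z + Im (log z)` for all `z`, and `a'` is read off at `g z = i`. -/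
def angleAct (α : SL2Tilde) (a : ℝ) : ℝ :=
  seenAngle a (α.mat⁻¹ • UpperHalfPlane.I) + (α.log (α.mat⁻¹ • UpperHalfPlane.I)).im

lemma dirForm_ne_zero (a : ℝ) (z : ℍ) : dirForm a z ≠ 0 := by
  intro h
  have h1 := congrArg Complex.im h
  have h2 := congrArg Complex.re h
  simp [dirForm, -Complex.ofReal_cos, -Complex.ofReal_sin] at h1 h2
  have hs : Real.sin a = 0 := by
    rcases h1 with h1 | h1
    · exact absurd h1 z.im_pos.ne'
    · exact h1
  have := Real.sin_sq_add_cos_sq a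
  rw [hs] at this h2
  simp at h2
  simp [h2] at this

lemma dirForm_slit (a : ℝ) (z : ℍ) :
    dirForm a z * Complex.exp (a * Complex.I) ∈ Complex.slitPlane := by
  rw [Complex.mem_slitPlane_iff_not_le_zero]
  intro h
  obtain ⟨hre, him⟩ := Complex.le_def.1 h
  set k := dirForm a z * Complex.exp (a * Complex.I) with hk
  have hkk : dirForm a z = k.re * Complex.exp (-(a * Complex.I)) := by
    have : k = (k.re : ℂ) := Complex.ext (by simp) (by simpa using him)
    rw [← this, hk, mul_assoc, ← Complex.exp_add]
    simp
  simp only [Complex.zero_re] at hre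
  have he : Complex.exp (-(a * Complex.I)) = Real.cos a - Real.sin a * Complex.I := by
    rw [← neg_mul, Complex.exp_mul_I]
    simp
    ring
  rw [he] at hkk
  have h1 := congrArg Complex.im hkk
  have h2 := congrArg Complex.re hkk
  simp [dirForm, -Complex.ofReal_cos, -Complex.ofReal_sin] at h1 h2
  have hz := z.im_pos
  have hs : Real.sin a = 0 := by
    rcases h1 with h1 | h1
    · linarith
    · exact h1
  have hc : Real.cos a = 0 := by
    rw [hs] at h2
    have : Real.cos a * (1 - k.re) = 0 := by linarith
    refine (mul_eq_zero.1 this).resolve_right ?_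
    linarith
  have := Real.sin_sq_add_cos_sq a
  simp [hs, hc] at this

lemma continuous_seenAngle (a : ℝ) : Continuous (seenAngle a) := by
  refine continuous_const.sub ?_
  have hc : Continuous fun z : ℍ => dirForm a z * Complex.exp (a * Complex.I) := by
    have := UpperHalfPlane.continuous_coe
    unfold dirForm
    fun_prop
  exact continuous_iff_continuousAt.2 fun z =>
    (Complex.continuousAt_arg (dirForm_slit a z)).comp_of_eq hc.continuousAt rfl

lemma exp_seenAngle (a : ℝ) (z : ℍ) :
    Complex.exp (-(seenAngle a z * Complex.I)) * ‖dirForm a z‖ = dirForm a z := by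
  have h := Complex.norm_mul_exp_arg_mul_I (dirForm a z * Complex.exp (a * Complex.I))
  rw [norm_mul, Complex.norm_exp_ofReal_mul_I, mul_one] at h
  have e : Complex.exp (-(seenAngle a z * Complex.I)) =
      Complex.exp (Complex.arg (dirForm a z * Complex.exp (a * Complex.I)) * Complex.I) *
        Complex.exp (-(a * Complex.I)) := by
    rw [← Complex.exp_add]
    congr 1
    simp only [seenAngle]
    push_cast
    ring
  rw [e, mul_right_comm, mul_comm _ (‖dirForm a z‖ : ℂ), h, mul_assoc, ← Complex.exp_add]
  simp

lemma seenAngle_I (a : ℝ) : seenAngle a UpperHalfPlane.I = a := by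
  have : dirForm a UpperHalfPlane.I * Complex.exp (a * Complex.I) = 1 := by
    have h := Complex.sin_sq_add_cos_sq (a : ℂ)
    rw [Complex.exp_mul_I]
    simp [dirForm]
    linear_combination h - Complex.sin a ^ 2 * Complex.I_sq
  simp [seenAngle, this]

lemma dirForm_add_pi (a : ℝ) (z : ℍ) : dirForm (a + Real.pi) z = -dirForm a z := by
  simp only [dirForm, Real.cos_add_pi, Real.sin_add_pi]
  push_cast
  ring

lemma seenAngle_add_pi (a : ℝ) (z : ℍ) : seenAngle (a + Real.pi) z = seenAngle a z + Real.pi := by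
  have : dirForm (a + Real.pi) z * Complex.exp ((a + Real.pi : ℝ) * Complex.I)
      = dirForm a z * Complex.exp (a * Complex.I) := by
    rw [dirForm_add_pi]
    push_cast
    rw [add_mul, Complex.exp_add, Complex.exp_pi_mul_I]
    ring
  rw [seenAngle, this, seenAngle]
  ring

lemma angleAct_add_pi (α : SL2Tilde) (a : ℝ) :
    angleAct α (a + Real.pi) = angleAct α a + Real.pi := by
  rw [angleAct, seenAngle_add_pi, angleAct]; ring

/-- The action on angles lifts the linear action of `SL(2, ℝ)` on directions of `ℝ²`. -/
lemma angleAct_lifts (α : SL2Tilde) (a : ℝ) :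
    ∃ r : ℝ, 0 < r ∧
      α.mat 0 0 * Real.cos a + α.mat 0 1 * Real.sin a = r * Real.cos (angleAct α a) ∧
      α.mat 1 0 * Real.cos a + α.mat 1 1 * Real.sin a = r * Real.sin (angleAct α a) := by
  set z : ℍ := α.mat⁻¹ • UpperHalfPlane.I with hz
  have hzi : α.mat • z = UpperHalfPlane.I := by rw [hz, smul_inv_smul]
  have hne := autFactor_ne_zero α.mat z
  have hw := dirForm_ne_zero a z
  have hdet := α.mat.det_coe
  rw [Matrix.det_fin_two] at hdet
  have hdC : (α.mat 0 0 : ℂ) * α.mat 1 1 - α.mat 0 1 * α.mat 1 0 = 1 := by exact_mod_cast hdet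
  have e1 := coe_smul_mul_autFactor α.mat z
  rw [hzi] at e1
  have key : ((α.mat 0 0 * Real.cos a + α.mat 0 1 * Real.sin a : ℝ) : ℂ) -
      (α.mat 1 0 * Real.cos a + α.mat 1 1 * Real.sin a : ℝ) * Complex.I =
      (‖dirForm a z‖ / ‖autFactor α.mat z‖ : ℝ) * Complex.exp (-(angleAct α a * Complex.I)) := by
    have e2 := exp_seenAngle a z
    have e3 := α.exp_log z
    have hn : (‖autFactor α.mat z‖ : ℂ) ≠ 0 := by simpa using hne
    have e4 : autFactor α.mat z =
        ‖autFactor α.mat z‖ * Complex.exp ((α.log z).im * Complex.I) := by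
      conv_lhs => rw [← e3, ← Complex.re_add_im (α.log z), Complex.exp_add]
      rw [← e3, Complex.norm_exp, Complex.ofReal_exp]
    have e5 : Complex.exp (-(angleAct α a * Complex.I)) * autFactor α.mat z =
        Complex.exp (-(seenAngle a z * Complex.I)) * ‖autFactor α.mat z‖ := by
      conv_lhs => rw [e4]
      rw [mul_left_comm, ← Complex.exp_add, mul_comm]
      congr 2
      simp only [angleAct, ← hz]
      push_cast
      ring
    refine mul_right_cancel₀ hne ?_
    rw [mul_assoc, e5]
    push_cast
    rw [div_mul_eq_mul_div, mul_comm (Complex.exp _), mul_left_comm,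
      mul_div_cancel_left₀ _ hn, mul_comm (‖dirForm a z‖ : ℂ), e2]
    have e6 : Complex.I * autFactor α.mat z = α.mat 0 0 * z + α.mat 0 1 := by simpa using e1
    have e7 : autFactor α.mat z = α.mat 1 0 * z + α.mat 1 1 := rfl
    simp only [dirForm]
    push_cast
    linear_combination (-(α.mat 1 0 * Complex.cos a + α.mat 1 1 * Complex.sin a)) * e6
      + (α.mat 0 0 * Complex.cos a + α.mat 0 1 * Complex.sin a) * e7
      + (Complex.cos a - z * Complex.sin a) * hdC
  have he : Complex.exp (-(angleAct α a * Complex.I)) =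
      Real.cos (angleAct α a) - Real.sin (angleAct α a) * Complex.I := by
    rw [← neg_mul, Complex.exp_mul_I]
    simp
    ring
  rw [he] at key
  refine ⟨‖dirForm a z‖ / ‖autFactor α.mat z‖,
    div_pos (norm_pos_iff.2 hw) (norm_pos_iff.2 hne), ?_, ?_⟩
  · simpa [-Complex.ofReal_cos, -Complex.ofReal_sin, -Complex.ofReal_div] using
      congrArg Complex.re key
  · have := congrArg Complex.im key
    simp [-Complex.ofReal_cos, -Complex.ofReal_sin, -Complex.ofReal_div] at this
    linarith

lemma exp_eq_of_pos_mul {r s : ℝ} (hr : 0 < r) (hs : 0 < s) {u v : ℝ}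
    (h : (r : ℂ) * Complex.exp (u * Complex.I) = s * Complex.exp (v * Complex.I)) :
    Complex.exp (u * Complex.I) = Complex.exp (v * Complex.I) := by
  have hn := congrArg norm h
  simp only [norm_mul, Complex.norm_exp_ofReal_mul_I, mul_one, Complex.norm_real,
    Real.norm_eq_abs, abs_of_pos hr, abs_of_pos hs] at hn
  rw [hn] at h
  exact mul_left_cancel₀ (by exact_mod_cast hs.ne') h

lemma seenAngle_angleAct (α : SL2Tilde) (a : ℝ) (z : ℍ) :
    seenAngle (angleAct α a) (α.mat • z) = seenAngle a z + (α.log z).im := by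
  obtain ⟨r, hr, hr1, hr2⟩ := angleAct_lifts α a
  set a' := angleAct α a with ha'
  have hexp : ∀ w : ℍ, Complex.exp ((-seenAngle a' (α.mat • w) : ℝ) * Complex.I) =
      Complex.exp ((-(seenAngle a w + (α.log w).im) : ℝ) * Complex.I) := fun w => by
    have hne := autFactor_ne_zero α.mat w
    have hd := dirForm_ne_zero a w
    have hd' := dirForm_ne_zero a' (α.mat • w)
    have hf : r * dirForm a' (α.mat • w) * autFactor α.mat w = dirForm a w := by
      have e1 := coe_smul_mul_autFactor α.mat w
      have hdet := α.mat.det_coe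
      rw [Matrix.det_fin_two] at hdet
      have hdC : (α.mat 0 0 : ℂ) * α.mat 1 1 - α.mat 0 1 * α.mat 1 0 = 1 := by exact_mod_cast hdet
      have hr1C : (α.mat 0 0 : ℂ) * Real.cos a + α.mat 0 1 * Real.sin a = r * Real.cos a' := by
        exact_mod_cast hr1
      have hr2C : (α.mat 1 0 : ℂ) * Real.cos a + α.mat 1 1 * Real.sin a = r * Real.sin a' := by
        exact_mod_cast hr2
      have e7 : autFactor α.mat w = α.mat 1 0 * w + α.mat 1 1 := rfl
      simp only [dirForm]
      linear_combination (-(r : ℂ) * Real.sin a') * e1 + (r * Real.cos a') * e7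
        - (α.mat 1 0 * w + α.mat 1 1) * hr1C + (α.mat 0 0 * w + α.mat 0 1) * hr2C
        + (Real.cos a - w * Real.sin a) * hdC
    have e2 := exp_seenAngle a w
    have e2' := exp_seenAngle a' (α.mat • w)
    have e4 : autFactor α.mat w =
        ‖autFactor α.mat w‖ * Complex.exp ((α.log w).im * Complex.I) := by
      have e3 := α.exp_log w
      conv_lhs => rw [← e3, ← Complex.re_add_im (α.log w), Complex.exp_add]
      rw [← e3, Complex.norm_exp, Complex.ofReal_exp]
    refine exp_eq_of_pos_mul
      (r := r * ‖dirForm a' (α.mat • w)‖ * ‖autFactor α.mat w‖) (s := ‖dirForm a w‖)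
      (mul_pos (mul_pos hr (norm_pos_iff.2 hd')) (norm_pos_iff.2 hne)) (norm_pos_iff.2 hd) ?_
    have hsplit : Complex.exp ((-(seenAngle a w + (α.log w).im) : ℝ) * Complex.I) *
        Complex.exp ((α.log w).im * Complex.I) = Complex.exp (-(seenAngle a w * Complex.I)) := by
      rw [← Complex.exp_add]
      congr 1
      push_cast
      ring
    refine mul_right_cancel₀ (Complex.exp_ne_zero ((α.log w).im * Complex.I)) ?_
    rw [mul_assoc (‖dirForm a w‖ : ℂ), hsplit, mul_comm (‖dirForm a w‖ : ℂ), e2, ← hf]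
    conv_rhs => rw [← e2', e4]
    push_cast
    ring_nf
  have key : ∀ w : ℍ, ∃ n : ℤ,
      seenAngle a' (α.mat • w) - (seenAngle a w + (α.log w).im) = n * (2 * Real.pi) := fun w => by
    obtain ⟨n, hn⟩ := Complex.exp_eq_exp_iff_exists_int.1 (hexp w)
    refine ⟨-n, ?_⟩
    have h := congrArg Complex.im hn
    simp at h
    push_cast
    linarith
  choose n hn using key
  have hpi : (2 * Real.pi) ≠ 0 := by positivity
  have hc : Continuous fun w : ℍ =>
      (seenAngle a' (α.mat • w) - (seenAngle a w + (α.log w).im)) / (2 * Real.pi) := by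
    have h1 := (continuous_seenAngle a').comp (SL2Tilde.continuous_smul' α.mat)
    have h2 := continuous_seenAngle a
    have h3 := Complex.continuous_im.comp α.continuous_log
    exact (h1.sub (h2.add h3)).div_const _
  have hfun : (fun w : ℍ =>
      (seenAngle a' (α.mat • w) - (seenAngle a w + (α.log w).im)) / (2 * Real.pi))
      = fun w => ((n w : ℤ) : ℝ) := by
    funext w
    rw [hn w, mul_div_cancel_right₀ _ hpi]
  rw [hfun] at hc
  have hcn : Continuous n := by
    rw [Int.isClosedEmbedding_coe_real.isEmbedding.continuous_iff]; exact hc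
  have hconst : n z = n (α.mat⁻¹ • UpperHalfPlane.I) :=
    PreconnectedSpace.constant inferInstance hcn
  have h0 : n (α.mat⁻¹ • UpperHalfPlane.I) = 0 := by
    have h := hn (α.mat⁻¹ • UpperHalfPlane.I)
    rw [smul_inv_smul, seenAngle_I, ha', angleAct, sub_self] at h
    have := (mul_eq_zero.1 h.symm).resolve_right hpi
    exact_mod_cast this
  have h := hn z
  rw [hconst, h0] at h
  simp at h
  linarith

lemma angleAct_mul (α β : SL2Tilde) (a : ℝ) :
    angleAct (α * β) a = angleAct α (angleAct β a) := by
  conv_rhs => rw [angleAct]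
  have h := seenAngle_angleAct β a ((α * β).mat⁻¹ • UpperHalfPlane.I)
  have e : β.mat • (α * β).mat⁻¹ • UpperHalfPlane.I = α.mat⁻¹ • UpperHalfPlane.I := by
    simp [mul_smul]
  rw [e] at h
  rw [h, angleAct, SL2Tilde.mul_log, e]
  simp
  ring

lemma angleAct_one (a : ℝ) : angleAct 1 a = a := by simp [angleAct, seenAngle_I]

lemma angleAct_zeta (a : ℝ) : angleAct SL2Tilde.zeta a = a + Real.pi := by
  have h : ∀ z : ℍ, SL2Tilde.zeta.mat⁻¹ • z = z := fun z =>
    center_smul_upperHalfPlane _ (by simp [SL2Tilde.zeta, Subgroup.mem_center_iff]) z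
  rw [angleAct, h, seenAngle_I]
  simp [SL2Tilde.zeta]

/-- The boundary of the universal cover of Anti-de Sitter space: the covering of `ℝP¹ × ℝP¹`
corresponding to the cyclic subgroup of the fundamental group generated by the diagonal (the
meridian of the solid torus). -/
abbrev AdSBoundary : Type := (ℝ × ℝ) ⧸ AddSubgroup.zmultiples ((Real.pi, Real.pi) : ℝ × ℝ)

lemma lineOfAngle_add_pi (a : ℝ) : lineOfAngle (a + Real.pi) = lineOfAngle a := by
  simp [lineOfAngle, Real.sin_add_pi, Real.cos_add_pi]

lemma lineOfAngle_add_int (a : ℝ) (n : ℤ) : lineOfAngle (a + n * Real.pi) = lineOfAngle a := by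
  have h : Function.Periodic lineOfAngle Real.pi := lineOfAngle_add_pi
  exact h.int_mul n a

lemma angleAct_add_int (α : SL2Tilde) (a : ℝ) (n : ℤ) :
    angleAct α (a + n * Real.pi) = angleAct α a + n * Real.pi := by
  have h : Function.Periodic (fun b => angleAct α b - b) Real.pi := fun b => by
    simp only [angleAct_add_pi]; ring
  have := h.int_mul n a
  linarith

lemma boundary_rel {u v : ℝ × ℝ}
    (h : QuotientAddGroup.leftRel (AddSubgroup.zmultiples ((Real.pi, Real.pi) : ℝ × ℝ)) u v) :
    ∃ n : ℤ, v = (u.1 + n * Real.pi, u.2 + n * Real.pi) := by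
  rw [QuotientAddGroup.leftRel_apply, AddSubgroup.mem_zmultiples_iff] at h
  obtain ⟨n, hn⟩ := h
  refine ⟨n, ?_⟩
  have h1 := congrArg Prod.fst hn
  have h2 := congrArg Prod.snd hn
  simp at h1 h2
  ext <;> simp <;> linarith

/-- The covering `∂_∞ → ℝP¹ × ℝP¹`. -/
def boundaryProj : AdSBoundary → OnePoint ℝ × OnePoint ℝ :=
  Quotient.lift (fun u : ℝ × ℝ => (lineOfAngle u.1, lineOfAngle u.2)) fun u v h => by
    obtain ⟨n, rfl⟩ := boundary_rel h
    simp [lineOfAngle_add_int]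

/-- The action of a pair `(α, β)` on the boundary. -/
def pairBoundaryAct (g : SL2Tilde × SL2Tilde) : AdSBoundary → AdSBoundary :=
  Quotient.map (fun u : ℝ × ℝ => (angleAct g.1 u.1, angleAct g.2 u.2)) fun u v h => by
    obtain ⟨n, rfl⟩ := boundary_rel h
    refine QuotientAddGroup.leftRel_apply.2 (AddSubgroup.mem_zmultiples_iff.2 ⟨n, ?_⟩)
    ext <;> simp [angleAct_add_int]

def pairToBoundaryPerm : SL2Tilde × SL2Tilde →* Equiv.Perm AdSBoundary :=
  letI : MulAction (SL2Tilde × SL2Tilde) AdSBoundary :=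
    { smul := pairBoundaryAct
      one_smul := fun ξ => by
        induction ξ using QuotientAddGroup.induction_on with
        | H u =>
          change (QuotientAddGroup.mk (angleAct 1 u.1, angleAct 1 u.2) : AdSBoundary) = _
          rw [angleAct_one, angleAct_one]
      mul_smul := fun g h ξ => by
        induction ξ using QuotientAddGroup.induction_on with
        | H u =>
          change (QuotientAddGroup.mk (angleAct (g.1 * h.1) u.1, angleAct (g.2 * h.2) u.2) :
            AdSBoundary) = QuotientAddGroup.mk
              (angleAct g.1 (angleAct h.1 u.1), angleAct g.2 (angleAct h.2 u.2))
          rw [angleAct_mul, angleAct_mul] }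
  MulAction.toPermHom _ _

/-- The isometries act on the boundary. -/
def isomToBoundaryPerm : Isom0 →* Equiv.Perm AdSBoundary :=
  QuotientGroup.lift _ pairToBoundaryPerm (by
    have : diagCenter ≤ pairToBoundaryPerm.ker := by
      rw [diagCenter, Subgroup.zpowers_le, MonoidHom.mem_ker]
      ext1 ξ
      induction ξ using QuotientAddGroup.induction_on with
      | H u =>
        change (QuotientAddGroup.mk (angleAct SL2Tilde.zeta u.1, angleAct SL2Tilde.zeta u.2) :
            AdSBoundary) = QuotientAddGroup.mk u
        rw [angleAct_zeta, angleAct_zeta]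
        refine QuotientAddGroup.eq.2 (AddSubgroup.mem_zmultiples_iff.2 ⟨-1, ?_⟩)
        ext <;> simp
    exact fun g hg => this hg)

instance : MulAction Isom0 AdSBoundary := MulAction.compHom _ isomToBoundaryPerm

/-- Orientation-preserving homeomorphisms of `ℝP¹`: those that lift to an increasing map of the
universal cover. -/
def IsOrientationPreserving (h : OnePoint ℝ ≃ₜ OnePoint ℝ) : Prop :=
  ∃ k : ℝ → ℝ, StrictMono k ∧ Continuous k ∧ ∀ a, lineOfAngle (k a) = h (lineOfAngle a)

/-- The preimage in the boundary of the universal cover of the graph of `h`. -/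
def graphPreimage (h : OnePoint ℝ ≃ₜ OnePoint ℝ) : Set AdSBoundary :=
  {ξ | (boundaryProj ξ).2 = h (boundaryProj ξ).1}

/-- `lift` is the standard lift of `(ρl, ρr)`: it lifts `(ρl, ρr)` and leaves invariant
every connected component of the preimage of the graph of the orientation-preserving
homeomorphism of `ℝP¹` that conjugates `ρl` to `ρr`. -/
def IsStandardLift {Γ : Type*} [Group Γ] (ρl ρr : Γ →* PSL(2, ℝ)) (lift : Γ →* Isom0) : Prop :=
  (∀ τ, isomToPSL (lift τ) = (ρl τ, ρr τ)) ∧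
    ∃ h : OnePoint ℝ ≃ₜ OnePoint ℝ, IsOrientationPreserving h ∧
      (∀ τ ξ, h (ρl τ • ξ) = ρr τ • h ξ) ∧
      ∀ τ, ∀ ξ ∈ graphPreimage h,
        (fun η => lift τ • η) '' connectedComponentIn (graphPreimage h) ξ =
          connectedComponentIn (graphPreimage h) ξ


/-! ### Surfaces and Fuchsian representations -/

/-- The atlas of a surface is oriented if its changes of charts preserve the orientation of
`ℂ = ℝ²`. -/
class OrientedAtlas (S : Type*) [TopologicalSpace S] [ChartedSpace ℂ S] : Prop where
  det_pos : ∀ e ∈ atlas ℂ S, ∀ e' ∈ atlas ℂ S, ∀ z ∈ (e.symm ≫ₕ e').source,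
    0 < (fderiv ℝ (e.symm ≫ₕ e') z).det

/-- The group of deck transformations of a covering. If the total space is simply connected, this
is the fundamental group of the base. -/
def deckGroup {S S' : Type*} [TopologicalSpace S'] (cover : S' → S) : Subgroup (S' ≃ₜ S') where
  carrier := {φ | ∀ x, cover (φ x) = cover x}
  mul_mem' := fun {φ ψ} hφ hψ x => by
    change cover (φ (ψ x)) = cover x
    rw [hφ, hψ]
  one_mem' _ := rfl
  inv_mem' := fun {φ} hφ x => by
    have h := hφ (φ⁻¹ x)
    rw [← h]
    congr 1
    exact φ.apply_symm_apply x

/-- A Fuchsian representation of the fundamental group of the oriented surface `S`: it is faithful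
and discrete, and it is the holonomy of an oriented hyperbolic structure on `S`, given by an
equivariant homeomorphism `dev` from the universal cover of `S` to the hyperbolic plane. The
resulting covering `ℍ → S`, which identifies `S` with `ℍ / ρ(π₁(S))`, is a local diffeomorphism
and preserves the orientation. -/
structure FuchsianStructure {S S' : Type*} [TopologicalSpace S] [ChartedSpace ℂ S]
    [TopologicalSpace S'] (cover : S' → S) (ρ : deckGroup cover →* PSL(2, ℝ)) where
  faithful : Function.Injective ρ
  discrete : DiscreteTopology ρ.range
  dev : S' ≃ₜ ℍ
  equivariant : ∀ (τ : deckGroup cover) (x : S'), dev (τ.1 x) = ρ τ • dev x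
  isLocalDiffeomorph : IsLocalDiffeomorph 𝓘(ℝ, ℂ) 𝓘(ℝ, ℂ) ∞ (fun z : ℍ => cover (dev.symm z))
  orientation : ∀ z : ℍ,
    0 < (show ℂ →L[ℝ] ℂ from
      mfderiv 𝓘(ℝ, ℂ) 𝓘(ℝ, ℂ) (fun z : ℍ => cover (dev.symm z)) z).det

namespace FuchsianStructure

variable {S S' : Type*} [TopologicalSpace S] [ChartedSpace ℂ S] [TopologicalSpace S']
  {cover : S' → S} {ρ : deckGroup cover →* PSL(2, ℝ)}

/-- The covering `ℍ → S`. -/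
def quot (h : FuchsianStructure cover ρ) (z : ℍ) : S := cover (h.dev.symm z)

lemma dev_symm_smul (h : FuchsianStructure cover ρ) (τ : deckGroup cover) (z : ℍ) :
    h.dev.symm (ρ τ • z) = τ.1 (h.dev.symm z) := by
  rw [Homeomorph.symm_apply_eq, h.equivariant, Homeomorph.apply_symm_apply]

lemma quot_smul (h : FuchsianStructure cover ρ) (τ : deckGroup cover) (z : ℍ) :
    h.quot (ρ τ • z) = h.quot z := by
  rw [quot, dev_symm_smul, τ.2, quot]

lemma isLocalHomeomorph_quot (h : FuchsianStructure cover ρ) : IsLocalHomeomorph h.quot :=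
  h.isLocalDiffeomorph.isLocalHomeomorph

end FuchsianStructure

/-- A pair of Fuchsian representations of the fundamental group of a closed surface `S` with
universal cover `S'`, and the standard lift of this pair. -/
structure FuchsianPair (S S' : Type*) [TopologicalSpace S] [ChartedSpace ℂ S]
    [TopologicalSpace S'] where
  cover : S' → S
  isCoveringMap : IsCoveringMap cover
  surjective : Function.Surjective cover
  ρl : deckGroup cover →* PSL(2, ℝ)
  ρr : deckGroup cover →* PSL(2, ℝ)
  left : FuchsianStructure cover ρl
  right : FuchsianStructure cover ρr
  lift : deckGroup cover →* Isom0
  isStandardLift : IsStandardLift ρl ρr lift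

namespace FuchsianPair

variable {S S' : Type*} [TopologicalSpace S] [ChartedSpace ℂ S]
  [TopologicalSpace S']

lemma surjective_quot_left (F : FuchsianPair S S') : Function.Surjective F.left.quot :=
  F.surjective.comp F.left.dev.symm.surjective

lemma surjective_quot_right (F : FuchsianPair S S') : Function.Surjective F.right.quot :=
  F.surjective.comp F.right.dev.symm.surjective

/-! ### The bundle `P_ρ` and its base `M_ρ` -/

/-- `P_ρ`, the quotient of the unit tangent bundle by the image of the standard lift. -/
def TotalSpace (F : FuchsianPair S S') : Type :=
  MulAction.orbitRel.Quotient F.lift.range UnitTimelike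

/-- `M_ρ`, the quotient of `ℍ × ℍ`, the space of future-directed timelike geodesics of Anti-de
Sitter space, by the diagonal action of the fundamental group through `(ρl, ρr)`. -/
def Base (F : FuchsianPair S S') : Type :=
  MulAction.orbitRel.Quotient F.lift.range (ℍ × ℍ)

instance (F : FuchsianPair S S') : TopologicalSpace F.TotalSpace :=
  inferInstanceAs (TopologicalSpace (MulAction.orbitRel.Quotient F.lift.range UnitTimelike))

instance (F : FuchsianPair S S') : TopologicalSpace F.Base :=
  inferInstanceAs (TopologicalSpace (MulAction.orbitRel.Quotient F.lift.range (ℍ × ℍ)))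

/-- The quotient map `T¹ → P_ρ`. -/
def toQuot (F : FuchsianPair S S') (T : UnitTimelike) : F.TotalSpace :=
  (Quotient.mk _ T : MulAction.orbitRel.Quotient F.lift.range UnitTimelike)

/-- A chosen representative. -/
def rep (F : FuchsianPair S S') (p : F.TotalSpace) : UnitTimelike :=
  Quotient.out (s := MulAction.orbitRel F.lift.range UnitTimelike) p

lemma toQuot_rep (F : FuchsianPair S S') (p : F.TotalSpace) : F.toQuot (F.rep p) = p :=
  Quotient.out_eq (s := MulAction.orbitRel F.lift.range UnitTimelike) p

/-- The covering `M_ρ → S × S` induced by the coverings `ℍ → S` defined by `ρl` and `ρr`. -/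
def baseToProd (F : FuchsianPair S S') : F.Base → S × S :=
  Quotient.lift (fun w : ℍ × ℍ => (F.left.quot w.1, F.right.quot w.2)) (by
    rintro _ w ⟨⟨_, τ, rfl⟩, rfl⟩
    change (F.left.quot (F.lift τ • w).1, F.right.quot (F.lift τ • w).2) = _
    rw [isom_smul_def, F.isStandardLift.1]
    simp only [F.left.quot_smul, F.right.quot_smul])

/-- The principal `ℝ`-bundle `P_ρ → M_ρ` induced by the projection of a unit timelike vector to the
geodesic that it spans. -/
def toBase (F : FuchsianPair S S') : F.TotalSpace → F.Base :=
  Quotient.map UnitTimelike.proj (by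
    rintro _ T ⟨g, rfl⟩
    exact ⟨g, (proj_smul g.1 T).symm⟩)

/-- The map `π_ρ : P_ρ → S × S` induced by the projection `π`. -/
def toProd (F : FuchsianPair S S') (p : F.TotalSpace) : S × S := F.baseToProd (F.toBase p)

lemma toProd_toQuot (F : FuchsianPair S S') (T : UnitTimelike) :
    F.toProd (F.toQuot T) = (F.left.quot T.proj.1, F.right.quot T.proj.2) := rfl

lemma preconnectedSpace (F : FuchsianPair S S') : PreconnectedSpace S' :=
  F.left.dev.symm.surjective.denseRange.preconnectedSpace F.left.dev.symm.continuous

/-- The fundamental group acts freely and properly discontinuously. -/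
lemma isQuotientCoveringMap_toQuot (F : FuchsianPair S S') :
    IsQuotientCoveringMap F.toQuot F.lift.range where
  toIsQuotientMap := isQuotientMap_quotient_mk'
  continuous_const_smul g := (continuous_const_smul g.1 : Continuous fun T : UnitTimelike => g.1 • T)
  apply_eq_iff_mem_orbit := Quotient.eq''
  disjoint T := by
    have := F.preconnectedSpace
    obtain ⟨V, hV, hTV, hinj⟩ :=
      F.isCoveringMap.isLocalHomeomorph.isLocallyInjective (F.left.dev.symm T.proj.1)
    have hc : Continuous fun T : UnitTimelike => F.left.dev.symm T.proj.1 :=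
      F.left.dev.symm.continuous.comp (continuous_fst.comp continuous_proj)
    refine ⟨_, (hV.preimage hc).mem_nhds hTV, ?_⟩
    rintro ⟨_, τ, rfl⟩ ⟨_, ⟨T', hT', rfl⟩, hT''⟩
    have hτ : F.left.dev.symm (F.lift τ • T').proj.1 = τ.1 (F.left.dev.symm T'.proj.1) := by
      rw [proj_smul, isom_smul_def, F.isStandardLift.1]
      exact F.left.dev_symm_smul τ _
    have hfix : τ.1 (F.left.dev.symm T'.proj.1) = F.left.dev.symm T'.proj.1 := by
      refine hinj ?_ hT' (τ.2 _)
      rw [← hτ]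
      exact hT''
    have h1 : (τ.1 : S' → S') = id :=
      F.isCoveringMap.eq_of_comp_eq τ.1.continuous continuous_id (funext τ.2) _ hfix
    have h2 : τ = 1 := Subtype.ext (Homeomorph.ext fun x => congrFun h1 x)
    exact Subtype.ext (by simp [h2])

lemma isLocalHomeomorph_toQuot (F : FuchsianPair S S') : IsLocalHomeomorph F.toQuot :=
  F.isQuotientCoveringMap_toQuot.isCoveringMap.isLocalHomeomorph

/-- A local section near `p` of the quotient map `T¹ → P_ρ`. -/
def localSection (F : FuchsianPair S S') (p : F.TotalSpace) :
    OpenPartialHomeomorph F.TotalSpace UnitTimelike :=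
  F.isLocalHomeomorph_toQuot.localInverseAt (F.rep p)

lemma mem_localSection_source (F : FuchsianPair S S') (p : F.TotalSpace) :
    p ∈ (F.localSection p).source := by
  have h := F.isLocalHomeomorph_toQuot.apply_self_mem_localInverseAt_source (x := F.rep p)
  rwa [F.toQuot_rep] at h

lemma localSection_symm (F : FuchsianPair S S') (p : F.TotalSpace) :
    ((F.localSection p).symm : UnitTimelike → F.TotalSpace) = F.toQuot :=
  F.isLocalHomeomorph_toQuot.localInverseAt_symm _

lemma toQuot_localSection (F : FuchsianPair S S') (p : F.TotalSpace) {q : F.TotalSpace}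
    (hq : q ∈ (F.localSection p).source) : F.toQuot (F.localSection p q) = q :=
  F.isLocalHomeomorph_toQuot.apply_localInverseAt_of_mem hq

lemma localSection_self (F : FuchsianPair S S') (p : F.TotalSpace) :
    F.localSection p p = F.rep p := by
  have h := F.isLocalHomeomorph_toQuot.localInverseAt_apply_self (x := F.rep p)
  rwa [F.toQuot_rep] at h

/-- The smooth structure of `P_ρ` whose charts are the local sections followed by the
coordinates `(θ, x, y)`. -/
instance (F : FuchsianPair S S') : ChartedSpace (ℝ × ℂ × ℂ) F.TotalSpace where
  atlas := {e | ∃ p, e = F.localSection p ≫ₕ chartAt (ℝ × ℂ × ℂ) (F.rep p)}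
  chartAt p := F.localSection p ≫ₕ chartAt (ℝ × ℂ × ℂ) (F.rep p)
  mem_chart_source p := by
    rw [OpenPartialHomeomorph.trans_source]
    refine ⟨F.mem_localSection_source p, ?_⟩
    rw [Set.mem_preimage, F.localSection_self]
    exact mem_chart_source _ _
  chart_mem_atlas p := ⟨p, rfl⟩

end FuchsianPair

/-! ### One-forms, pull-back and exterior derivative -/

section Forms

variable {E H M : Type*} [NormedAddCommGroup E] [NormedSpace ℝ E] [TopologicalSpace H]
  [TopologicalSpace M] [ChartedSpace H M]
  {E' H' N : Type*} [NormedAddCommGroup E'] [NormedSpace ℝ E'] [TopologicalSpace H']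
  [TopologicalSpace N] [ChartedSpace H' N]

/-- One-forms on a manifold. -/
abbrev OneForm (I : ModelWithCorners ℝ E H) (M : Type*) [TopologicalSpace M] [ChartedSpace H M] :=
  ∀ x : M, TangentSpace I x →ₗ[ℝ] ℝ

/-- The pull-back `f^*η`. -/
def OneForm.pullback {I : ModelWithCorners ℝ E H} {J : ModelWithCorners ℝ E' H'} (f : M → N)
    (η : OneForm J N) : OneForm I M :=
  fun x => (η (f x)).comp (mfderiv I J f x).toLinearMap

/-- The exterior derivative of a smooth one-form on a manifold without boundary, evaluated on two
tangent vectors at `x`: in the preferred chart at `x`, in which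
`dη (v, w) = D_v (η (w)) - D_w (η (v))` for constant `v` and `w`. -/
def OneForm.extDeriv {I : ModelWithCorners ℝ E H} (η : OneForm I M) (x : M)
    (v w : TangentSpace I x) : ℝ :=
  let c := extChartAt I x
  let ηc : E → E → ℝ := fun u a => η (c.symm u) (mfderiv 𝓘(ℝ, E) I c.symm u a)
  fderiv ℝ (fun u => ηc u w) (c x) v - fderiv ℝ (fun u => ηc u v) (c x) w

end Forms

/-! ### The Sasaki metric and the connection form -/

namespace UnitTimelike

/-- `T¹` as a submanifold of the space of pairs of matrices; it is an immersion. -/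
def toMat (T : UnitTimelike) : (Fin 2 → Fin 2 → ℝ) × (Fin 2 → Fin 2 → ℝ) :=
  (fun i j => T.pt.mat i j, fun i j => T.vec i j)

/-- The components `(Ȧ, U̇)` in matrix terms of a tangent vector of `T¹` at `(A, U)`. -/
def matVel (T : UnitTimelike) : TangentSpace 𝓘(ℝ, ℝ × ℂ × ℂ) T →ₗ[ℝ]
    (Fin 2 → Fin 2 → ℝ) × (Fin 2 → Fin 2 → ℝ) :=
  (mfderiv 𝓘(ℝ, ℝ × ℂ × ℂ) 𝓘(ℝ, (Fin 2 → Fin 2 → ℝ) × (Fin 2 → Fin 2 → ℝ)) toMat T).toLinearMap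

/-- The covariant derivative `DU/dt = U̇ - (Ȧ A⁻¹ U + U A⁻¹ Ȧ) / 2` of a vector field `U` along a
curve `A` in `SL(2, ℝ)`, with respect to the Levi-Civita connection of the bi-invariant metric,
for which `∇_X Y = [X, Y] / 2` on left-invariant fields. -/
def covDeriv (T : UnitTimelike) (X : (Fin 2 → Fin 2 → ℝ) × (Fin 2 → Fin 2 → ℝ)) :
    Matrix (Fin 2) (Fin 2) ℝ :=
  of X.2 - (1 / 2 : ℝ) •
    (of X.1 * ((T.pt.mat⁻¹ : SL(2, ℝ)) : Matrix (Fin 2) (Fin 2) ℝ) * T.vec +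
      T.vec * ((T.pt.mat⁻¹ : SL(2, ℝ)) : Matrix (Fin 2) (Fin 2) ℝ) * of X.1)

/-- The Sasaki metric: the Anti-de Sitter metric on the horizontal parts `Ȧ` plus the Anti-de
Sitter metric on the vertical parts `DU/dt`. -/
def sasaki (T : UnitTimelike) (X Y : (Fin 2 → Fin 2 → ℝ) × (Fin 2 → Fin 2 → ℝ)) : ℝ :=
  adsMetric T.pt.mat (of X.1) (of Y.1) + adsMetric T.pt.mat (T.covDeriv X) (T.covDeriv Y)

/-- The generator `χ` of the geodesic flow at `(A, U)`: the horizontal lift of `U`, that is, the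
vector with `Ȧ = U` and `DU/dt = 0`. -/
def geodesicSpray (T : UnitTimelike) : (Fin 2 → Fin 2 → ℝ) × (Fin 2 → Fin 2 → ℝ) :=
  (fun i j => T.vec i j, fun i j =>
    (T.vec * ((T.pt.mat⁻¹ : SL(2, ℝ)) : Matrix (Fin 2) (Fin 2) ℝ) * T.vec) i j)

lemma covDeriv_geodesicSpray (T : UnitTimelike) : T.covDeriv T.geodesicSpray = 0 := by
  ext i j
  simp [covDeriv, geodesicSpray, Matrix.mul_apply, Fin.sum_univ_two]
  ring

lemma covDeriv_add (T : UnitTimelike) (X Y : (Fin 2 → Fin 2 → ℝ) × (Fin 2 → Fin 2 → ℝ)) :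
    T.covDeriv (X + Y) = T.covDeriv X + T.covDeriv Y := by
  ext i j
  simp [covDeriv, Matrix.mul_apply, Fin.sum_univ_two]
  ring

lemma covDeriv_smul (T : UnitTimelike) (r : ℝ) (X : (Fin 2 → Fin 2 → ℝ) × (Fin 2 → Fin 2 → ℝ)) :
    T.covDeriv (r • X) = r • T.covDeriv X := by
  ext i j
  simp [covDeriv, Matrix.mul_apply, Fin.sum_univ_two]
  ring

lemma sasaki_add (T : UnitTimelike) (X Y Z : (Fin 2 → Fin 2 → ℝ) × (Fin 2 → Fin 2 → ℝ)) :
    T.sasaki X (Y + Z) = T.sasaki X Y + T.sasaki X Z := by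
  have h : (of (Y + Z).1 : Matrix (Fin 2) (Fin 2) ℝ) = of Y.1 + of Z.1 := rfl
  simp only [sasaki, covDeriv_add, h, adsMetric, Matrix.mul_add, Matrix.trace_add]
  ring

lemma sasaki_smul (T : UnitTimelike) (r : ℝ)
    (X Y : (Fin 2 → Fin 2 → ℝ) × (Fin 2 → Fin 2 → ℝ)) :
    T.sasaki X (r • Y) = r * T.sasaki X Y := by
  have h : (of (r • Y).1 : Matrix (Fin 2) (Fin 2) ℝ) = r • of Y.1 := rfl
  simp only [sasaki, covDeriv_smul, h, adsMetric, Matrix.mul_smul, Matrix.trace_smul, smul_eq_mul]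
  ring

/-- The principal connection `ω = -g_S(χ, ·)` on `T¹`, given by the Sasaki metric. -/
def connForm : OneForm 𝓘(ℝ, ℝ × ℂ × ℂ) UnitTimelike := fun T =>
  { toFun := fun X => -T.sasaki T.geodesicSpray (T.matVel X)
    map_add' := fun X Y => by
      rw [map_add, sasaki_add]
      ring
    map_smul' := fun r X => by
      rw [map_smul, sasaki_smul]
      simp }

end UnitTimelike

namespace FuchsianPair

variable {S S' : Type*} [TopologicalSpace S] [ChartedSpace ℂ S]
  [TopologicalSpace S']

/-- The principal connection `ω_ρ` of `P_ρ` induced by `ω`. -/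
def connForm (F : FuchsianPair S S') : OneForm 𝓘(ℝ, ℝ × ℂ × ℂ) F.TotalSpace := fun p =>
  OneForm.pullback (F.localSection p) UnitTimelike.connForm p

end FuchsianPair

/-! ### The symplectic form and Lagrangian embeddings -/

/-- The area form `dx ∧ dy / y²` of the hyperbolic plane. -/
def hyperbolicArea (z : ℍ) (v w : TangentSpace 𝓘(ℝ, ℂ) z) : ℝ :=
  (Complex.re v * Complex.im w - Complex.im v * Complex.re w) / z.im ^ 2

/-- The area form of the hyperbolic metric of `S = ℍ / ρ(π₁(S))`, computed through a local inverse
of the covering `ℍ → S`. -/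
def FuchsianStructure.area {S S' : Type*} [TopologicalSpace S] [ChartedSpace ℂ S]
    [TopologicalSpace S'] {cover : S' → S} {ρ : deckGroup cover →* PSL(2, ℝ)}
    (h : FuchsianStructure cover ρ) (hs : Function.Surjective h.quot) (s : S)
    (v w : TangentSpace 𝓘(ℝ, ℂ) s) : ℝ :=
  let a : S → ℍ := h.isLocalHomeomorph_quot.localInverseAt (Function.surjInv hs s)
  hyperbolicArea (a s) (mfderiv 𝓘(ℝ, ℂ) 𝓘(ℝ, ℂ) a s v) (mfderiv 𝓘(ℝ, ℂ) 𝓘(ℝ, ℂ) a s w)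

namespace FuchsianPair

variable {S S' : Type*} [TopologicalSpace S] [ChartedSpace ℂ S]
  [TopologicalSpace S']

/-- The symplectic form `Ω_ρ` on `S × S`, the area form of the metric defined by `ρl` on the first
factor minus the area form of the metric defined by `ρr` on the second one. -/
def symplecticForm (F : FuchsianPair S S') (s : S × S)
    (v w : TangentSpace (𝓘(ℝ, ℂ).prod 𝓘(ℝ, ℂ)) s) : ℝ :=
  F.left.area F.surjective_quot_left s.1 v.1 w.1 -
    F.right.area F.surjective_quot_right s.2 v.2 w.2

/-- A map from the surface `S` to the four-manifold `(S × S, Ω_ρ)` is Lagrangian if it pulls back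
`Ω_ρ` to zero. -/
def IsLagrangian (F : FuchsianPair S S') (Λ : S → S × S) : Prop :=
  ∀ (s : S) (v w : TangentSpace 𝓘(ℝ, ℂ) s),
    F.symplecticForm (Λ s) (mfderiv 𝓘(ℝ, ℂ) (𝓘(ℝ, ℂ).prod 𝓘(ℝ, ℂ)) Λ s v)
      (mfderiv 𝓘(ℝ, ℂ) (𝓘(ℝ, ℂ).prod 𝓘(ℝ, ℂ)) Λ s w) = 0

/-! ### The pull-back of `P_ρ` -/

/-- The pull-back `Λ^*P_ρ = {(s, p) | Λ(s) = π_ρ(p)}`. -/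
def Pullback (F : FuchsianPair S S') (Λ : C(S, S × S)) : Type _ :=
  {n : S × F.TotalSpace // Λ n.1 = F.toProd n.2}

instance (F : FuchsianPair S S') (Λ : C(S, S × S)) : TopologicalSpace (F.Pullback Λ) :=
  inferInstanceAs (TopologicalSpace {n : S × F.TotalSpace // Λ n.1 = F.toProd n.2})

namespace Pullback

variable {F : FuchsianPair S S'} {Λ : C(S, S × S)}

/-- The projection to the surface. -/
def pt (n : F.Pullback Λ) : S := n.1.1

/-- The point `(s, p)`. -/
def ofPair (s : S) (p : F.TotalSpace) (h : Λ s = F.toProd p) : F.Pullback Λ := ⟨(s, p), h⟩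

/-- The bundle map `i : Λ^*P_ρ → P_ρ`. -/
def incl (n : F.Pullback Λ) : F.TotalSpace := n.1.2

lemma continuous_pt : Continuous (pt : F.Pullback Λ → S) :=
  continuous_fst.comp continuous_subtype_val

lemma continuous_incl : Continuous (incl : F.Pullback Λ → F.TotalSpace) :=
  continuous_snd.comp continuous_subtype_val

lemma eq_toProd (n : F.Pullback Λ) : Λ n.pt = F.toProd n.incl := n.2

lemma ext' {m n : F.Pullback Λ} (h : m.pt = n.pt) (h' : m.incl = n.incl) : m = n :=
  Subtype.ext (Prod.ext h h')

/-- Local inverses near `n` of the two coverings `ℍ → S`. -/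
def leftInv (n : F.Pullback Λ) : OpenPartialHomeomorph S ℍ :=
  F.left.isLocalHomeomorph_quot.localInverseAt (F.rep n.incl).proj.1

def rightInv (n : F.Pullback Λ) : OpenPartialHomeomorph S ℍ :=
  F.right.isLocalHomeomorph_quot.localInverseAt (F.rep n.incl).proj.2

lemma leftInv_symm (n : F.Pullback Λ) : (n.leftInv.symm : ℍ → S) = F.left.quot :=
  F.left.isLocalHomeomorph_quot.localInverseAt_symm _

lemma rightInv_symm (n : F.Pullback Λ) : (n.rightInv.symm : ℍ → S) = F.right.quot :=
  F.right.isLocalHomeomorph_quot.localInverseAt_symm _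

/-- The unit timelike vector over `(s, t)` in the local trivialization near `n`. -/
def vector (n : F.Pullback Λ) (s : S) (t : ℝ) : UnitTimelike :=
  coordHomeo.symm (t, n.leftInv (Λ s).1, n.rightInv (Λ s).2)

lemma vector_proj (n : F.Pullback Λ) (s : S) (t : ℝ) :
    (n.vector s t).proj = (n.leftInv (Λ s).1, n.rightInv (Λ s).2) :=
  congrArg Prod.snd (coordHomeo.apply_symm_apply (t, n.leftInv (Λ s).1, n.rightInv (Λ s).2))

lemma vector_coords (n : F.Pullback Λ) (s : S) (t : ℝ) : (n.vector s t).coords.1 = t :=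
  congrArg Prod.fst (coordHomeo.apply_symm_apply (t, n.leftInv (Λ s).1, n.rightInv (Λ s).2))

lemma toProd_vector (n : F.Pullback Λ) {s : S} (t : ℝ) (hl : (Λ s).1 ∈ n.leftInv.source)
    (hr : (Λ s).2 ∈ n.rightInv.source) : Λ s = F.toProd (F.toQuot (n.vector s t)) := by
  rw [F.toProd_toQuot, vector_proj, ← n.leftInv_symm, ← n.rightInv_symm, n.leftInv.left_inv hl,
    n.rightInv.left_inv hr]

open Classical in
/-- The point of the pull-back with coordinates `(s, t)` in the local trivialization near `n`. -/
def pointOver (n : F.Pullback Λ) (s : S) (t : ℝ) : F.Pullback Λ :=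
  if h : Λ s = F.toProd (F.toQuot (n.vector s t)) then ofPair s _ h else n

lemma pointOver_val (n : F.Pullback Λ) {s : S} (t : ℝ) (hl : (Λ s).1 ∈ n.leftInv.source)
    (hr : (Λ s).2 ∈ n.rightInv.source) : (n.pointOver s t).1 = (s, F.toQuot (n.vector s t)) := by
  rw [pointOver, dif_pos (n.toProd_vector t hl hr)]
  rfl

/-- The vectors in the local section near `n`. -/
def sec (n m : F.Pullback Λ) : UnitTimelike := F.localSection n.incl m.incl

/-- The domain of the local trivialization near `n`. -/
def dom (n : F.Pullback Λ) : Set (F.Pullback Λ) :=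
  {m | m.pt ∈ (chartAt ℂ n.pt).source ∧ m.incl ∈ (F.localSection n.incl).source ∧
    (Λ m.pt).1 ∈ n.leftInv.source ∧ (Λ m.pt).2 ∈ n.rightInv.source ∧
    (n.sec m).proj.1 ∈ n.leftInv.target ∧ (n.sec m).proj.2 ∈ n.rightInv.target}

lemma vector_of_mem_dom {n m : F.Pullback Λ} (hm : m ∈ n.dom) :
    n.vector m.pt (n.sec m).coords.1 = n.sec m := by
  obtain ⟨-, h2, -, -, h5, h6⟩ := hm
  have h := m.eq_toProd
  rw [← F.toQuot_localSection n.incl h2, F.toProd_toQuot] at h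
  change Λ m.pt = (F.left.quot (n.sec m).proj.1, F.right.quot (n.sec m).proj.2) at h
  have hl : n.leftInv (Λ m.pt).1 = (n.sec m).proj.1 := by
    rw [h, ← n.leftInv_symm, n.leftInv.right_inv h5]
  have hr : n.rightInv (Λ m.pt).2 = (n.sec m).proj.2 := by
    rw [h, ← n.rightInv_symm, n.rightInv.right_inv h6]
  rw [vector, hl, hr]
  exact coordHomeo.symm_apply_apply (n.sec m)

/-- The image of the local trivialization near `n`. -/
def chartTarget (n : F.Pullback Λ) : Set (ℂ × ℝ) :=
  {u | u.1 ∈ (chartAt ℂ n.pt).target ∧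
    (Λ ((chartAt ℂ n.pt).symm u.1)).1 ∈ n.leftInv.source ∧
    (Λ ((chartAt ℂ n.pt).symm u.1)).2 ∈ n.rightInv.source ∧
    n.vector ((chartAt ℂ n.pt).symm u.1) u.2 ∈ (F.localSection n.incl).target}

lemma continuousOn_sec (n : F.Pullback Λ) :
    ContinuousOn n.sec (incl ⁻¹' (F.localSection n.incl).source) :=
  (F.localSection n.incl).continuousOn.comp continuous_incl.continuousOn fun _ hm => hm

lemma isOpen_dom (n : F.Pullback Λ) : IsOpen n.dom := by
  have h1 : IsOpen (incl ⁻¹' (F.localSection n.incl).source : Set (F.Pullback Λ)) :=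
    (F.localSection n.incl).open_source.preimage continuous_incl
  have h2 := (continuous_proj.comp_continuousOn n.continuousOn_sec).isOpen_inter_preimage h1
    (n.leftInv.open_target.prod n.rightInv.open_target)
  have h3 : IsOpen (pt ⁻¹' (chartAt ℂ n.pt).source : Set (F.Pullback Λ)) :=
    (chartAt ℂ n.pt).open_source.preimage continuous_pt
  have h4 : IsOpen ((fun m => Λ m.pt) ⁻¹' (n.leftInv.source ×ˢ n.rightInv.source) :
      Set (F.Pullback Λ)) :=
    (n.leftInv.open_source.prod n.rightInv.open_source).preimage
      (Λ.continuous.comp continuous_pt)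
  convert (h3.inter h4).inter h2 using 1
  ext m
  exact ⟨fun ⟨k1, k2, k3, k4, k5, k6⟩ => ⟨⟨k1, k3, k4⟩, k2, k5, k6⟩,
    fun ⟨⟨k1, k3, k4⟩, k2, k5, k6⟩ => ⟨k1, k2, k3, k4, k5, k6⟩⟩

lemma continuousOn_vector (n : F.Pullback Λ) :
    ContinuousOn (fun u : ℂ × ℝ => n.vector ((chartAt ℂ n.pt).symm u.1) u.2)
      {u | u.1 ∈ (chartAt ℂ n.pt).target ∧
        (Λ ((chartAt ℂ n.pt).symm u.1)).1 ∈ n.leftInv.source ∧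
        (Λ ((chartAt ℂ n.pt).symm u.1)).2 ∈ n.rightInv.source} := by
  have hs : ContinuousOn (fun u : ℂ × ℝ => Λ ((chartAt ℂ n.pt).symm u.1))
      {u | u.1 ∈ (chartAt ℂ n.pt).target ∧
        (Λ ((chartAt ℂ n.pt).symm u.1)).1 ∈ n.leftInv.source ∧
        (Λ ((chartAt ℂ n.pt).symm u.1)).2 ∈ n.rightInv.source} :=
    Λ.continuous.comp_continuousOn ((chartAt ℂ n.pt).symm.continuousOn.comp
      continuous_fst.continuousOn fun u hu => hu.1)
  refine coordHomeo.symm.continuous.comp_continuousOn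
    (continuous_snd.continuousOn.prodMk (ContinuousOn.prodMk ?_ ?_))
  · exact n.leftInv.continuousOn.comp (continuous_fst.comp_continuousOn hs) fun u hu => hu.2.1
  · exact n.rightInv.continuousOn.comp (continuous_snd.comp_continuousOn hs) fun u hu => hu.2.2

/-- The chart of the pull-back near `n`: a chart of the surface and the fibre coordinate `θ`. -/
def chart (n : F.Pullback Λ) : OpenPartialHomeomorph (F.Pullback Λ) (ℂ × ℝ) where
  toFun m := (chartAt ℂ n.pt m.pt, (n.sec m).coords.1)
  invFun u := n.pointOver ((chartAt ℂ n.pt).symm u.1) u.2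
  source := n.dom
  target := n.chartTarget
  map_source' m hm := by
    have hv := vector_of_mem_dom hm
    obtain ⟨h1, h2, h3, h4, -, -⟩ := hm
    refine ⟨(chartAt ℂ n.pt).map_source h1, ?_⟩
    dsimp only
    rw [(chartAt ℂ n.pt).left_inv h1, hv]
    exact ⟨h3, h4, (F.localSection n.incl).map_source h2⟩
  map_target' u hu := by
    obtain ⟨h1, h2, h3, h4⟩ := hu
    set s := (chartAt ℂ n.pt).symm u.1 with hs
    have hp := n.pointOver_val u.2 h2 h3
    have hpt : (n.pointOver s u.2).pt = s := congrArg Prod.fst hp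
    have hin : (n.pointOver s u.2).incl = F.toQuot (n.vector s u.2) := congrArg Prod.snd hp
    have hsec : n.sec (n.pointOver s u.2) = n.vector s u.2 := by
      rw [sec, hin, ← F.localSection_symm n.incl, (F.localSection n.incl).right_inv h4]
    refine ⟨?_, ?_, ?_, ?_, ?_, ?_⟩
    · rw [hpt]; exact (chartAt ℂ n.pt).map_target h1
    · rw [hin, ← F.localSection_symm n.incl]; exact (F.localSection n.incl).map_target h4
    · rw [hpt]; exact h2
    · rw [hpt]; exact h3
    · rw [hsec, vector_proj]; exact n.leftInv.map_source h2
    · rw [hsec, vector_proj]; exact n.rightInv.map_source h3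
  left_inv' m hm := by
    have hv := vector_of_mem_dom hm
    obtain ⟨h1, h2, h3, h4, -, -⟩ := hm
    dsimp only
    rw [(chartAt ℂ n.pt).left_inv h1]
    refine Subtype.ext ((n.pointOver_val _ h3 h4).trans ?_)
    rw [hv, sec, F.toQuot_localSection n.incl h2]
    rfl
  right_inv' u hu := by
    obtain ⟨h1, h2, h3, h4⟩ := hu
    set s := (chartAt ℂ n.pt).symm u.1 with hs
    have hp := n.pointOver_val u.2 h2 h3
    have hpt : (n.pointOver s u.2).pt = s := congrArg Prod.fst hp
    have hin : (n.pointOver s u.2).incl = F.toQuot (n.vector s u.2) := congrArg Prod.snd hp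
    have hsec : n.sec (n.pointOver s u.2) = n.vector s u.2 := by
      rw [sec, hin, ← F.localSection_symm n.incl, (F.localSection n.incl).right_inv h4]
    rw [hsec, hpt, vector_coords, hs, (chartAt ℂ n.pt).right_inv h1]
  open_source := n.isOpen_dom
  open_target := by
    have hc := (chartAt ℂ n.pt).symm.continuousOn
    have hΛ := Λ.continuous.comp_continuousOn hc
    have h1 : IsOpen ((chartAt ℂ n.pt).target ∩
        (fun z => Λ ((chartAt ℂ n.pt).symm z)) ⁻¹' (n.leftInv.source ×ˢ n.rightInv.source)) :=
      hΛ.isOpen_inter_preimage (chartAt ℂ n.pt).open_target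
        (n.leftInv.open_source.prod n.rightInv.open_source)
    have h2 : IsOpen (Prod.fst ⁻¹' _ : Set (ℂ × ℝ)) := h1.preimage continuous_fst
    have h3 := n.continuousOn_vector.isOpen_inter_preimage h2 (F.localSection n.incl).open_target
    refine (congrArg IsOpen (Set.ext fun u => ?_)).mp h3
    exact ⟨fun ⟨⟨k1, k2, k3⟩, k4⟩ => ⟨k1, k2, k3, k4⟩, fun ⟨k1, k2, k3, k4⟩ => ⟨⟨k1, k2, k3⟩, k4⟩⟩
  continuousOn_toFun := by
    refine ContinuousOn.prodMk ?_ ?_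
    · exact (chartAt ℂ n.pt).continuousOn.comp continuous_pt.continuousOn fun m hm => hm.1
    · exact (continuous_fst.comp coordHomeo.continuous).comp_continuousOn
        (n.continuousOn_sec.mono fun m hm => hm.2.1)
  continuousOn_invFun := by
    have hi : Topology.IsInducing (fun m : F.Pullback Λ => m.1) := Topology.IsInducing.subtypeVal
    rw [hi.continuousOn_iff]
    have hq : Continuous F.toQuot := F.isLocalHomeomorph_toQuot.continuous
    have h1 : ContinuousOn (fun u : ℂ × ℝ => ((chartAt ℂ n.pt).symm u.1,
        F.toQuot (n.vector ((chartAt ℂ n.pt).symm u.1) u.2))) n.chartTarget :=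
      ((chartAt ℂ n.pt).symm.continuousOn.comp continuous_fst.continuousOn
        fun u hu => hu.1).prodMk (hq.comp_continuousOn (n.continuousOn_vector.mono
          fun u hu => ⟨hu.1, hu.2.1, hu.2.2.1⟩))
    exact h1.congr fun u hu => n.pointOver_val u.2 hu.2.1 hu.2.2.1

lemma mem_dom_self (n : F.Pullback Λ) : n ∈ n.dom := by
  have h := n.eq_toProd
  have hsec : n.sec n = F.rep n.incl := F.localSection_self n.incl
  rw [← F.toQuot_rep n.incl, F.toProd_toQuot] at h
  refine ⟨mem_chart_source _ _, F.mem_localSection_source _, ?_, ?_, ?_, ?_⟩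
  · rw [h]
    exact F.left.isLocalHomeomorph_quot.apply_self_mem_localInverseAt_source
  · rw [h]
    exact F.right.isLocalHomeomorph_quot.apply_self_mem_localInverseAt_source
  · rw [hsec]
    exact F.left.isLocalHomeomorph_quot.self_mem_localInverseAt_target
  · rw [hsec]
    exact F.right.isLocalHomeomorph_quot.self_mem_localInverseAt_target

end Pullback

instance (F : FuchsianPair S S') (Λ : C(S, S × S)) : ChartedSpace (ℂ × ℝ) (F.Pullback Λ) where
  atlas := Set.range Pullback.chart
  chartAt := Pullback.chart
  mem_chart_source := Pullback.mem_dom_self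
  chart_mem_atlas n := ⟨n, rfl⟩

/-- The connection form `i^*ω_ρ` of the pull-back. -/
def pullbackConnForm (F : FuchsianPair S S') (Λ : C(S, S × S)) :
    OneForm 𝓘(ℝ, ℂ × ℝ) (F.Pullback Λ) :=
  OneForm.pullback Pullback.incl F.connForm

/-- The curvature of the pulled-back connection. The structure group `ℝ` being abelian, it is the
exterior derivative of the connection form. -/
def pullbackCurvature (F : FuchsianPair S S') (Λ : C(S, S × S)) (n : F.Pullback Λ)
    (v w : TangentSpace 𝓘(ℝ, ℂ × ℝ) n) : ℝ :=
  (F.pullbackConnForm Λ).extDeriv n v w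

/-- The pull-back `Λ^*P_ρ` with the induced connection is flat: its curvature vanishes. -/
def IsFlatPullback (F : FuchsianPair S S') (Λ : C(S, S × S)) : Prop :=
  ∀ (n : F.Pullback Λ) (v w : TangentSpace 𝓘(ℝ, ℂ × ℝ) n), F.pullbackCurvature Λ n v w = 0

/-- Flatness of the principal `ℝ`-bundle over `S` that is the pull-back of `P_ρ → M_ρ` by a lift
`Λ' : S → M_ρ` of `Λ`. This is the open subset of `Λ^*P_ρ` consisting of the points `(s, p)` such
that `p` lies over `Λ'(s)`. -/
def IsFlatAlong (F : FuchsianPair S S') (Λ : C(S, S × S)) (Λ' : S → F.Base) : Prop :=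
  ∀ n : F.Pullback Λ, F.toBase n.incl = Λ' n.pt →
    ∀ v w : TangentSpace 𝓘(ℝ, ℂ × ℝ) n, F.pullbackCurvature Λ n v w = 0

end FuchsianPair

end AdSLagrangian

end

noncomputable section

namespace AdSLagrangian

open Matrix

/-! Everything follows from one identity: the curvature of `i^*ω_ρ` is one half of the pull-back of
`Ω_ρ` by `Λ` (`pullbackCurvature_eq`).

On the unit tangent bundle use the global coordinates `(θ, x, y)`, where `(x, y)` is the geodesic
and `θ` is the argument of the automorphy factor `c y + d`. Since `χ` is horizontal, `ω` only sees
the horizontal part of a vector, and a computation with 2 × 2 matrices gives `ω = -dθ + dx₁ / (2 x₂)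
- dy₁ / (2 y₂)`, with `x = x₁ + i x₂` and `y = y₁ + i y₂` (`connForm_apply`). As `d(dx₁ / x₂)` is
the hyperbolic area form, `dω` is half the difference of the two area forms.

To pass to `P_ρ`, `ω` must be invariant under isometries. A Möbius map changes `Re dz / (2 Im z)` by
`d arg (c z + d)` (`re_div_im_smul`), and this is exactly what `θ` gains from the left factor or
loses to the right factor (`exists_hasFDerivAt_pairAct`). Hence local sections of `T¹ → P_ρ` may be
chosen at will.

A chart of `Λ^*P_ρ` is a chart of `S` together with `θ`. There the connection form is the model form
evaluated along local lifts `L`, `R : ℂ → ℍ` of the two components of `Λ`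
(`pullbackConnForm_chart_symm`). In its exterior derivative the second derivatives of `L` and `R`
cancel by symmetry, and the pulled-back area forms remain (`fderiv_modelForm`). These are the area
forms of `S` because two local inverses of the covering `ℍ → S` differ by a deck transformation,
which acts by a Möbius map and preserves area (`FuchsianStructure.area_eq`).

The curvature at a point of `Λ^*P_ρ` over `s` thus depends only on `s`, not on the position in the
fibre nor on the sheet of `M_ρ → S × S`. So it suffices to test flatness at one point over each `s`.
Such a point exists in the whole pull-back, and also among the points lying over a prescribed lift
to `M_ρ` (`exists_pt_eq`). -/

/-! ### The connection form in the coordinates `(θ, x, y)` -/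

lemma hasMFDerivAt_of_hasFDerivAt_chart {E E' M N : Type*} [NormedAddCommGroup E] [NormedSpace ℝ E]
    [NormedAddCommGroup E'] [NormedSpace ℝ E'] [TopologicalSpace M] [ChartedSpace E M]
    [TopologicalSpace N] [ChartedSpace E' N] {f : M → N} {x : M} {f' : E →L[ℝ] E'}
    (hc : ContinuousAt f x)
    (h : HasFDerivAt (fun u => chartAt E' (f x) (f ((chartAt E x).symm u))) f' (chartAt E x x)) :
    HasMFDerivAt 𝓘(ℝ, E) 𝓘(ℝ, E') f x f' := by
  -- With the trivial models the coordinate expression is `f` read in the preferred charts, and the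
  -- range of the model is the whole space.
  refine ⟨hc, ?_⟩
  exact HasFDerivAt.hasFDerivWithinAt h

/-- The coordinates `(θ, x, y)` as an element of the model space. -/
def UnitTimelike.modelCoords (T : UnitTimelike) : ℝ × ℂ × ℂ :=
  (T.coords.1, (T.coords.2.1 : ℂ), (T.coords.2.2 : ℂ))

lemma UnitTimelike.chartAt_apply (T T' : UnitTimelike) :
    chartAt (ℝ × ℂ × ℂ) T T' = T'.modelCoords := rfl

lemma UnitTimelike.chartAt_symm_modelCoords (T T' : UnitTimelike) :
    (chartAt (ℝ × ℂ × ℂ) T).symm T'.modelCoords = T' := by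
  rw [← UnitTimelike.chartAt_apply T T']
  exact (chartAt (ℝ × ℂ × ℂ) T).left_inv (Set.mem_univ _)

lemma UnitTimelike.chartAt_symm_apply (T : UnitTimelike) (θ : ℝ) (x y : ℍ) :
    (chartAt (ℝ × ℂ × ℂ) T).symm (θ, (x : ℂ), (y : ℂ)) = frame (θ, x, y) := by
  have h : (frame (θ, x, y)).modelCoords = (θ, (x : ℂ), (y : ℂ)) := by
    have : (frame (θ, x, y)).coords = (θ, x, y) := coordEquiv.right_inv (θ, x, y)
    rw [UnitTimelike.modelCoords, this]
  rw [← h, chartAt_symm_modelCoords]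

/-- `frameFactor` as a function on the model space. -/
def modelFactor (u : ℝ × ℂ × ℂ) : ℂ :=
  Real.sqrt (u.2.2.im / u.2.1.im) * Complex.exp (u.1 * Complex.I)

/-- `frameMat` as a function on the model space. -/
def modelMat (u : ℝ × ℂ × ℂ) : Fin 2 → Fin 2 → ℝ :=
  ![![(u.2.1 * modelFactor u).im / u.2.2.im,
      (u.2.1 * modelFactor u).re - (u.2.1 * modelFactor u).im / u.2.2.im * u.2.2.re],
    ![(modelFactor u).im / u.2.2.im,
      (modelFactor u).re - (modelFactor u).im / u.2.2.im * u.2.2.re]]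

/-- `rotGen` as a function on `ℂ`. -/
def modelGen (z : ℂ) : Matrix (Fin 2) (Fin 2) ℝ :=
  !![-z.re / z.im, (z.re ^ 2 + z.im ^ 2) / z.im; -1 / z.im, z.re / z.im]

/-- The vector of a frame is its matrix times the rotation generator at `y`. This puts the immersion
into pairs of matrices in closed form on the model space, where it can be differentiated. -/
lemma toMat_frame (θ : ℝ) (x y : ℍ) :
    (frame (θ, x, y)).toMat = (modelMat (θ, x, y),
      fun i j => ∑ k, modelMat (θ, x, y) i k * modelGen y k j) := by
  have h : ∀ i j, frameMat θ x y i j = modelMat (θ, x, y) i j := by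
    intro i j
    fin_cases i <;> fin_cases j <;> rfl
  refine Prod.ext ?_ ?_
  · funext i j
    exact h i j
  · funext i j
    change ((frameMat θ x y : Matrix (Fin 2) (Fin 2) ℝ) * rotGen y) i j = _
    rw [Matrix.mul_apply]
    simp only [h]
    rfl

lemma _root_.DifferentiableAt.div_real {E : Type*} [NormedAddCommGroup E] [NormedSpace ℝ E]
    {f g : E → ℝ} {u : E} (hf : DifferentiableAt ℝ f u) (hg : DifferentiableAt ℝ g u)
    (h : g u ≠ 0) : DifferentiableAt ℝ (fun u => f u / g u) u := by
  simp only [div_eq_mul_inv]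
  exact hf.mul (hg.inv h)

lemma differentiableAt_modelFactor {u : ℝ × ℂ × ℂ} (hx : 0 < u.2.1.im) (hy : 0 < u.2.2.im) :
    DifferentiableAt ℝ modelFactor u := by
  have h1 : DifferentiableAt ℝ (fun u : ℝ × ℂ × ℂ => u.2.1.im) u :=
    Complex.imCLM.differentiableAt.comp u (by fun_prop)
  have h2 : DifferentiableAt ℝ (fun u : ℝ × ℂ × ℂ => u.2.2.im) u :=
    Complex.imCLM.differentiableAt.comp u (by fun_prop)
  have h3 : DifferentiableAt ℝ (fun u : ℝ × ℂ × ℂ => Real.sqrt (u.2.2.im / u.2.1.im)) u :=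
    (h2.div_real h1 hx.ne').sqrt (div_pos hy hx).ne'
  have h4 : DifferentiableAt ℝ (fun u : ℝ × ℂ × ℂ =>
      ((Real.sqrt (u.2.2.im / u.2.1.im) : ℝ) : ℂ)) u :=
    Complex.ofRealCLM.differentiableAt.comp u h3
  have h5 : DifferentiableAt ℝ (fun u : ℝ × ℂ × ℂ => ((u.1 : ℝ) : ℂ)) u :=
    Complex.ofRealCLM.differentiableAt.comp u (by fun_prop)
  exact h4.mul (h5.mul_const _).cexp

lemma differentiableAt_modelMat {u : ℝ × ℂ × ℂ} (hx : 0 < u.2.1.im) (hy : 0 < u.2.2.im) :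
    DifferentiableAt ℝ modelMat u := by
  have hJ := differentiableAt_modelFactor hx hy
  have h1 : DifferentiableAt ℝ (fun u : ℝ × ℂ × ℂ => u.2.2.im) u :=
    Complex.imCLM.differentiableAt.comp u (by fun_prop)
  have h2 : DifferentiableAt ℝ (fun u : ℝ × ℂ × ℂ => u.2.2.re) u :=
    Complex.reCLM.differentiableAt.comp u (by fun_prop)
  have hxJ : DifferentiableAt ℝ (fun u : ℝ × ℂ × ℂ => u.2.1 * modelFactor u) u :=
    DifferentiableAt.mul (by fun_prop) hJ
  have h3 := Complex.reCLM.differentiableAt.comp u hJ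
  have h4 := Complex.imCLM.differentiableAt.comp u hJ
  have h5 := Complex.reCLM.differentiableAt.comp u hxJ
  have h6 := Complex.imCLM.differentiableAt.comp u hxJ
  refine differentiableAt_pi.2 fun i => differentiableAt_pi.2 fun j => ?_
  fin_cases i <;> fin_cases j
  · exact h6.div_real h1 hy.ne'
  · exact h5.sub ((h6.div_real h1 hy.ne').mul h2)
  · exact h4.div_real h1 hy.ne'
  · exact h3.sub ((h4.div_real h1 hy.ne').mul h2)

lemma differentiableAt_modelGen {u : ℝ × ℂ × ℂ} (hy : 0 < u.2.2.im) (k j : Fin 2) :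
    DifferentiableAt ℝ (fun u : ℝ × ℂ × ℂ => modelGen u.2.2 k j) u := by
  have h1 : DifferentiableAt ℝ (fun u : ℝ × ℂ × ℂ => u.2.2.im) u :=
    Complex.imCLM.differentiableAt.comp u (by fun_prop)
  have h2 : DifferentiableAt ℝ (fun u : ℝ × ℂ × ℂ => u.2.2.re) u :=
    Complex.reCLM.differentiableAt.comp u (by fun_prop)
  fin_cases k <;> fin_cases j
  · exact h2.neg.div_real h1 hy.ne'
  · exact ((h2.pow 2).add (h1.pow 2)).div_real h1 hy.ne'
  · exact (differentiableAt_const _).div_real h1 hy.ne'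
  · exact h2.div_real h1 hy.ne'

lemma modelCoords_im_pos (T : UnitTimelike) :
    0 < T.modelCoords.2.1.im ∧ 0 < T.modelCoords.2.2.im :=
  ⟨T.coords.2.1.im_pos, T.coords.2.2.im_pos⟩

/-- The differential of `toMat`, in the coordinates. -/
lemma matVel_fst (T : UnitTimelike) (X : ℝ × ℂ × ℂ) :
    (T.matVel X).1 = fderiv ℝ modelMat T.modelCoords X := by
  obtain ⟨hx, hy⟩ := modelCoords_im_pos T
  have hA := differentiableAt_modelMat hx hy
  -- Only the first component is wanted, but it is read off the differential of the whole of
  -- `toMat`, which would be zero by default if the second component were not differentiable.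
  have hB : DifferentiableAt ℝ (fun u : ℝ × ℂ × ℂ =>
      (fun i j => ∑ k, modelMat u i k * modelGen u.2.2 k j : Fin 2 → Fin 2 → ℝ)) T.modelCoords := by
    refine differentiableAt_pi.2 fun i => differentiableAt_pi.2 fun j => ?_
    refine DifferentiableAt.fun_sum fun k _ => ?_
    exact (differentiableAt_pi.1 (differentiableAt_pi.1 hA i) k).mul
      (differentiableAt_modelGen hy k j)
  have hd := hA.hasFDerivAt.prodMk hB.hasFDerivAt
  -- The inverse chart is the frame only where both imaginary parts are positive; this is a
  -- neighbourhood of the point, which is enough for a derivative.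
  have hev : (fun u => UnitTimelike.toMat ((chartAt (ℝ × ℂ × ℂ) T).symm u)) =ᶠ[𝓝 T.modelCoords]
      fun u => (modelMat u, fun i j => ∑ k, modelMat u i k * modelGen u.2.2 k j) := by
    have h1 : ∀ᶠ u : ℝ × ℂ × ℂ in 𝓝 T.modelCoords, 0 < u.2.1.im :=
      (Complex.continuous_im.comp (continuous_fst.comp continuous_snd)).continuousAt.eventually
        (lt_mem_nhds hx)
    have h2 : ∀ᶠ u : ℝ × ℂ × ℂ in 𝓝 T.modelCoords, 0 < u.2.2.im :=
      (Complex.continuous_im.comp (continuous_snd.comp continuous_snd)).continuousAt.eventually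
        (lt_mem_nhds hy)
    filter_upwards [h1, h2] with u hu1 hu2
    have := UnitTimelike.chartAt_symm_apply T u.1 ⟨u.2.1, hu1⟩ ⟨u.2.2, hu2⟩
    change (chartAt (ℝ × ℂ × ℂ) T).symm u = _ at this
    rw [this, toMat_frame]
  have hd' := hd.congr_of_eventuallyEq hev
  -- The chart is global, so continuity follows from that of the coordinate expression.
  have hc : ContinuousAt UnitTimelike.toMat T := by
    have h1 : ContinuousAt ((fun u => UnitTimelike.toMat ((chartAt (ℝ × ℂ × ℂ) T).symm u)) ∘
        chartAt (ℝ × ℂ × ℂ) T) T :=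
      ContinuousAt.comp (f := chartAt (ℝ × ℂ × ℂ) T) hd'.continuousAt
        ((chartAt (ℝ × ℂ × ℂ) T).continuousAt (mem_chart_source _ _))
    refine h1.congr (Filter.Eventually.of_forall fun T' => ?_)
    simp only [Function.comp_apply, UnitTimelike.chartAt_apply,
      UnitTimelike.chartAt_symm_modelCoords]
  have hm := hasMFDerivAt_of_hasFDerivAt_chart (f := UnitTimelike.toMat) (x := T) hc hd'
  rw [UnitTimelike.matVel, hm.mfderiv]
  rfl

/-- This is logarithmic differentiation: `log J = (log y₂ - log x₂) / 2 + iθ` for the model factor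
`J`. -/
lemma fderiv_modelFactor {u : ℝ × ℂ × ℂ} (hx : 0 < u.2.1.im) (hy : 0 < u.2.2.im)
    (X : ℝ × ℂ × ℂ) : fderiv ℝ modelFactor u X = modelFactor u *
      ((X.2.2.im / (2 * u.2.2.im) - X.2.1.im / (2 * u.2.1.im) : ℝ) + X.1 * Complex.I) := by
  -- Restricting to the line through `u` in the direction `X` reduces everything to one-variable
  -- rules.
  have hl : HasDerivAt (fun t : ℝ => u + t • X) X 0 := by
    simpa using ((hasDerivAt_id (0 : ℝ)).smul_const X).const_add u
  have h0 : u + (0 : ℝ) • X = u := by simp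
  have hJ := (differentiableAt_modelFactor hx hy).hasFDerivAt
  have h1 := HasFDerivAt.comp_hasDerivAt_of_eq (0 : ℝ) hJ hl h0.symm
  have hθ : HasDerivAt (fun t : ℝ => u.1 + t * X.1) X.1 0 := by
    simpa using ((hasDerivAt_id (0 : ℝ)).mul_const X.1).const_add u.1
  have hxi : HasDerivAt (fun t : ℝ => u.2.1.im + t * X.2.1.im) X.2.1.im 0 := by
    simpa using ((hasDerivAt_id (0 : ℝ)).mul_const X.2.1.im).const_add u.2.1.im
  have hyi : HasDerivAt (fun t : ℝ => u.2.2.im + t * X.2.2.im) X.2.2.im 0 := by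
    simpa using ((hasDerivAt_id (0 : ℝ)).mul_const X.2.2.im).const_add u.2.2.im
  have hq := (hyi.div hxi (by simpa using hx.ne')).sqrt (by simpa using ⟨hy.ne', hx.ne'⟩)
  have hqc := hq.ofReal_comp
  have hθc := (hθ.ofReal_comp.mul_const Complex.I).cexp
  have h2 := hqc.mul hθc
  have h3 : (modelFactor ∘ fun t : ℝ => u + t • X) = fun t : ℝ =>
      ((Real.sqrt ((u.2.2.im + t * X.2.2.im) / (u.2.1.im + t * X.2.1.im)) : ℝ) : ℂ) *
        Complex.exp (((u.1 + t * X.1 : ℝ) : ℂ) * Complex.I) := by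
    funext t
    simp [modelFactor]
  rw [h3] at h1
  refine (h1.unique h2).trans ?_
  have hs : 0 < Real.sqrt (u.2.2.im / u.2.1.im) := Real.sqrt_pos.2 (div_pos hy hx)
  have hs2 : Real.sqrt (u.2.2.im / u.2.1.im) ^ 2 = u.2.2.im / u.2.1.im :=
    Real.sq_sqrt (div_pos hy hx).le
  -- The chain rule leaves the root in a denominator; multiplying by it turns it into its square,
  -- `y₂ / x₂`.
  have key : (X.2.2.im * u.2.1.im - u.2.2.im * X.2.1.im) / u.2.1.im ^ 2 /
      (2 * Real.sqrt (u.2.2.im / u.2.1.im)) = Real.sqrt (u.2.2.im / u.2.1.im) *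
      (X.2.2.im / (2 * u.2.2.im) - X.2.1.im / (2 * u.2.1.im)) := by
    rw [div_eq_iff (by positivity)]
    have : ∀ a : ℝ, Real.sqrt (u.2.2.im / u.2.1.im) * a * (2 * Real.sqrt (u.2.2.im / u.2.1.im)) =
      2 * a * Real.sqrt (u.2.2.im / u.2.1.im) ^ 2 := fun a => by ring
    rw [this, hs2]
    field_simp
  simp only [Pi.div_apply, zero_mul, add_zero]
  rw [key]
  simp only [modelFactor]
  push_cast
  ring

/-- The modulus of the factor expresses that a matrix of determinant one takes `y` to `x`. It is the
only relation between the entries that the computation of `ω` needs. -/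
lemma normSq_modelFactor {u : ℝ × ℂ × ℂ} (hx : 0 < u.2.1.im) (hy : 0 < u.2.2.im) :
    (modelFactor u).re ^ 2 + (modelFactor u).im ^ 2 = u.2.2.im / u.2.1.im := by
  have := normSq_frameFactor u.1 ⟨u.2.1, hx⟩ ⟨u.2.2, hy⟩
  rw [Complex.normSq_apply] at this
  rw [pow_two, pow_two]
  exact this

/-- Product and quotient rule along a line. `P` is the derivative of `x J`, and `a` and `c` are the
derivatives of the entries of the left column, in terms of which the right column is expressed. -/
lemma fderiv_modelMat {u : ℝ × ℂ × ℂ} (hx : 0 < u.2.1.im) (hy : 0 < u.2.2.im)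
    (X : ℝ × ℂ × ℂ) :
    let J := modelFactor u
    let K := fderiv ℝ modelFactor u X
    let P := X.2.1 * J + u.2.1 * K
    let a := P.im / u.2.2.im - (u.2.1 * J).im * X.2.2.im / u.2.2.im ^ 2
    let c := K.im / u.2.2.im - J.im * X.2.2.im / u.2.2.im ^ 2
    fderiv ℝ modelMat u X =
      ![![a, P.re - (a * u.2.2.re + (u.2.1 * J).im / u.2.2.im * X.2.2.re)],
        ![c, K.re - (c * u.2.2.re + J.im / u.2.2.im * X.2.2.re)]] := by
  intro J K P a c
  have hl : HasDerivAt (fun t : ℝ => u + t • X) X 0 := by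
    simpa using ((hasDerivAt_id (0 : ℝ)).smul_const X).const_add u
  have h0 : u + (0 : ℝ) • X = u := by simp
  have h1 := HasFDerivAt.comp_hasDerivAt_of_eq (0 : ℝ)
    (differentiableAt_modelMat hx hy).hasFDerivAt hl h0.symm
  have hJ : HasDerivAt (fun t : ℝ => modelFactor (u + t • X)) K 0 :=
    HasFDerivAt.comp_hasDerivAt_of_eq (0 : ℝ)
      (differentiableAt_modelFactor hx hy).hasFDerivAt hl h0.symm
  have hxl : HasDerivAt (fun t : ℝ => (u + t • X).2.1) X.2.1 0 := by
    simpa using ((hasDerivAt_id (0 : ℝ)).smul_const X.2.1).const_add u.2.1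
  have hyi : HasDerivAt (fun t : ℝ => (u + t • X).2.2.im) X.2.2.im 0 := by
    simpa using ((hasDerivAt_id (0 : ℝ)).mul_const X.2.2.im).const_add u.2.2.im
  have hyr : HasDerivAt (fun t : ℝ => (u + t • X).2.2.re) X.2.2.re 0 := by
    simpa using ((hasDerivAt_id (0 : ℝ)).mul_const X.2.2.re).const_add u.2.2.re
  have hP := hxl.mul hJ
  have hPr := Complex.reCLM.hasFDerivAt.comp_hasDerivAt (0 : ℝ) hP
  have hPi := Complex.imCLM.hasFDerivAt.comp_hasDerivAt (0 : ℝ) hP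
  have hJr := Complex.reCLM.hasFDerivAt.comp_hasDerivAt (0 : ℝ) hJ
  have hJi := Complex.imCLM.hasFDerivAt.comp_hasDerivAt (0 : ℝ) hJ
  have hy0 : (u + (0 : ℝ) • X).2.2.im ≠ 0 := by rw [h0]; exact hy.ne'
  have hne := hy.ne'
  have ha := hPi.div hyi hy0
  have hc := hJi.div hyi hy0
  have hb := hPr.sub (ha.mul hyr)
  have hd := hJr.sub (hc.mul hyr)
  have he := fun i j => (hasDerivAt_pi.1 (hasDerivAt_pi.1 h1 i) j)
  funext i j
  fin_cases i <;> fin_cases j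
  · refine ((he 0 0).unique ha).trans ?_
    simp [a, P, J, K]
    field_simp
  · refine ((he 0 1).unique hb).trans ?_
    simp [a, P, J, K]
    field_simp
    simp
  · refine ((he 1 0).unique hc).trans ?_
    simp [c, J, K]
    field_simp
  · refine ((he 1 1).unique hd).trans ?_
    simp [c, J, K]
    field_simp
    simp

/-- The connection form in the coordinates `(θ, x, y)`. -/
def modelForm (u X : ℝ × ℂ × ℂ) : ℝ :=
  -(X.1 - X.2.1.re / (2 * u.2.1.im) + X.2.2.re / (2 * u.2.2.im))

/-- As the vertical part of `χ` vanishes, `ω(X)` is minus the Anti-de Sitter product of the vector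
with `Ȧ`, that is `-tr (B A⁻¹ Ȧ) / 2`, where the left translate `B` of the vector is the rotation
generator at `y`. Substituting the matrix `A` and its derivative leaves an identity of rational
functions modulo the value of `|J|²`. -/
lemma connForm_apply (T : UnitTimelike) (X : ℝ × ℂ × ℂ) :
    UnitTimelike.connForm T X = modelForm T.modelCoords X := by
  obtain ⟨hx, hy⟩ := modelCoords_im_pos T
  have hT : T = frame T.coords := (coordEquiv.left_inv T).symm
  have hM : ∀ i j, T.pt.mat i j = modelMat T.modelCoords i j := fun i j => by
    have h := congrArg (fun T => T.toMat.1 i j) hT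
    exact h.trans (congrFun (congrFun (congrArg Prod.fst
      (toMat_frame T.coords.1 T.coords.2.1 T.coords.2.2)) i) j)
  have hB : T.body = modelGen T.modelCoords.2.2 := T.body_eq
  change -(adsMetric T.pt.mat T.vec (of (T.matVel X).1) +
    adsMetric T.pt.mat (T.covDeriv T.geodesicSpray) _) = _
  rw [T.covDeriv_geodesicSpray, matVel_fst]
  have h1 : ∀ Y, adsMetric T.pt.mat T.vec Y = (1 / 2) * (T.body *
      (T.pt.mat : Matrix (Fin 2) (Fin 2) ℝ).adjugate * Y).trace := fun Y => by
    rw [adsMetric, UnitTimelike.body, Matrix.SpecialLinearGroup.coe_inv]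
    ring
  have h2 : ∀ Y, adsMetric T.pt.mat 0 Y = 0 := fun Y => by simp [adsMetric]
  rw [h1, h2, hB, Matrix.adjugate_fin_two, Matrix.trace_fin_two]
  simp only [Matrix.mul_apply, Fin.sum_univ_two]
  rw [fderiv_modelMat hx hy]
  simp only [hM]
  have hn := normSq_modelFactor hx hy
  have hK := fderiv_modelFactor hx hy X
  have hKr := congrArg Complex.re hK
  have hKi := congrArg Complex.im hK
  simp only [modelMat, modelGen, modelForm]
  generalize fderiv ℝ modelFactor T.modelCoords X = K at *
  generalize modelFactor T.modelCoords = J at *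
  generalize T.modelCoords = u at *
  obtain ⟨θ, x, y⟩ := u
  obtain ⟨θ', x', y'⟩ := X
  simp only [Complex.mul_re, Complex.mul_im, Complex.add_re, Complex.add_im, Complex.ofReal_re,
    Complex.ofReal_im, Complex.I_re, Complex.I_im] at hKr hKi
  simp only [Matrix.of_apply, Matrix.cons_val', Matrix.cons_val_zero, Matrix.cons_val_one,
      Matrix.cons_val_fin_one, Complex.mul_re, Complex.mul_im, Complex.add_re, Complex.add_im,
      hKr, hKi] at hx hy hn ⊢
  generalize J.re = p at *
  generalize J.im = q at *
  generalize x.re = x1 at *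
  generalize x.im = x2 at *
  generalize y.re = y1 at *
  generalize y.im = y2 at *
  generalize x'.re = a1 at *
  generalize x'.im = a2 at *
  generalize y'.re = b1 at *
  generalize y'.im = b2 at *
  clear hK hKr hKi hM hB hT h1 h2
  have hx2 := hx.ne'
  have hy2 := hy.ne'
  field_simp at hn ⊢
  -- The relation is `|J|² = y₂ / x₂`; its multiplier is the model form with denominators cleared,
  -- that is, multiplied by `4 y₂³ x₂`.
  linear_combination
    (-2 * y2 ^ 2 * x2 * b1 + 2 * y2 ^ 3 * a1 - 4 * y2 ^ 3 * x2 * θ') * hn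

/-! ### Isometries in the coordinates -/

/-- The quotient of two values of `c z + d` avoids the negative real axis, so its principal
logarithm is continuous in `z`. The right-hand side is then a continuous logarithm of `c z + d` that
agrees with the given one at `w`. It makes the abstract logarithm differentiable. -/
lemma SL2Tilde.log_eq (α : SL2Tilde) (z w : ℍ) :
    α.log z = α.log w + Complex.log (autFactor α.mat z / autFactor α.mat w) := by
  have hw := autFactor_ne_zero α.mat w
  let β : SL2Tilde :=
    { mat := α.mat
      log := fun z => α.log w + Complex.log (autFactor α.mat z / autFactor α.mat w)
      continuous_log := continuous_const.add
        (((autFactor_continuous _).div_const _).clog fun z => autFactor_div_mem_slitPlane _ z w)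
      exp_log := fun z => by
        rw [Complex.exp_add, Complex.exp_log (div_ne_zero (autFactor_ne_zero _ z) hw), α.exp_log,
          mul_div_cancel₀ _ hw] }
  have h : α = β := SL2Tilde.ext_of_log_eq rfl w (by simp [β, div_self hw])
  exact congrFun (congrArg SL2Tilde.log h) z

section

variable {E : Type*} [NormedAddCommGroup E] [NormedSpace ℝ E] {f : E → ℍ} {f' : E →L[ℝ] ℂ} {u : E}

lemma hasFDerivAt_autFactor (g : SL(2, ℝ)) (hf : HasFDerivAt (fun u => (f u : ℂ)) f' u) :
    HasFDerivAt (fun u => autFactor g (f u)) ((g 1 0 : ℂ) • f') u :=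
  (hf.const_mul (g 1 0 : ℂ)).add_const (g 1 1 : ℂ)

lemma SL2Tilde.hasFDerivAt_log (α : SL2Tilde) (hf : HasFDerivAt (fun u => (f u : ℂ)) f' u) :
    HasFDerivAt (fun u => α.log (f u))
      (((α.mat 1 0 : ℂ) / autFactor α.mat (f u)) • f') u := by
  have hne := autFactor_ne_zero α.mat (f u)
  -- Taking `f u` as base point makes the quotient equal to 1 at `u`, inside the slit plane.
  have h1 : HasFDerivAt (fun v => autFactor α.mat (f v) / autFactor α.mat (f u))
      ((autFactor α.mat (f u))⁻¹ • (α.mat 1 0 : ℂ) • f') u := by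
    simp only [div_eq_inv_mul]
    exact (hasFDerivAt_autFactor α.mat hf).const_mul _
  have h2 := (HasDerivAt.comp_hasFDerivAt u
    (Complex.hasDerivAt_log (autFactor_div_mem_slitPlane α.mat (f u) (f u))) h1).const_add
      (α.log (f u))
  have h3 : (fun v => α.log (f v)) = fun v => α.log (f u) +
      (Complex.log ∘ fun v => autFactor α.mat (f v) / autFactor α.mat (f u)) v := by
    funext v
    exact α.log_eq (f v) (f u)
  rw [h3]
  refine h2.congr_fderiv ?_
  rw [div_self hne, inv_one, one_smul, smul_smul, div_eq_inv_mul]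

lemma hasFDerivAt_smul (g : SL(2, ℝ)) (hf : HasFDerivAt (fun u => (f u : ℂ)) f' u) :
    HasFDerivAt (fun u => ((g • f u : ℍ) : ℂ)) ((1 / autFactor g (f u) ^ 2) • f') u := by
  have hne := autFactor_ne_zero g (f u)
  have hj := hasFDerivAt_autFactor g hf
  have hi := HasDerivAt.comp_hasFDerivAt u (hasDerivAt_inv hne) hj
  have hn : HasFDerivAt (fun u => (g 0 0 : ℂ) * f u + (g 0 1 : ℂ)) ((g 0 0 : ℂ) • f') u :=
    (hf.const_mul (g 0 0 : ℂ)).add_const (g 0 1 : ℂ)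
  have h := hn.mul hi
  have e : (fun u => ((g • f u : ℍ) : ℂ)) =
      fun u => ((g 0 0 : ℂ) * f u + (g 0 1 : ℂ)) *
        ((fun z : ℂ => z⁻¹) ∘ fun u => autFactor g (f u)) u := by
    funext v
    rw [← coe_smul_mul_autFactor]
    exact (mul_inv_cancel_right₀ (autFactor_ne_zero g (f v)) _).symm
  rw [e]
  refine HasFDerivAt.congr_fderiv h ?_
  have hdet := g.det_coe
  rw [Matrix.det_fin_two] at hdet
  have hdC : (g 0 0 : ℂ) * g 1 1 - g 0 1 * g 1 0 = 1 := by exact_mod_cast hdet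
  have hj' : autFactor g (f u) = g 1 0 * f u + g 1 1 := rfl
  ext a
  simp only [_root_.smul_apply, _root_.add_apply, smul_eq_mul,
    Function.comp_apply]
  field_simp
  rw [hj']
  -- The numerator of the derivative of the Möbius map is `a (c z + d) - c (a z + b)`, which is the
  -- determinant.
  linear_combination (f' a) * hdC

end

lemma im_smul_eq (g : SL(2, ℝ)) (z : ℍ) :
    (g • z).im * Complex.normSq (autFactor g z) = z.im := by
  have h := UpperHalfPlane.im_smul_eq_div_normSq (g : GL (Fin 2) ℝ) z
  have h2 : (g : GL (Fin 2) ℝ) • z = g • z := by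
    ext1
    rw [UpperHalfPlane.coe_specialLinearGroup_apply, UpperHalfPlane.coe_smul_of_det_pos (by simp)]
    rfl
  rw [h2] at h
  have hne : Complex.normSq (autFactor g z) ≠ 0 := by simpa using autFactor_ne_zero g z
  refine (eq_div_iff hne).1 ?_
  simpa [autFactor, UpperHalfPlane.denom] using h

/-- Put `j = c z + d`. From `conj j = j - 2i Im j` one gets `conj j ^ 2 = |j|² - 2i (Im j) conj j`.
The first term gives the invariant part, because `Im (g z) = Im z / |j|²`. As `Im j = c Im z`, the
second gives `Im (c v / j)`, the differential of `arg (c z + d)`: this is the cocycle by which the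
form `Re dz / (2 Im z)` fails to be invariant. -/
lemma re_div_im_smul (g : SL(2, ℝ)) (z : ℍ) (v : ℂ) :
    (1 / autFactor g z ^ 2 * v).re / (2 * (g • z).im) =
      v.re / (2 * z.im) + ((g 1 0 : ℂ) / autFactor g z * v).im := by
  have hne := autFactor_ne_zero g z
  have him := im_smul_eq g z
  have hn : Complex.normSq (autFactor g z) ≠ 0 := by simpa using hne
  have hz := z.im_pos.ne'
  have hgz := (g • z).im_pos.ne'
  have e1 : 1 / autFactor g z ^ 2 * v =
      (starRingEnd ℂ (autFactor g z)) ^ 2 * v / ((Complex.normSq (autFactor g z) ^ 2 : ℝ) : ℂ) := by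
    have := Complex.mul_conj (autFactor g z)
    push_cast
    rw [← this]
    have : starRingEnd ℂ (autFactor g z) ≠ 0 := by simpa using hne
    field_simp
  have e2 : (g 1 0 : ℂ) / autFactor g z * v =
      g 1 0 * starRingEnd ℂ (autFactor g z) * v / ((Complex.normSq (autFactor g z) : ℝ) : ℂ) := by
    rw [← Complex.mul_conj (autFactor g z)]
    have : starRingEnd ℂ (autFactor g z) ≠ 0 := by simpa using hne
    field_simp
  have e3 : (autFactor g z).im = g 1 0 * z.im := by simp [autFactor]
  rw [e1, e2, Complex.div_ofReal_re, Complex.div_ofReal_im]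
  have e4 : (g • z).im = z.im / Complex.normSq (autFactor g z) := by
    rw [← him]; field_simp
  rw [e4]
  have e5 := Complex.normSq_apply (autFactor g z)
  generalize Complex.normSq (autFactor g z) = N at *
  generalize autFactor g z = j at *
  have hc : g 1 0 = j.im / z.im := by rw [e3]; field_simp
  simp [pow_two, hc]
  field_simp
  rw [e5]
  ring

lemma pairAct_modelCoords (g : SL2Tilde × SL2Tilde) (T : UnitTimelike) :
    (pairAct g T).modelCoords =
      (T.coords.1 + (g.1.log T.coords.2.1).im - (g.2.log T.coords.2.2).im,
        ((g.1.mat • T.coords.2.1 : ℍ) : ℂ), ((g.2.mat • T.coords.2.2 : ℍ) : ℂ)) := by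
  rw [UnitTimelike.modelCoords, pairAct_coords]

/-- The connection form is invariant under the isometries. -/
lemma exists_hasFDerivAt_pairAct {E : Type*} [NormedAddCommGroup E] [NormedSpace ℝ E]
    {W : E → UnitTimelike} {W' : E →L[ℝ] ℝ × ℂ × ℂ} {u : E} (g : SL2Tilde × SL2Tilde)
    (hW : HasFDerivAt (fun u => (W u).modelCoords) W' u) :
    ∃ V' : E →L[ℝ] ℝ × ℂ × ℂ, HasFDerivAt (fun u => (pairAct g (W u)).modelCoords) V' u ∧
      ∀ a, modelForm (pairAct g (W u)).modelCoords (V' a) = modelForm (W u).modelCoords (W' a) := by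
  have h1 := hW.fst
  have h2 : HasFDerivAt (fun u => ((W u).coords.2.1 : ℂ)) _ u := hW.snd.fst
  have h3 : HasFDerivAt (fun u => ((W u).coords.2.2 : ℂ)) _ u := hW.snd.snd
  have k1 := Complex.imCLM.hasFDerivAt.comp u (g.1.hasFDerivAt_log h2)
  have k2 := Complex.imCLM.hasFDerivAt.comp u (g.2.hasFDerivAt_log h3)
  have h := ((h1.add k1).sub k2).prodMk
    ((hasFDerivAt_smul g.1.mat h2).prodMk (hasFDerivAt_smul g.2.mat h3))
  refine ⟨_, h.congr_of_eventuallyEq (Filter.Eventually.of_forall fun v =>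
    pairAct_modelCoords g (W v)), fun a => ?_⟩
  rw [pairAct_modelCoords]
  have r1 := re_div_im_smul g.1.mat (W u).coords.2.1 (W' a).2.1
  have r2 := re_div_im_smul g.2.mat (W u).coords.2.2 (W' a).2.2
  simp only [modelForm, UnitTimelike.modelCoords]
  change -(((W' a).1 + (_ * (W' a).2.1).im - (_ * (W' a).2.2).im) -
    (_ * (W' a).2.1).re / (2 * (g.1.mat • (W u).coords.2.1).im) +
    (_ * (W' a).2.2).re / (2 * (g.2.mat • (W u).coords.2.2).im)) =
    -((W' a).1 - (W' a).2.1.re / (2 * (W u).coords.2.1.im) +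
      (W' a).2.2.re / (2 * (W u).coords.2.2.im))
  -- The cocycles of `x` and of `y` cancel the variations of the two logarithms added to and
  -- subtracted from `θ`.
  linear_combination r1 - r2

/-! ### The exterior derivative in the coordinates -/

/-- The area form of the hyperbolic plane at `z`, on the model space. -/
def modelArea (z v w : ℂ) : ℝ := (v.re * w.im - v.im * w.re) / z.im ^ 2

/-- The function is the coefficient along `a` of the pull-back by `L` of `Re dz / (2 Im z)`. The
formula separates the second derivative of `L`, symmetric in `v` and `a`, from the term that
produces the area form. -/
lemma hasFDerivAt_re_div_im {L : ℂ → ℂ} {z : ℂ} (hL : ContDiffAt ℝ 2 L z) (hz : (L z).im ≠ 0)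
    (a : ℂ) : ∃ D : ℂ →L[ℝ] ℝ,
      HasFDerivAt (fun z => (fderiv ℝ L z a).re / (2 * (L z).im)) D z ∧
      ∀ v, D v = (fderiv ℝ (fderiv ℝ L) z v a).re / (2 * (L z).im) -
        (fderiv ℝ L z a).re * (fderiv ℝ L z v).im / (2 * (L z).im ^ 2) := by
  have h1 : HasFDerivAt L (fderiv ℝ L z) z := (hL.differentiableAt (by norm_num)).hasFDerivAt
  have h2 : HasFDerivAt (fderiv ℝ L) (fderiv ℝ (fderiv ℝ L) z) z :=
    ((hL.fderiv_right (m := 1) (by norm_num)).differentiableAt (by norm_num)).hasFDerivAt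
  have h3 := Complex.reCLM.hasFDerivAt.comp z (h2.clm_apply (hasFDerivAt_const a z))
  have h4 := (Complex.imCLM.hasFDerivAt.comp z h1).const_mul (2 : ℝ)
  have hne : 2 * (Complex.imCLM ∘ L) z ≠ 0 := mul_ne_zero two_ne_zero hz
  have h5 := h3.mul (HasDerivAt.comp_hasFDerivAt z (hasDerivAt_inv hne) h4)
  refine ⟨_, h5.congr_of_eventuallyEq (Filter.Eventually.of_forall fun v => ?_), fun v => ?_⟩
  · exact div_eq_mul_inv _ _
  · simp
    field_simp
    ring

/-- The `dθ` part has constant coefficients. In the other two parts antisymmetrization removes the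
second derivatives of `L` and `R`, and what is left of each is half a pulled-back area form. -/
lemma fderiv_modelForm {L R : ℂ → ℂ} {p : ℂ × ℝ} (hL : ContDiffAt ℝ 2 L p.1)
    (hR : ContDiffAt ℝ 2 R p.1) (hLi : (L p.1).im ≠ 0) (hRi : (R p.1).im ≠ 0) (v w : ℂ × ℝ) :
    let η : ℂ × ℝ → ℂ × ℝ → ℝ := fun u a =>
      modelForm (u.2, L u.1, R u.1) (a.2, fderiv ℝ L u.1 a.1, fderiv ℝ R u.1 a.1)
    fderiv ℝ (fun u => η u w) p v - fderiv ℝ (fun u => η u v) p w =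
      (modelArea (L p.1) (fderiv ℝ L p.1 v.1) (fderiv ℝ L p.1 w.1) -
        modelArea (R p.1) (fderiv ℝ R p.1 v.1) (fderiv ℝ R p.1 w.1)) / 2 := by
  intro η
  have key : ∀ a b : ℂ × ℝ, fderiv ℝ (fun u => η u a) p b =
      ((fderiv ℝ (fderiv ℝ L) p.1 b.1 a.1).re / (2 * (L p.1).im) -
        (fderiv ℝ L p.1 a.1).re * (fderiv ℝ L p.1 b.1).im / (2 * (L p.1).im ^ 2)) -
      ((fderiv ℝ (fderiv ℝ R) p.1 b.1 a.1).re / (2 * (R p.1).im) -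
        (fderiv ℝ R p.1 a.1).re * (fderiv ℝ R p.1 b.1).im / (2 * (R p.1).im ^ 2)) := by
    intro a b
    obtain ⟨D, hD, hD'⟩ := hasFDerivAt_re_div_im hL hLi a.1
    obtain ⟨G, hG, hG'⟩ := hasFDerivAt_re_div_im hR hRi a.1
    have h1 := hD.comp p hasFDerivAt_fst
    have h2 := hG.comp p hasFDerivAt_fst
    have h : HasFDerivAt (fun u => η u a) _ p := ((h1.const_sub a.2).add h2).neg
    rw [h.fderiv, ← hD', ← hG']
    simp
    ring
  have sL : ∀ a b, fderiv ℝ (fderiv ℝ L) p.1 a b = fderiv ℝ (fderiv ℝ L) p.1 b a := fun a b =>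
    (hL.isSymmSndFDerivAt (by simp)) a b
  have sR : ∀ a b, fderiv ℝ (fderiv ℝ R) p.1 a b = fderiv ℝ (fderiv ℝ R) p.1 b a := fun a b =>
    (hR.isSymmSndFDerivAt (by simp)) a b
  rw [key, key, sL v.1, sR v.1, modelArea, modelArea]
  field_simp
  ring

/-! ### Local inverses of local diffeomorphisms -/

/-- The topological local inverse and the smooth inverse given by the local diffeomorphism are both
sections of `f`. Near `y` the smooth one takes values in the target of the other, where `f` is
injective, so the two agree there. -/
lemma contMDiffAt_localInverseAt {E E' M N : Type*} [NormedAddCommGroup E] [NormedSpace ℝ E]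
    [NormedAddCommGroup E'] [NormedSpace ℝ E'] [TopologicalSpace M] [ChartedSpace E M]
    [TopologicalSpace N] [ChartedSpace E' N] {f : M → N} {k : ℕ∞ω}
    (hf : IsLocalDiffeomorph 𝓘(ℝ, E) 𝓘(ℝ, E') k f) (hl : IsLocalHomeomorph f) (x : M) {y : N}
    (hy : y ∈ (hl.localInverseAt x).source) :
    ContMDiffAt 𝓘(ℝ, E') 𝓘(ℝ, E) k (hl.localInverseAt x) y := by
  set e := hl.localInverseAt x with he
  have hy' : f (e y) = y := hl.apply_localInverseAt_of_mem hy
  have h := hf (e y)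
  have hs := h.localInverse_contMDiffAt
  have hx : h.localInverse (f (e y)) = e y := h.localInverse_left_inv h.localInverse_mem_target
  have hr := h.localInverse_eventuallyEq_right
  rw [hy'] at hs hx hr
  refine hs.congr_of_eventuallyEq ?_
  have ht : ∀ᶠ z in 𝓝 y, h.localInverse z ∈ e.target := by
    refine hs.continuousAt.eventually_mem ?_
    rw [hx]
    exact e.open_target.mem_nhds (e.map_source hy)
  filter_upwards [ht, hr] with z hz hz'
  have h1 : e (e.symm (h.localInverse z)) = h.localInverse z := e.right_inv hz
  have hes : e.symm (h.localInverse z) = f (h.localInverse z) :=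
    congrFun (hl.localInverseAt_symm x) _
  have h2 : f (h.localInverse z) = z := hz'
  rw [hes, h2] at h1
  exact h1

/-! ### The action of the group of deck transformations -/

instance UpperHalfPlane.locallyPathConnectedSpace : LocallyPathConnectedSpace ℍ :=
  UpperHalfPlane.isOpenEmbedding_coe.locallyPathConnectedSpace

section

variable {S S' : Type*} [TopologicalSpace S] [TopologicalSpace S'] {cover : S' → S}

/-- A universal covering is normal: by the lifting criterion the covering lifts through itself to a
map taking `x` to `y` and to one taking `y` to `x`. Their composites are lifts with a fixed point,
hence the identity. -/
lemma exists_deckGroup_apply_eq [SimplyConnectedSpace S'] [LocallyPathConnectedSpace S']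
    (hc : IsCoveringMap cover) {x y : S'} (h : cover x = cover y) :
    ∃ τ : deckGroup cover, τ.1 x = y := by
  have lift : ∀ {x y : S'}, cover x = cover y →
      ∃ f : C(S', S'), f x = y ∧ cover ∘ f = cover := fun {x y} h => by
    obtain ⟨f, ⟨h1, h2⟩, -⟩ := hc.existsUnique_continuousMap_lifts
      (⟨cover, hc.continuous⟩ : C(S', S)) x y h.symm
    exact ⟨f, h1, h2⟩
  obtain ⟨f, hf, hf'⟩ := lift h
  obtain ⟨g, hg, hg'⟩ := lift h.symm
  have hfg : (f ∘ g : S' → S') = id :=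
    hc.eq_of_comp_eq (f.continuous.comp g.continuous) continuous_id
      (by rw [← Function.comp_assoc, hf', hg', Function.comp_id]) y (by simp [hg, hf])
  have hgf : (g ∘ f : S' → S') = id :=
    hc.eq_of_comp_eq (g.continuous.comp f.continuous) continuous_id
      (by rw [← Function.comp_assoc, hg', hf', Function.comp_id]) x (by simp [hg, hf])
  exact ⟨⟨⟨⟨f, g, congrFun hgf, congrFun hfg⟩, f.continuous, g.continuous⟩, congrFun hf'⟩, hf⟩

variable [ChartedSpace ℂ S] {ρ : deckGroup cover →* PSL(2, ℝ)}

lemma FuchsianStructure.exists_smul_eq [SimplyConnectedSpace S'] (hc : IsCoveringMap cover)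
    (h : FuchsianStructure cover ρ) {z w : ℍ} (hzw : h.quot z = h.quot w) :
    ∃ g : SL(2, ℝ), g • z = w ∧ ∀ z, h.quot (g • z) = h.quot z := by
  -- The lifting criterion needs local path-connectedness, which `S'` inherits from the hyperbolic
  -- plane through the developing map.
  have : LocallyPathConnectedSpace S' :=
    h.dev.isOpenEmbedding.locallyPathConnectedSpace
  obtain ⟨τ, hτ⟩ := exists_deckGroup_apply_eq hc hzw
  obtain ⟨g, hg⟩ := QuotientGroup.mk_surjective (ρ τ)
  refine ⟨g, ?_, fun z => ?_⟩
  · rw [← mk_smul, hg, ← h.dev.symm.injective.eq_iff, h.dev_symm_smul, hτ]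
  · rw [← mk_smul, hg, h.quot_smul]

/-! ### The area form of a hyperbolic surface -/

lemma UpperHalfPlane.hasMFDerivAt_of_coe {E M : Type*} [NormedAddCommGroup E] [NormedSpace ℝ E]
    [TopologicalSpace M] [ChartedSpace E M] {f : M → ℍ} {x : M} {f' : E →L[ℝ] ℂ}
    (hc : ContinuousAt f x)
    (h : HasFDerivAt (fun u => (f ((chartAt E x).symm u) : ℂ)) f' (chartAt E x x)) :
    HasMFDerivAt 𝓘(ℝ, E) 𝓘(ℝ, ℂ) f x f' :=
  hasMFDerivAt_of_hasFDerivAt_chart hc h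

lemma UpperHalfPlane.hasFDerivAt_coe_of_hasMFDerivAt {E M : Type*} [NormedAddCommGroup E]
    [NormedSpace ℝ E] [TopologicalSpace M] [ChartedSpace E M] {f : M → ℍ} {x : M}
    {f' : E →L[ℝ] ℂ} (h : HasMFDerivAt 𝓘(ℝ, E) 𝓘(ℝ, ℂ) f x f') :
    HasFDerivAt (fun u => (f ((chartAt E x).symm u) : ℂ)) f' (chartAt E x x) := by
  exact HasFDerivWithinAt.hasFDerivAt (E := E) (F := ℂ) h.2 (by simp)

/-- Multiplication by the complex number `(c z + d)⁻²` scales Euclidean area by `|c z + d|⁻⁴`, and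
`(Im z)²` is scaled by the same factor. -/
lemma modelArea_smul (g : SL(2, ℝ)) (z : ℍ) (v w : ℂ) :
    modelArea (g • z : ℍ) (1 / autFactor g z ^ 2 * v) (1 / autFactor g z ^ 2 * w) =
      modelArea z v w := by
  have hne := autFactor_ne_zero g z
  have hn : Complex.normSq (autFactor g z) ≠ 0 := by simpa using hne
  have hgz := (g • z).im_pos.ne'
  have h1 : ∀ k v w : ℂ, (k * v).re * (k * w).im - (k * v).im * (k * w).re =
      Complex.normSq k * (v.re * w.im - v.im * w.re) := fun k v w => by
    rw [Complex.normSq_apply]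
    simp
    ring
  rw [modelArea, modelArea, h1, UpperHalfPlane.coe_im, UpperHalfPlane.coe_im, ← im_smul_eq g z]
  simp
  field_simp

/-- The area form of the surface may be computed through any local inverse of the covering. -/
lemma FuchsianStructure.area_eq [SimplyConnectedSpace S'] (hc : IsCoveringMap cover)
    (h : FuchsianStructure cover ρ) (hs : Function.Surjective h.quot) (z₀ : ℍ) {s : S}
    (hz₀ : s ∈ (h.isLocalHomeomorph_quot.localInverseAt z₀).source) (v w : ℂ) :
    h.area hs s v w = modelArea (h.isLocalHomeomorph_quot.localInverseAt z₀ s)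
      (mfderiv 𝓘(ℝ, ℂ) 𝓘(ℝ, ℂ) (h.isLocalHomeomorph_quot.localInverseAt z₀) s v)
      (mfderiv 𝓘(ℝ, ℂ) 𝓘(ℝ, ℂ) (h.isLocalHomeomorph_quot.localInverseAt z₀) s w) := by
  set b := h.isLocalHomeomorph_quot.localInverseAt z₀ with hb
  set z₁ := Function.surjInv hs s
  have hz₁ : h.quot z₁ = s := Function.surjInv_eq hs s
  set a := h.isLocalHomeomorph_quot.localInverseAt z₁ with ha
  have hsa : s ∈ a.source := by
    have := h.isLocalHomeomorph_quot.apply_self_mem_localInverseAt_source (x := z₁)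
    rwa [hz₁] at this
  have hqb : ∀ t ∈ b.source, h.quot (b t) = t := fun t ht =>
    h.isLocalHomeomorph_quot.apply_localInverseAt_of_mem ht
  have hqa : ∀ t ∈ a.source, h.quot (a t) = t := fun t ht =>
    h.isLocalHomeomorph_quot.apply_localInverseAt_of_mem ht
  -- The values at `s` of the two local inverses lie in one fibre, so a Möbius map coming from a
  -- deck transformation joins them.
  obtain ⟨g, hg, hgq⟩ := h.exists_smul_eq hc ((hqb s hz₀).trans (hqa s hsa).symm)
  have hbc : ContinuousAt b s := b.continuousAt hz₀
  -- `g ∘ b` is also a section of the covering and near `s` has values in the target of `a`, where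
  -- the covering is injective.
  have hev : (a : S → ℍ) =ᶠ[𝓝 s] fun t => g • b t := by
    have h1 : ∀ᶠ t in 𝓝 s, g • b t ∈ a.target := by
      refine ((continuous_const_smul g).continuousAt.comp hbc).eventually_mem ?_
      change a.target ∈ 𝓝 (g • b s)
      rw [hg]
      exact a.open_target.mem_nhds (a.map_source hsa)
    filter_upwards [h1, b.open_source.mem_nhds hz₀] with t ht htb
    have h2 := a.right_inv ht
    rw [ha, h.isLocalHomeomorph_quot.localInverseAt_symm, hgq, hqb t htb] at h2
    exact h2
  have hbm : MDifferentiableAt 𝓘(ℝ, ℂ) 𝓘(ℝ, ℂ) b s :=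
    (contMDiffAt_localInverseAt h.isLocalDiffeomorph h.isLocalHomeomorph_quot z₀
      hz₀).mdifferentiableAt (by simp)
  have hbd := hbm.hasMFDerivAt
  obtain ⟨D, hD⟩ : ∃ D : ℂ →L[ℝ] ℂ, D = mfderiv 𝓘(ℝ, ℂ) 𝓘(ℝ, ℂ) b s := ⟨_, rfl⟩
  rw [← hD] at hbd
  have hbf := UpperHalfPlane.hasFDerivAt_coe_of_hasMFDerivAt hbd
  have hsm := hasFDerivAt_smul g hbf
  have hss : (chartAt ℂ s).symm (chartAt ℂ s s) = s :=
    (chartAt ℂ s).left_inv (mem_chart_source _ _)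
  have hgm : HasMFDerivAt 𝓘(ℝ, ℂ) 𝓘(ℝ, ℂ) (fun t => g • b t) s _ :=
    UpperHalfPlane.hasMFDerivAt_of_coe ((continuous_const_smul g).continuousAt.comp hbc) hsm
  have ham := hgm.congr_of_eventuallyEq hev
  have has : a s = g • b s := hg.symm
  change hyperbolicArea (a s) (mfderiv 𝓘(ℝ, ℂ) 𝓘(ℝ, ℂ) a s v) (mfderiv 𝓘(ℝ, ℂ) 𝓘(ℝ, ℂ) a s w) = _
  rw [ham.mfderiv, ← hD, hss, has]
  exact modelArea_smul g (b s) (D v) (D w)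

end

namespace FuchsianPair

variable {S S' : Type*} [TopologicalSpace S] [ChartedSpace ℂ S] [TopologicalSpace S']

lemma two_le_infty : (2 : ℕ∞ω) ≤ ∞ := WithTop.coe_le_coe.2 le_top

/-! ### Local sections of `T¹ → P_ρ` -/

/-- A lift of a map to `P_ρ` differs from the lift through a local section by an isometry. -/
lemma exists_localSection_toQuot_eq (F : FuchsianPair S S') {X : Type*} [TopologicalSpace X]
    {f : X → UnitTimelike} {x : X} (hf : ContinuousAt f x) {q : F.TotalSpace}
    (hq : F.toQuot (f x) ∈ (F.localSection q).source) :
    ∃ g : SL2Tilde × SL2Tilde,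
      ∀ᶠ x' in 𝓝 x, F.localSection q (F.toQuot (f x')) = pairAct g (f x') := by
  set T := F.localSection q (F.toQuot (f x)) with hT
  have h1 : F.toQuot T = F.toQuot (f x) := F.toQuot_localSection q hq
  obtain ⟨γ, hγ⟩ : T ∈ MulAction.orbit F.lift.range (f x) :=
    F.isQuotientCoveringMap_toQuot.apply_eq_iff_mem_orbit.1 h1
  obtain ⟨g, hg⟩ := QuotientGroup.mk_surjective (γ : Isom0)
  have hgs : ∀ T : UnitTimelike, γ • T = pairAct g T := fun T => by
    change (γ : Isom0) • T = _
    rw [← hg, mk_smul_unitTimelike]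
  have hquot : ∀ T : UnitTimelike, F.toQuot (γ • T) = F.toQuot T := fun T =>
    F.isQuotientCoveringMap_toQuot.apply_eq_iff_mem_orbit.2 ⟨γ, rfl⟩
  have hcont : Continuous fun T : UnitTimelike => γ • T := continuous_const_smul (γ : Isom0)
  refine ⟨g, ?_⟩
  -- The isometry is chosen at `x` alone. By continuity the translated lift stays in the sheet of
  -- the section, so the same isometry works nearby.
  have hev : ∀ᶠ x' in 𝓝 x, γ • f x' ∈ (F.localSection q).target := by
    refine (hcont.continuousAt.comp hf).eventually_mem ?_
    change (F.localSection q).target ∈ 𝓝 (γ • f x)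
    have h2 : γ • f x = T := hγ
    rw [h2]
    exact (F.localSection q).open_target.mem_nhds ((F.localSection q).map_source hq)
  filter_upwards [hev] with x' hx'
  have h3 := (F.localSection q).right_inv hx'
  rw [F.localSection_symm, hquot] at h3
  rw [h3, hgs]

/-- The chart at `p` is this very section followed by `(θ, x, y)`, so the coordinate expression of
the section is the identity. -/
lemma mdifferentiableAt_localSection (F : FuchsianPair S S') (p : F.TotalSpace) :
    MDifferentiableAt 𝓘(ℝ, ℝ × ℂ × ℂ) 𝓘(ℝ, ℝ × ℂ × ℂ) (F.localSection p) p := by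
  have hp := F.mem_localSection_source p
  refine (hasMFDerivAt_of_hasFDerivAt_chart (f' := ContinuousLinearMap.id ℝ _)
    ((F.localSection p).continuousAt hp) ?_).mdifferentiableAt
  have ht : chartAt (ℝ × ℂ × ℂ) p p ∈ (chartAt (ℝ × ℂ × ℂ) p).target :=
    (chartAt (ℝ × ℂ × ℂ) p).map_source (mem_chart_source _ _)
  refine (hasFDerivAt_id _).congr_of_eventuallyEq ?_
  filter_upwards [(chartAt (ℝ × ℂ × ℂ) p).open_target.mem_nhds ht] with u hu
  exact (chartAt (ℝ × ℂ × ℂ) p).right_inv hu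

/-! ### The connection form and its curvature in the charts of the pull-back -/

namespace Pullback

variable {F : FuchsianPair S S'} {Λ : C(S, S × S)}

/-- The first component of the lift of `Λ` to `ℍ × ℍ` near `n`, in the chart at `n`. -/
def leftLift (n : F.Pullback Λ) (z : ℂ) : ℂ := n.leftInv (Λ ((chartAt ℂ n.pt).symm z)).1

/-- The second component of the lift of `Λ` to `ℍ × ℍ` near `n`, in the chart at `n`. -/
def rightLift (n : F.Pullback Λ) (z : ℂ) : ℂ := n.rightInv (Λ ((chartAt ℂ n.pt).symm z)).2

/-- The unit timelike vector with coordinates `u` in the local trivialization near `n`. -/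
def chartVector (n : F.Pullback Λ) (u : ℂ × ℝ) : UnitTimelike :=
  n.vector ((chartAt ℂ n.pt).symm u.1) u.2

lemma modelCoords_chartVector (n : F.Pullback Λ) (u : ℂ × ℝ) :
    (n.chartVector u).modelCoords = (u.2, n.leftLift u.1, n.rightLift u.1) := by
  have h : (n.chartVector u).coords = _ := coordHomeo.apply_symm_apply _
  rw [UnitTimelike.modelCoords, h]
  rfl

lemma leftLift_im_pos (n : F.Pullback Λ) (z : ℂ) : 0 < (n.leftLift z).im :=
  UpperHalfPlane.im_pos _

lemma rightLift_im_pos (n : F.Pullback Λ) (z : ℂ) : 0 < (n.rightLift z).im :=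
  UpperHalfPlane.im_pos _

lemma isManifold_upperHalfPlane : IsManifold 𝓘(ℝ, ℂ) ∞ ℍ :=
  UpperHalfPlane.isOpenEmbedding_coe.isManifold_singleton

lemma contMDiff_upperHalfPlane_coe :
    ContMDiff 𝓘(ℝ, ℂ) 𝓘(ℝ, ℂ) ∞ ((↑) : ℍ → ℂ) :=
  haveI := isManifold_upperHalfPlane
  fun _ => contMDiffAt_extChartAt

lemma pt_chart_symm (n : F.Pullback Λ) {u : ℂ × ℝ} (hu : u ∈ n.chartTarget) :
    (n.chart.symm u).pt = (chartAt ℂ n.pt).symm u.1 :=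
  congrArg Prod.fst (n.pointOver_val u.2 hu.2.1 hu.2.2.1)

lemma incl_chart_symm (n : F.Pullback Λ) {u : ℂ × ℝ} (hu : u ∈ n.chartTarget) :
    (n.chart.symm u).incl = F.toQuot (n.chartVector u) :=
  congrArg Prod.snd (n.pointOver_val u.2 hu.2.1 hu.2.2.1)

lemma isOpen_chartTarget (n : F.Pullback Λ) : IsOpen n.chartTarget := n.chart.open_target

lemma continuousAt_chartVector (n : F.Pullback Λ) {u : ℂ × ℝ} (hu : u ∈ n.chartTarget) :
    ContinuousAt n.chartVector u :=
  (n.continuousOn_vector.mono fun _ h => ⟨h.1, h.2.1, h.2.2.1⟩).continuousAt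
    (n.isOpen_chartTarget.mem_nhds hu)

lemma contDiffAt_leftLift [IsManifold 𝓘(ℝ, ℂ) ∞ S]
    (hΛ : ContMDiff 𝓘(ℝ, ℂ) (𝓘(ℝ, ℂ).prod 𝓘(ℝ, ℂ)) ∞ Λ)
    (n : F.Pullback Λ) {z : ℂ} (hz : z ∈ (chartAt ℂ n.pt).target)
    (hl : (Λ ((chartAt ℂ n.pt).symm z)).1 ∈ n.leftInv.source) :
    ContDiffAt ℝ ∞ n.leftLift z := by
  have h1 : ContMDiffAt 𝓘(ℝ, ℂ) 𝓘(ℝ, ℂ) ∞ (chartAt ℂ n.pt).symm z :=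
    (contMDiffOn_chart_symm (I := 𝓘(ℝ, ℂ))).contMDiffAt
      ((chartAt ℂ n.pt).open_target.mem_nhds hz)
  have h2 : ContMDiffAt 𝓘(ℝ, ℂ) 𝓘(ℝ, ℂ) ∞ (fun z => (Λ ((chartAt ℂ n.pt).symm z)).1) z :=
    (contMDiff_fst.comp hΛ).contMDiffAt.comp z h1
  have h3 : ContMDiffAt 𝓘(ℝ, ℂ) 𝓘(ℝ, ℂ) ∞ n.leftInv (Λ ((chartAt ℂ n.pt).symm z)).1 :=
    contMDiffAt_localInverseAt F.left.isLocalDiffeomorph _ _ hl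
  exact contMDiffAt_iff_contDiffAt.1
    ((contMDiff_upperHalfPlane_coe.contMDiffAt).comp z (h3.comp z h2))

lemma contDiffAt_rightLift [IsManifold 𝓘(ℝ, ℂ) ∞ S]
    (hΛ : ContMDiff 𝓘(ℝ, ℂ) (𝓘(ℝ, ℂ).prod 𝓘(ℝ, ℂ)) ∞ Λ)
    (n : F.Pullback Λ) {z : ℂ} (hz : z ∈ (chartAt ℂ n.pt).target)
    (hr : (Λ ((chartAt ℂ n.pt).symm z)).2 ∈ n.rightInv.source) :
    ContDiffAt ℝ ∞ n.rightLift z := by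
  have h1 : ContMDiffAt 𝓘(ℝ, ℂ) 𝓘(ℝ, ℂ) ∞ (chartAt ℂ n.pt).symm z :=
    (contMDiffOn_chart_symm (I := 𝓘(ℝ, ℂ))).contMDiffAt
      ((chartAt ℂ n.pt).open_target.mem_nhds hz)
  have h2 : ContMDiffAt 𝓘(ℝ, ℂ) 𝓘(ℝ, ℂ) ∞ (fun z => (Λ ((chartAt ℂ n.pt).symm z)).2) z :=
    (contMDiff_snd.comp hΛ).contMDiffAt.comp z h1
  have h3 : ContMDiffAt 𝓘(ℝ, ℂ) 𝓘(ℝ, ℂ) ∞ n.rightInv (Λ ((chartAt ℂ n.pt).symm z)).2 :=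
    contMDiffAt_localInverseAt F.right.isLocalDiffeomorph _ _ hr
  exact contMDiffAt_iff_contDiffAt.1
    ((contMDiff_upperHalfPlane_coe.contMDiffAt).comp z (h3.comp z h2))

/-- The fibre coordinate of the chart is `θ` itself, so in coordinates the local trivialization is
`(z, t) ↦ (t, L z, R z)`. -/
lemma hasFDerivAt_chartVector [IsManifold 𝓘(ℝ, ℂ) ∞ S]
    (hΛ : ContMDiff 𝓘(ℝ, ℂ) (𝓘(ℝ, ℂ).prod 𝓘(ℝ, ℂ)) ∞ Λ)
    (n : F.Pullback Λ) {u : ℂ × ℝ} (hu : u ∈ n.chartTarget) :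
    ∃ W' : ℂ × ℝ →L[ℝ] ℝ × ℂ × ℂ,
      HasFDerivAt (fun u => (n.chartVector u).modelCoords) W' u ∧
      ∀ a, W' a = (a.2, fderiv ℝ n.leftLift u.1 a.1, fderiv ℝ n.rightLift u.1 a.1) := by
  have h1 := ((n.contDiffAt_leftLift hΛ hu.1 hu.2.1).differentiableAt (by simp)).hasFDerivAt
  have h2 := ((n.contDiffAt_rightLift hΛ hu.1 hu.2.2.1).differentiableAt (by simp)).hasFDerivAt
  have h := (hasFDerivAt_snd (𝕜 := ℝ) (p := u)).prodMk
    ((h1.comp u (hasFDerivAt_fst (𝕜 := ℝ))).prodMk (h2.comp u (hasFDerivAt_fst (𝕜 := ℝ))))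
  exact ⟨_, h.congr_of_eventuallyEq (Filter.Eventually.of_forall n.modelCoords_chartVector),
    fun a => rfl⟩

/-- The lift of the inverse of a chart through a local section of `T¹ → P_ρ`. -/
lemma hasFDerivAt_localSection_incl [IsManifold 𝓘(ℝ, ℂ) ∞ S]
    (hΛ : ContMDiff 𝓘(ℝ, ℂ) (𝓘(ℝ, ℂ).prod 𝓘(ℝ, ℂ)) ∞ Λ)
    (n : F.Pullback Λ) {u : ℂ × ℝ} (hu : u ∈ n.chartTarget) {q : F.TotalSpace}
    (hq : (n.chart.symm u).incl ∈ (F.localSection q).source) :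
    ∃ V' : ℂ × ℝ →L[ℝ] ℝ × ℂ × ℂ,
      HasFDerivAt (fun u => (F.localSection q (n.chart.symm u).incl).modelCoords) V' u ∧
      ∀ a, modelForm (F.localSection q (n.chart.symm u).incl).modelCoords (V' a) =
        modelForm (u.2, n.leftLift u.1, n.rightLift u.1)
          (a.2, fderiv ℝ n.leftLift u.1 a.1, fderiv ℝ n.rightLift u.1 a.1) := by
  obtain ⟨W', hW, hW'⟩ := n.hasFDerivAt_chartVector hΛ hu
  rw [n.incl_chart_symm hu] at hq
  -- The section at `q` need not be the one used for the chart at `n`; the two lifts differ by an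
  -- isometry, which leaves the connection form unchanged.
  obtain ⟨g, hg⟩ := F.exists_localSection_toQuot_eq (n.continuousAt_chartVector hu) hq
  obtain ⟨V', hV, hV'⟩ := exists_hasFDerivAt_pairAct g hW
  refine ⟨V', hV.congr_of_eventuallyEq ?_, fun a => ?_⟩
  · filter_upwards [hg, n.isOpen_chartTarget.mem_nhds hu] with u' h1 h2
    rw [n.incl_chart_symm h2, h1]
  · rw [n.incl_chart_symm hu, hg.self_of_nhds, hV', hW', modelCoords_chartVector]

/-- The chart of `P_ρ` at the image of `n` is the local section followed by the coordinates, so the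
coordinate expression is the lift just differentiated, with `q` the image of `n`. -/
lemma mdifferentiableAt_incl [IsManifold 𝓘(ℝ, ℂ) ∞ S]
    (hΛ : ContMDiff 𝓘(ℝ, ℂ) (𝓘(ℝ, ℂ).prod 𝓘(ℝ, ℂ)) ∞ Λ)
    (n : F.Pullback Λ) : MDifferentiableAt 𝓘(ℝ, ℂ × ℝ) 𝓘(ℝ, ℝ × ℂ × ℂ)
    (incl : F.Pullback Λ → F.TotalSpace) n := by
  have hn := n.mem_dom_self
  have hs : n.chart.symm (n.chart n) = n := n.chart.left_inv hn
  obtain ⟨V', hV, -⟩ := n.hasFDerivAt_localSection_incl hΛ (u := n.chart n) (q := n.incl)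
    (n.chart.map_source hn) (by rw [hs]; exact F.mem_localSection_source _)
  exact (hasMFDerivAt_of_hasFDerivAt_chart (f' := V') continuous_incl.continuousAt
    hV).mdifferentiableAt

/-- At `m = n.chart.symm u` the tangent space is read in the chart at `m`, so this is a change of
charts. Its first component is a change of charts of `S`, and its second is the `θ` coordinate of
the lift through the section at the image of `m`. -/
lemma mdifferentiableAt_chart_symm [IsManifold 𝓘(ℝ, ℂ) ∞ S]
    (hΛ : ContMDiff 𝓘(ℝ, ℂ) (𝓘(ℝ, ℂ).prod 𝓘(ℝ, ℂ)) ∞ Λ)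
    (n : F.Pullback Λ) {u : ℂ × ℝ} (hu : u ∈ n.chartTarget) :
    MDifferentiableAt 𝓘(ℝ, ℂ × ℝ) 𝓘(ℝ, ℂ × ℝ) n.chart.symm u := by
  set m := n.chart.symm u with hm
  obtain ⟨V', hV, -⟩ := n.hasFDerivAt_localSection_incl hΛ (q := m.incl) hu
    (F.mem_localSection_source _)
  have hpt : m.pt = (chartAt ℂ n.pt).symm u.1 := n.pt_chart_symm hu
  have h1 : ContMDiffAt 𝓘(ℝ, ℂ) 𝓘(ℝ, ℂ) ∞ (chartAt ℂ n.pt).symm u.1 :=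
    (contMDiffOn_chart_symm (I := 𝓘(ℝ, ℂ))).contMDiffAt
      ((chartAt ℂ n.pt).open_target.mem_nhds hu.1)
  have h2 : ContMDiffAt 𝓘(ℝ, ℂ) 𝓘(ℝ, ℂ) ∞ (chartAt ℂ m.pt) ((chartAt ℂ n.pt).symm u.1) := by
    refine (contMDiffOn_chart (I := 𝓘(ℝ, ℂ))).contMDiffAt
      ((chartAt ℂ m.pt).open_source.mem_nhds ?_)
    rw [← hpt]
    exact mem_chart_source _ _
  have h3 := ((contMDiffAt_iff_contDiffAt.1 (h2.comp u.1 h1)).differentiableAt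
    (by simp)).hasFDerivAt
  have h := (h3.comp u (hasFDerivAt_fst (𝕜 := ℝ))).prodMk hV.fst
  refine (hasMFDerivAt_of_hasFDerivAt_chart (n.chart.symm.continuousAt hu)
    (h.congr_of_eventuallyEq ?_)).mdifferentiableAt
  filter_upwards [n.isOpen_chartTarget.mem_nhds hu] with u' hu'
  have h4 := n.pt_chart_symm hu'
  change (chartAt ℂ m.pt (n.chart.symm u').pt, _) = _
  rw [h4]
  rfl

/-- The connection form of the pull-back in the local trivialization near `n`. -/
lemma pullbackConnForm_chart_symm [IsManifold 𝓘(ℝ, ℂ) ∞ S]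
    (hΛ : ContMDiff 𝓘(ℝ, ℂ) (𝓘(ℝ, ℂ).prod 𝓘(ℝ, ℂ)) ∞ Λ)
    (n : F.Pullback Λ) {u : ℂ × ℝ} (hu : u ∈ n.chartTarget) (a : ℂ × ℝ) :
    F.pullbackConnForm Λ (n.chart.symm u)
        (mfderiv 𝓘(ℝ, ℂ × ℝ) 𝓘(ℝ, ℂ × ℝ) n.chart.symm u a) =
      modelForm (u.2, n.leftLift u.1, n.rightLift u.1)
        (a.2, fderiv ℝ n.leftLift u.1 a.1, fderiv ℝ n.rightLift u.1 a.1) := by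
  set m := n.chart.symm u with hm
  obtain ⟨V', hV, hV'⟩ := n.hasFDerivAt_localSection_incl hΛ (q := m.incl) hu
    (F.mem_localSection_source _)
  have h1 := (n.mdifferentiableAt_chart_symm hΛ hu).hasMFDerivAt
  have h2 := (m.mdifferentiableAt_incl hΛ).hasMFDerivAt
  have h3 := (F.mdifferentiableAt_localSection m.incl).hasMFDerivAt
  -- The form on the left is built from three successive differentials; by uniqueness their
  -- composite is the derivative `V'` of the lift, on which the value of the model form is known.
  have h4 := h3.comp u (h2.comp u h1)
  have h5 : HasMFDerivAt 𝓘(ℝ, ℂ × ℝ) 𝓘(ℝ, ℝ × ℂ × ℂ)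
      ((F.localSection m.incl) ∘ (incl : F.Pullback Λ → F.TotalSpace) ∘ n.chart.symm) u V' :=
    hasMFDerivAt_of_hasFDerivAt_chart h4.continuousAt hV
  have h6 := DFunLike.congr_fun (hasMFDerivAt_unique h4 h5) a
  have h7 := (connForm_apply (F.localSection m.incl m.incl) (V' a)).trans (hV' a)
  exact (congrArg (UnitTimelike.connForm (F.localSection m.incl m.incl)) h6).trans h7

/-- The curvature of the pull-back in the local trivialization near `n`. -/
lemma pullbackCurvature_eq_modelArea [IsManifold 𝓘(ℝ, ℂ) ∞ S]
    (hΛ : ContMDiff 𝓘(ℝ, ℂ) (𝓘(ℝ, ℂ).prod 𝓘(ℝ, ℂ)) ∞ Λ)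
    (n : F.Pullback Λ) (v w : ℂ × ℝ) :
    F.pullbackCurvature Λ n v w =
      (modelArea (n.leftLift (chartAt ℂ n.pt n.pt))
          (fderiv ℝ n.leftLift (chartAt ℂ n.pt n.pt) v.1)
          (fderiv ℝ n.leftLift (chartAt ℂ n.pt n.pt) w.1) -
        modelArea (n.rightLift (chartAt ℂ n.pt n.pt))
          (fderiv ℝ n.rightLift (chartAt ℂ n.pt n.pt) v.1)
          (fderiv ℝ n.rightLift (chartAt ℂ n.pt n.pt) w.1)) / 2 := by
  have hp : n.chart n ∈ n.chartTarget := n.chart.map_source n.mem_dom_self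
  have hL := (n.contDiffAt_leftLift hΛ hp.1 hp.2.1).of_le (m := 2) two_le_infty
  have hR := (n.contDiffAt_rightLift hΛ hp.1 hp.2.2.1).of_le (m := 2) two_le_infty
  refine Eq.trans ?_ (fderiv_modelForm hL hR (n.leftLift_im_pos _).ne' (n.rightLift_im_pos _).ne'
    v w)
  -- The exterior derivative differentiates the coefficients, so the local formula is needed on a
  -- neighbourhood and not only at the point.
  have key : ∀ a : ℂ × ℝ, (fun u => F.pullbackConnForm Λ (n.chart.symm u)
      (mfderiv 𝓘(ℝ, ℂ × ℝ) 𝓘(ℝ, ℂ × ℝ) n.chart.symm u a)) =ᶠ[𝓝 (n.chart n)]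
      fun u => modelForm (u.2, n.leftLift u.1, n.rightLift u.1)
        (a.2, fderiv ℝ n.leftLift u.1 a.1, fderiv ℝ n.rightLift u.1 a.1) := fun a => by
    filter_upwards [n.isOpen_chartTarget.mem_nhds hp] with u hu
    exact n.pullbackConnForm_chart_symm hΛ hu a
  have hvw := congrArg₂ (fun A B : ℂ × ℝ →L[ℝ] ℝ => A v - B w) (key w).fderiv_eq (key v).fderiv_eq
  refine Eq.trans ?_ hvw
  rfl

/-! ### Comparison of the curvature with the symplectic form -/

/-- Chain rule: `leftLift` is the coordinate expression at `n.pt` of the local inverse composed with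
the first component of `Λ`. -/
lemma mfderiv_leftInv_eq
    (hΛ : ContMDiff 𝓘(ℝ, ℂ) (𝓘(ℝ, ℂ).prod 𝓘(ℝ, ℂ)) ∞ Λ)
    (n : F.Pullback Λ) (v : ℂ) :
    mfderiv 𝓘(ℝ, ℂ) 𝓘(ℝ, ℂ) n.leftInv (Λ n.pt).1
        (mfderiv 𝓘(ℝ, ℂ) (𝓘(ℝ, ℂ).prod 𝓘(ℝ, ℂ)) Λ n.pt v).1 =
      fderiv ℝ n.leftLift (chartAt ℂ n.pt n.pt) v := by
  have h1 := (hΛ.mdifferentiableAt (x := n.pt) (by simp)).hasMFDerivAt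
  have h2 : MDifferentiableAt 𝓘(ℝ, ℂ) 𝓘(ℝ, ℂ) n.leftInv (Λ n.pt).1 :=
    (contMDiffAt_localInverseAt F.left.isLocalDiffeomorph _ _
      n.mem_dom_self.2.2.1).mdifferentiableAt (by simp)
  have h3 := h2.hasMFDerivAt.comp n.pt ((hasMFDerivAt_fst (Λ n.pt)).comp n.pt h1)
  have h4 := (UpperHalfPlane.hasFDerivAt_coe_of_hasMFDerivAt h3).fderiv
  exact (congrArg (fun D : ℂ →L[ℝ] ℂ => D v) h4).symm

lemma mfderiv_rightInv_eq
    (hΛ : ContMDiff 𝓘(ℝ, ℂ) (𝓘(ℝ, ℂ).prod 𝓘(ℝ, ℂ)) ∞ Λ)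
    (n : F.Pullback Λ) (v : ℂ) :
    mfderiv 𝓘(ℝ, ℂ) 𝓘(ℝ, ℂ) n.rightInv (Λ n.pt).2
        (mfderiv 𝓘(ℝ, ℂ) (𝓘(ℝ, ℂ).prod 𝓘(ℝ, ℂ)) Λ n.pt v).2 =
      fderiv ℝ n.rightLift (chartAt ℂ n.pt n.pt) v := by
  have h1 := (hΛ.mdifferentiableAt (x := n.pt) (by simp)).hasMFDerivAt
  have h2 : MDifferentiableAt 𝓘(ℝ, ℂ) 𝓘(ℝ, ℂ) n.rightInv (Λ n.pt).2 :=
    (contMDiffAt_localInverseAt F.right.isLocalDiffeomorph _ _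
      n.mem_dom_self.2.2.2.1).mdifferentiableAt (by simp)
  have h3 := h2.hasMFDerivAt.comp n.pt ((hasMFDerivAt_snd (Λ n.pt)).comp n.pt h1)
  have h4 := (UpperHalfPlane.hasFDerivAt_coe_of_hasMFDerivAt h3).fderiv
  exact (congrArg (fun D : ℂ →L[ℝ] ℂ => D v) h4).symm

/-- The curvature of the pull-back is half the pull-back of the symplectic form. -/
theorem pullbackCurvature_eq [IsManifold 𝓘(ℝ, ℂ) ∞ S]
    (hΛ : ContMDiff 𝓘(ℝ, ℂ) (𝓘(ℝ, ℂ).prod 𝓘(ℝ, ℂ)) ∞ Λ)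
    (n : F.Pullback Λ) [SimplyConnectedSpace S'] (v w : ℂ × ℝ) :
    F.pullbackCurvature Λ n v w =
      F.symplecticForm (Λ n.pt) (mfderiv 𝓘(ℝ, ℂ) (𝓘(ℝ, ℂ).prod 𝓘(ℝ, ℂ)) Λ n.pt v.1)
        (mfderiv 𝓘(ℝ, ℂ) (𝓘(ℝ, ℂ).prod 𝓘(ℝ, ℂ)) Λ n.pt w.1) / 2 := by
  rw [n.pullbackCurvature_eq_modelArea hΛ, symplecticForm]
  -- `Ω_ρ` is defined with a local inverse chosen from the point of `S` alone, whereas the chart at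
  -- `n` uses the one through the geodesic of a representative of `n`.
  have hl := F.left.area_eq F.isCoveringMap F.surjective_quot_left (F.rep n.incl).proj.1
    n.mem_dom_self.2.2.1
    (mfderiv 𝓘(ℝ, ℂ) (𝓘(ℝ, ℂ).prod 𝓘(ℝ, ℂ)) Λ n.pt v.1).1
    (mfderiv 𝓘(ℝ, ℂ) (𝓘(ℝ, ℂ).prod 𝓘(ℝ, ℂ)) Λ n.pt w.1).1
  have hr := F.right.area_eq F.isCoveringMap F.surjective_quot_right (F.rep n.incl).proj.2
    n.mem_dom_self.2.2.2.1
    (mfderiv 𝓘(ℝ, ℂ) (𝓘(ℝ, ℂ).prod 𝓘(ℝ, ℂ)) Λ n.pt v.1).2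
    (mfderiv 𝓘(ℝ, ℂ) (𝓘(ℝ, ℂ).prod 𝓘(ℝ, ℂ)) Λ n.pt w.1).2
  have hs : (chartAt ℂ n.pt).symm (chartAt ℂ n.pt n.pt) = n.pt :=
    (chartAt ℂ n.pt).left_inv (mem_chart_source _ _)
  have hl0 : n.leftLift (chartAt ℂ n.pt n.pt) = n.leftInv (Λ n.pt).1 := by rw [leftLift, hs]
  have hr0 : n.rightLift (chartAt ℂ n.pt n.pt) = n.rightInv (Λ n.pt).2 := by rw [rightLift, hs]
  rw [hl0, hr0, ← n.mfderiv_leftInv_eq hΛ, ← n.mfderiv_leftInv_eq hΛ,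
    ← n.mfderiv_rightInv_eq hΛ, ← n.mfderiv_rightInv_eq hΛ]
  exact congrArg₂ (fun a b : ℝ => (a - b) / 2) hl.symm hr.symm

/-- Every lift of a point of `Λ(S)` to `M_ρ` is covered by a point of the pull-back. -/
lemma exists_pt_eq {s : S} {b : F.Base} (hb : F.baseToProd b = Λ s) :
    ∃ n : F.Pullback Λ, n.pt = s ∧ F.toBase n.incl = b := by
  obtain ⟨w, rfl⟩ := Quotient.exists_rep b
  -- Any point of the fibre over `w` would do; the one with `θ = 0` is taken.
  have hw : F.toBase (F.toQuot (frame (0, w))) = Quotient.mk _ w := by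
    have h : (frame (0, w)).proj = w := congrArg Prod.snd (coordEquiv.right_inv (0, w))
    exact congrArg (Quotient.mk _) h
  exact ⟨ofPair s (F.toQuot (frame (0, w))) (by rw [toProd, hw, hb]), rfl, hw⟩

end Pullback

lemma surjective_baseToProd (F : FuchsianPair S S') : Function.Surjective F.baseToProd := by
  rintro ⟨s, t⟩
  obtain ⟨z, rfl⟩ := F.surjective_quot_left s
  obtain ⟨w, rfl⟩ := F.surjective_quot_right t
  exact ⟨Quotient.mk _ (z, w), rfl⟩

end FuchsianPair

end AdSLagrangian

end

/-! ### The theorem -/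

theorem mainTheorem5 {S S' : Type*}
    [TopologicalSpace S] [CompactSpace S] [T2Space S]
    [ChartedSpace ℂ S] [IsManifold 𝓘(ℝ, ℂ) ∞ S] [AdSLagrangian.OrientedAtlas S]
    [TopologicalSpace S'] [SimplyConnectedSpace S']
    (F : AdSLagrangian.FuchsianPair S S') (Λ : C(S, S × S))
    (hΛ : Manifold.IsSmoothEmbedding 𝓘(ℝ, ℂ) (𝓘(ℝ, ℂ).prod 𝓘(ℝ, ℂ)) ∞ Λ) :
    (F.IsLagrangian Λ ↔ F.IsFlatPullback Λ) ∧
      ∀ Λ' : C(S, F.Base), (∀ s, F.baseToProd (Λ' s) = Λ s) →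
        (F.IsLagrangian Λ ↔ F.IsFlatAlong Λ Λ') := by
  have hsm := hΛ.contMDiff
  have flat : F.IsLagrangian Λ → F.IsFlatPullback Λ := fun h n v w => by
    refine (n.pullbackCurvature_eq hsm v w).trans ?_
    exact (congrArg (· / 2) (h n.pt v.1 w.1)).trans (zero_div 2)
  -- Vanishing of the curvature at a single point over each `s` suffices, since it equals half of
  -- `Λ^*Ω_ρ` at `s` whichever point is taken. This serves both equivalences.
  have lag : (∀ s, ∃ n : F.Pullback Λ, n.pt = s ∧
      ∀ v w : ℂ × ℝ, F.pullbackCurvature Λ n v w = 0) → F.IsLagrangian Λ := fun h s v w => by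
    obtain ⟨n, rfl, hn⟩ := h s
    -- Any lifts of `v` and `w` give the same value, because the fibre direction does not enter the
    -- curvature.
    have h1 := (n.pullbackCurvature_eq hsm (v, 0) (w, 0)).symm.trans (hn _ _)
    exact (div_eq_zero_iff.1 h1).resolve_right two_ne_zero
  refine ⟨⟨flat, fun h => lag fun s => ?_⟩, fun Λ' hΛ' => ⟨fun h n _ => flat h n, fun h =>
    lag fun s => ?_⟩⟩
  · obtain ⟨b, hb⟩ := F.surjective_baseToProd (Λ s)
    obtain ⟨n, hn, -⟩ := AdSLagrangian.FuchsianPair.Pullback.exists_pt_eq hb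
    exact ⟨n, hn, h n⟩
  · obtain ⟨n, rfl, hn⟩ := AdSLagrangian.FuchsianPair.Pullback.exists_pt_eq (hΛ' s)
    exact ⟨n, rfl, h n hn⟩
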